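/- For a Hermitian operator $P$ on $\mathbb{C}^d\otimes\mathbb{C}^d$ let $$\nu(P)=\max\{\operatorname{tr}[(|\varphi_1\rangle\langle\varphi_1|\otimes|\varphi_2\rangle\langle\varphi_2|)\,P] : \varphi_1,\varphi_2\in\mathbb{C}^d,\ \|\varphi_1\|=\|\varphi_2\|=1\}.$$ Let $d\ge 1$ and $x\ge 1$ be integers such that $r=d^2-2(d-1)-x\ge 0$, and let $\Pi$ be the orthogonal projector onto a uniformly random $r$-dimensional subspace of $\mathbb{C}^d\otimes\mathbb{C}^d$; that is, $\Pi=U P_0 U^\dagger$, where $P_0$ is any fixed orthogonal projector of rank $r$ and $U$ is a Haar-distributed unitary on $\mathbb{C}^d\otimes\mathbb{C}^d$. Then $$\Pr_\Pi\left[\nu(\Pi)\ge 1-d^{-2-2d/x}\right]\le d^{-d}.$$ -/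

import Mathlib

open scoped Kronecker Matrix

noncomputable section

instance unitaryGroupMeasurableSpace (n : Type) [Fintype n] [DecidableEq n] :
    MeasurableSpace (Matrix.unitaryGroup n ℂ) := borel _

instance unitaryGroupBorelSpace (n : Type) [Fintype n] [DecidableEq n] :
    BorelSpace (Matrix.unitaryGroup n ℂ) := ⟨rfl⟩

instance unitaryGroupCompactSpace (n : Type) [Fintype n] [DecidableEq n] :
    CompactSpace (Matrix.unitaryGroup n ℂ) := by
  have hK : IsCompact (Set.univ.pi fun _ : n => Set.univ.pi fun _ : n =>
      Metric.closedBall (0 : ℂ) 1) :=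
    isCompact_univ_pi fun _ => isCompact_univ_pi fun _ => isCompact_closedBall _ _
  have hc : IsClosed (Matrix.unitaryGroup n ℂ : Set (Matrix n n ℂ)) := isClosed_unitary
  refine isCompact_iff_compactSpace.mp (hK.of_isClosed_subset hc ?_)
  intro U hU i _ j _
  simpa using entry_norm_bound_of_unitary hU i j

/-- The Haar probability measure on the unitary group. -/
def haarUnitary (n : Type) [Fintype n] [DecidableEq n] :
    MeasureTheory.Measure (Matrix.unitaryGroup n ℂ) :=
  MeasureTheory.Measure.haarMeasure ⊤

instance haarUnitaryIsProbabilityMeasure (n : Type) [Fintype n] [DecidableEq n] :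
    MeasureTheory.IsProbabilityMeasure (haarUnitary n) :=
  ⟨MeasureTheory.Measure.haarMeasure_self⟩

instance haarUnitaryIsHaarMeasure (n : Type) [Fintype n] [DecidableEq n] :
    (haarUnitary n).IsHaarMeasure :=
  inferInstanceAs (MeasureTheory.Measure.haarMeasure _).IsHaarMeasure

/-- The density matrix `|φ⟩⟨φ|` of a vector `φ`. -/
def pureState {n : Type} (φ : EuclideanSpace ℂ n) : Matrix n n ℂ :=
  Matrix.vecMulVec (fun i => φ i) (fun i => star (φ i))

/-- The overlap `tr ((|φ⟩⟨φ| ⊗ |ψ⟩⟨ψ|) P)`; it is a real number when `P` is Hermitian. -/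
def productOverlap {m n : Type} [Fintype m] [Fintype n]
    (P : Matrix (m × n) (m × n) ℂ) (φ : EuclideanSpace ℂ m) (ψ : EuclideanSpace ℂ n) : ℝ :=
  (Matrix.trace ((pureState φ ⊗ₖ pureState ψ) * P)).re

/-- The maximal overlap of `P` with a product of two unit vectors. -/
def maxProductOverlap {m n : Type} [Fintype m] [Fintype n]
    (P : Matrix (m × n) (m × n) ℂ) : ℝ :=
  sSup {t : ℝ | ∃ (φ : EuclideanSpace ℂ m) (ψ : EuclideanSpace ℂ n),
    ‖φ‖ = 1 ∧ ‖ψ‖ = 1 ∧ productOverlap P φ ψ = t}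

/-- On nonzero spaces, the supremum defining `maxProductOverlap` is an attained maximum. -/
theorem isGreatest_maxProductOverlap {m n : Type} [Fintype m] [Fintype n]
    [Nonempty m] [Nonempty n] (P : Matrix (m × n) (m × n) ℂ) :
    IsGreatest {t : ℝ | ∃ (φ : EuclideanSpace ℂ m) (ψ : EuclideanSpace ℂ n),
      ‖φ‖ = 1 ∧ ‖ψ‖ = 1 ∧ productOverlap P φ ψ = t} (maxProductOverlap P) := by
  have hcont : Continuous fun p : EuclideanSpace ℂ m × EuclideanSpace ℂ n =>
      productOverlap P p.1 p.2 := by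
    simp only [productOverlap, Matrix.trace, Matrix.diag, Matrix.mul_apply,
      Matrix.kroneckerMap_apply, pureState, Matrix.vecMulVec_apply]
    fun_prop
  have hS : {t : ℝ | ∃ (φ : EuclideanSpace ℂ m) (ψ : EuclideanSpace ℂ n),
      ‖φ‖ = 1 ∧ ‖ψ‖ = 1 ∧ productOverlap P φ ψ = t} =
      (fun p : EuclideanSpace ℂ m × EuclideanSpace ℂ n => productOverlap P p.1 p.2) ''
        (Metric.sphere 0 1 ×ˢ Metric.sphere 0 1) := by
    ext t
    simp
  have hne : (Metric.sphere (0 : EuclideanSpace ℂ m) 1 ×ˢ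
      Metric.sphere (0 : EuclideanSpace ℂ n) 1).Nonempty :=
    (NormedSpace.sphere_nonempty.mpr zero_le_one).prod
      (NormedSpace.sphere_nonempty.mpr zero_le_one)
  rw [maxProductOverlap, hS]
  exact (((isCompact_sphere _ _).prod (isCompact_sphere _ _)).image hcont).isGreatest_sSup
    (hne.image _)

end

open scoped ComplexOrder
open MeasureTheory Filter Topology

noncomputable section

/-! Write d = m + 1, ε = d^(-2-2d/x), and let Q = 1 - Π, a random projector of rank 2m + x. The
event ν(Π) ≥ 1 - ε says that the least value l of ⟨φ⊗ψ, Q φ⊗ψ⟩ over unit product vectors is at most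
ε. A minimiser is a critical point of this function on the manifold of product states, which has
real dimension 4m, so the probability can be bounded by a Kac–Rice argument that counts critical
points of low value. Limits are taken by Fatou's lemma, and no coarea formula is needed.

Lower bound on the event. Let N be the compression of Q to the tangent space at a product state.
Average over all product states the weight det(N + τ)², restricted to squared gradient < t² and
value < e, where e > ε and τ > 0. Near a minimiser the gradient is to first order the real-linear
map k ↦ (N - l)k + C k̄ with C complex symmetric. Minimality, combined with a rotation of the phase
of k, gives |k̄ᵀ C k̄| ≤ k*(N - l)k, and this forces |det(k ↦ (N + τ)k + C k̄)| ≤ det(N + τ)²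
(`abs_det_conjLinear_le`). The region of small gradient is therefore large enough to compensate the
weight: the average divided by t^(4m) has liminf at least m!²/(2m)!, whatever Q is
(`tendsto_productWeight`, `le_liminf_averagedWeight`).

Upper bound in expectation. By unitary invariance the expected average equals the expected weight at
one fixed product state (`lintegral_haarUnitary_averagedWeight`). Moreover Q has the law of the
projection onto the row space of a (2m + x) × d² Gaussian matrix
(`lintegral_haarUnitary_eq_gaussPi`). Let a be the column at the base state, B the other columns and
K = BB*. The value and the gradient are explicit in a by a rank-one update, and given B the
admissible a lie in a set of volume at most that of a ball in ℂ^(2m) times a ball in ℂ^x, times det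
K / det N, where N is now formed from B (`volume_inter_le`). The second ball, of squared radius
e/(1-e), is the source of the factor ε^x. There remains the mean of det(N + τ)² det K / det N. As τ
→ 0 it tends to the mean of det N · det K, which a block elimination bounds by a product of two
Gaussian Gram determinants (`lintegral_det_leftGram_mul_det_le`).

Letting τ → 0 and then e → ε gives the tail bound C(2m,m) C(2m+x,x) C(m²,x) ε^x / (1-ε)^(4m+x)
(`measureReal_maxProductOverlap_le`). Since ε^x = d^(-2x-2d), half of the factor d^(-2d) is left to
absorb the binomials (`tail_bound_le`). -/

/-- The squared Euclidean norm of a complex vector. -/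
def sqNorm {ι : Type*} [Fintype ι] (z : ι → ℂ) : ℝ := ∑ i, ‖z i‖ ^ 2

theorem sqNorm_nonneg {ι : Type*} [Fintype ι] (z : ι → ℂ) : 0 ≤ sqNorm z :=
  Finset.sum_nonneg fun _ _ => by positivity

@[fun_prop]
theorem continuous_sqNorm {ι : Type*} [Fintype ι] : Continuous (sqNorm : (ι → ℂ) → ℝ) := by
  unfold sqNorm
  fun_prop

theorem sqNorm_eq_dotProduct {ι : Type*} [Fintype ι] (z : ι → ℂ) :
    (sqNorm z : ℂ) = star z ⬝ᵥ z := by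
  simp only [sqNorm, dotProduct, Pi.star_apply, Complex.ofReal_sum]
  refine Finset.sum_congr rfl fun i _ => ?_
  have := Complex.normSq_eq_conj_mul_self (z := z i)
  rw [← Complex.normSq_eq_norm_sq, this]
  rfl

theorem sqNorm_unitary_mulVec {ι : Type*} [Fintype ι] [DecidableEq ι] {V : Matrix ι ι ℂ}
    (hV : Vᴴ * V = 1) (z : ι → ℂ) : sqNorm (V *ᵥ z) = sqNorm z := by
  have : ((sqNorm (V *ᵥ z) : ℝ) : ℂ) = sqNorm z := by
    rw [sqNorm_eq_dotProduct, sqNorm_eq_dotProduct, Matrix.star_mulVec, ← Matrix.dotProduct_mulVec,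
      Matrix.mulVec_mulVec, hV, Matrix.one_mulVec]
  exact_mod_cast this

/-! ### Complex Gaussian vectors -/

/-- The density of the standard complex Gaussian. -/
def gaussDensity (z : ℂ) : ℝ := Real.pi⁻¹ * Real.exp (-‖z‖ ^ 2)

theorem gaussDensity_nonneg (z : ℂ) : 0 ≤ gaussDensity z := by
  unfold gaussDensity; positivity

@[fun_prop]
theorem continuous_gaussDensity : Continuous gaussDensity := by
  unfold gaussDensity; fun_prop

theorem integral_norm_pow_mul_exp (q : ℕ) {b : ℝ} (hb : 0 < b) :
    ∫ z : ℂ, ‖z‖ ^ (2 * q) * Real.exp (-b * ‖z‖ ^ 2) =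
      Real.pi * q.factorial / b ^ (q + 1) := by
  have h := Complex.integral_rpow_mul_exp_neg_mul_rpow (p := 2) (q := (2 * q : ℕ)) (b := b)
    (by norm_num) (by have : (0:ℝ) ≤ ((2 * q : ℕ) : ℝ) := by positivity
                      linarith) hb
  simp only [Real.rpow_natCast] at h
  have h2 : ∀ z : ℂ, ‖z‖ ^ (2 : ℝ) = ‖z‖ ^ 2 := fun z => by norm_cast
  simp only [h2] at h
  rw [h]
  have : (((2 * q : ℕ) : ℝ) + 2) / 2 = (q : ℝ) + 1 := by push_cast; ring
  rw [this, Real.Gamma_nat_eq_factorial, neg_div, this, Real.rpow_neg hb.le]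
  have : b ^ ((q : ℝ) + 1) = b ^ (q + 1) := by exact_mod_cast Real.rpow_natCast b (q + 1)
  rw [this]
  field_simp

theorem integrable_norm_pow_mul_exp (q : ℕ) {b : ℝ} (hb : 0 < b) :
    Integrable fun z : ℂ => ‖z‖ ^ (2 * q) * Real.exp (-b * ‖z‖ ^ 2) := by
  by_contra h
  have h1 := integral_undef h
  rw [integral_norm_pow_mul_exp q hb] at h1
  have : 0 < Real.pi * q.factorial / b ^ (q + 1) := by positivity
  linarith

theorem integral_gaussDensity : ∫ z, gaussDensity z = 1 := by
  have h := integral_norm_pow_mul_exp 0 one_pos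
  simp only [mul_zero, pow_zero, one_mul, Nat.factorial_zero, Nat.cast_one, mul_one, one_pow,
    div_one, neg_mul] at h
  simp only [gaussDensity, integral_const_mul, h]
  field_simp

theorem integrable_gaussDensity : Integrable gaussDensity := by
  by_contra h
  have := integral_undef h
  rw [integral_gaussDensity] at this
  norm_num at this

/-- The standard complex Gaussian measure. -/
def gaussC : Measure ℂ := volume.withDensity fun z => ENNReal.ofReal (gaussDensity z)

instance : IsProbabilityMeasure gaussC := by
  constructor
  rw [gaussC, withDensity_apply _ MeasurableSet.univ, Measure.restrict_univ,
    ← ofReal_integral_eq_lintegral_ofReal integrable_gaussDensity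
      (Filter.Eventually.of_forall gaussDensity_nonneg), integral_gaussDensity, ENNReal.ofReal_one]

/-- The standard Gaussian measure on complex vectors. -/
def gaussPi (ι : Type*) [Fintype ι] : Measure (ι → ℂ) := Measure.pi fun _ => gaussC

instance (ι : Type*) [Fintype ι] : IsProbabilityMeasure (gaussPi ι) := by
  unfold gaussPi; infer_instance

theorem prod_gaussDensity {ι : Type*} [Fintype ι] (z : ι → ℂ) :
    ∏ i, gaussDensity (z i) = (Real.pi⁻¹) ^ Fintype.card ι * Real.exp (-sqNorm z) := by
  simp only [gaussDensity, Finset.prod_mul_distrib, Finset.prod_const, Finset.card_univ, sqNorm,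
    ← Real.exp_sum, Finset.sum_neg_distrib]

theorem gaussPi_eq_withDensity (ι : Type*) [Fintype ι] :
    gaussPi ι = volume.withDensity fun z : ι → ℂ =>
      ENNReal.ofReal ((Real.pi⁻¹) ^ Fintype.card ι * Real.exp (-sqNorm z)) := by
  refine Measure.pi_eq fun s hs => ?_
  rw [withDensity_apply _ (MeasurableSet.univ_pi hs)]
  have hi : ∀ i, Integrable ((s i).indicator gaussDensity) := fun i =>
    integrable_gaussDensity.indicator (hs i)
  have hp := Integrable.fintype_prod (𝕜 := ℝ) (f := fun i => (s i).indicator gaussDensity)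
    (μ := fun _ => (volume : Measure ℂ)) hi
  have hind : ∀ z : ι → ℂ, (Set.univ.pi s).indicator (fun z => ENNReal.ofReal
      ((Real.pi⁻¹) ^ Fintype.card ι * Real.exp (-sqNorm z))) z =
      ENNReal.ofReal (∏ i, (s i).indicator gaussDensity (z i)) := by
    intro z
    by_cases hz : z ∈ Set.univ.pi s
    · rw [Set.indicator_of_mem hz, ← prod_gaussDensity]
      congr 1
      refine Finset.prod_congr rfl fun i _ => ?_
      rw [Set.indicator_of_mem (hz i (Set.mem_univ i))]
    · rw [Set.indicator_of_notMem hz]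
      simp only [Set.mem_pi, Set.mem_univ, true_implies, not_forall] at hz
      obtain ⟨i, hi⟩ := hz
      rw [Finset.prod_eq_zero (Finset.mem_univ i) (Set.indicator_of_notMem hi _),
        ENNReal.ofReal_zero]
  rw [← lintegral_indicator (MeasurableSet.univ_pi hs)]
  rw [lintegral_congr hind, volume_pi, ← ofReal_integral_eq_lintegral_ofReal hp
    (Filter.Eventually.of_forall fun z => Finset.prod_nonneg fun i _ =>
      Set.indicator_nonneg (fun z _ => gaussDensity_nonneg z) _)]
  rw [integral_fintype_prod_eq_prod (𝕜 := ℝ) (fun i => (s i).indicator gaussDensity),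
    ENNReal.ofReal_prod_of_nonneg (fun i _ => integral_nonneg fun z =>
      Set.indicator_nonneg (fun z _ => gaussDensity_nonneg z) _)]
  refine Finset.prod_congr rfl fun i _ => ?_
  rw [ofReal_integral_eq_lintegral_ofReal (hi i) (Filter.Eventually.of_forall fun z =>
      Set.indicator_nonneg (fun z _ => gaussDensity_nonneg z) _), gaussC,
    withDensity_apply _ (hs i), ← lintegral_indicator (hs i)]
  refine lintegral_congr fun z => ?_
  by_cases hz : z ∈ s i <;> simp [hz]

theorem lintegral_gaussPi {ι : Type*} [Fintype ι] (F : (ι → ℂ) → ENNReal) (hF : Measurable F) :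
    ∫⁻ z, F z ∂gaussPi ι =
      ∫⁻ z, ENNReal.ofReal ((Real.pi⁻¹) ^ Fintype.card ι * Real.exp (-sqNorm z)) * F z := by
  rw [gaussPi_eq_withDensity, lintegral_withDensity_eq_lintegral_mul _ (by fun_prop) hF]
  rfl

/-! ### Volume under complex-linear maps and unitary invariance -/

theorem abs_det_restrictScalars_mulVecLin {ι : Type*} [Fintype ι] [DecidableEq ι]
    (M : Matrix ι ι ℂ) :
    |LinearMap.det ((Matrix.mulVecLin M).restrictScalars ℝ)| = ‖M.det‖ ^ 2 := by
  rw [LinearMap.det_restrictScalars, ← Matrix.toLin'_apply', LinearMap.det_toLin',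
    Algebra.norm_complex_apply, Complex.normSq_eq_norm_sq, abs_of_nonneg (by positivity)]

theorem volume_preimage_mulVec {ι : Type*} [Fintype ι] [DecidableEq ι] {M : Matrix ι ι ℂ}
    (hM : M.det ≠ 0) (s : Set (ι → ℂ)) :
    volume ((M *ᵥ ·) ⁻¹' s) = ENNReal.ofReal ((‖M.det‖ ^ 2)⁻¹) * volume s := by
  have h : LinearMap.det ((Matrix.mulVecLin M).restrictScalars ℝ) ≠ 0 := by
    rw [← abs_ne_zero, abs_det_restrictScalars_mulVecLin]
    positivity
  have := Measure.addHaar_preimage_linearMap volume h s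
  rw [abs_inv, abs_det_restrictScalars_mulVecLin] at this
  exact this

theorem map_gaussPi_unitary {ι : Type*} [Fintype ι] [DecidableEq ι] {V : Matrix ι ι ℂ}
    (hV : Vᴴ * V = 1) : (gaussPi ι).map (V *ᵥ ·) = gaussPi ι := by
  have hdet : ‖V.det‖ = 1 := by
    have := congrArg (fun M => ‖M.det‖) hV
    simp only [Matrix.det_mul, Matrix.det_conjTranspose, norm_mul, Matrix.det_one, norm_one] at this
    rw [norm_star] at this
    nlinarith [norm_nonneg V.det]
  have hm : Measurable (V *ᵥ · : (ι → ℂ) → ι → ℂ) := by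
    refine Continuous.measurable ?_
    fun_prop
  have hvol : MeasurePreserving (V *ᵥ · : (ι → ℂ) → ι → ℂ) volume volume := by
    refine ⟨hm, ?_⟩
    ext s hs
    rw [Measure.map_apply hm hs, volume_preimage_mulVec (by rw [← norm_ne_zero_iff, hdet]; norm_num),
      hdet]
    simp
  ext s hs
  rw [Measure.map_apply hm hs, gaussPi_eq_withDensity, withDensity_apply _ (hm hs),
    withDensity_apply _ hs, ← hvol.setLIntegral_comp_preimage hs (by fun_prop)]
  simp only [sqNorm_unitary_mulVec hV]

theorem lintegral_gaussPi_unitary {ι : Type*} [Fintype ι] [DecidableEq ι] {V : Matrix ι ι ℂ}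
    (hV : Vᴴ * V = 1) (F : (ι → ℂ) → ENNReal) (hF : Measurable F) :
    ∫⁻ z, F (V *ᵥ z) ∂gaussPi ι = ∫⁻ z, F z ∂gaussPi ι := by
  conv_rhs => rw [← map_gaussPi_unitary hV]
  rw [lintegral_map hF (Continuous.measurable (by fun_prop))]

theorem volume_sqNorm_lt {ι : Type*} [Fintype ι] (r : ℝ) (hr : 0 < r) :
    volume {z : ι → ℂ | sqNorm z < r} =
      ENNReal.ofReal (r ^ Fintype.card ι * Real.pi ^ Fintype.card ι / (Fintype.card ι).factorial) := by
  rcases isEmpty_or_nonempty ι with h | h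
  · have : {z : ι → ℂ | sqNorm z < r} = Set.univ := by
      ext z; simp [sqNorm, hr]
    rw [this, volume_pi, ← Set.pi_univ Set.univ]
    simp
  have h2 : {z : ι → ℂ | sqNorm z < r} =
      {x : ι → ℂ | (∑ i, ‖x i‖ ^ (2 : ℝ)) ^ (1 / (2 : ℝ)) < √r} := by
    ext z
    simp only [Set.mem_ofPred_eq, sqNorm, ← Real.sqrt_eq_rpow, Real.rpow_two]
    rw [Real.sqrt_lt_sqrt_iff (Finset.sum_nonneg fun _ _ => by positivity)]
  rw [h2, Complex.volume_sum_rpow_lt (ι := ι) (p := 2) (by norm_num), ← ENNReal.ofReal_pow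
    (by positivity), ← ENNReal.ofReal_mul (by positivity)]
  congr 1
  have : (2 : ℝ) * Fintype.card ι / 2 + 1 = Fintype.card ι + 1 := by ring
  rw [this, Real.Gamma_nat_eq_factorial, pow_mul, Real.sq_sqrt hr.le]
  have : (2 : ℝ) / 2 + 1 = (1 : ℕ) + 1 := by norm_num
  rw [this, Real.Gamma_nat_eq_factorial]
  simp
  ring

theorem gaussPi_absolutelyContinuous (ι : Type*) [Fintype ι] :
    gaussPi ι ≪ (volume : Measure (ι → ℂ)) := by
  rw [gaussPi_eq_withDensity]
  exact withDensity_absolutelyContinuous _ _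

/-! ### Gaussian matrices are almost surely nonsingular -/

theorem finite_setOf_det_add_smul_one_eq_zero {κ : Type*} [Fintype κ] [DecidableEq κ]
    (X : Matrix κ κ ℂ) : {t : ℝ | (X + (t : ℂ) • (1 : Matrix κ κ ℂ)).det = 0}.Finite := by
  have h : ((-X).charpoly.rootSet ℂ).Finite := Polynomial.rootSet_finite _ _
  refine (h.preimage (f := fun t : ℝ => (t : ℂ)) (Complex.ofReal_injective.injOn)).subset ?_
  intro t ht
  rw [Set.mem_preimage, Polynomial.mem_rootSet]
  refine ⟨(Matrix.charpoly_monic _).ne_zero, ?_⟩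
  rw [Polynomial.coe_aeval_eq_eval, Matrix.eval_charpoly]
  have : Matrix.scalar κ (t : ℂ) - -X = X + (t : ℂ) • (1 : Matrix κ κ ℂ) := by
    rw [sub_neg_eq_add, add_comm, Matrix.smul_one_eq_diagonal, Matrix.scalar_apply]
  rw [this]
  exact ht

/-- Translating B by t along the direction that is the identity on the selected columns turns the
determinant into a characteristic polynomial in t, which has finitely many roots. Lebesgue measure
is translation invariant, so averaging over t in [0, 1] and exchanging the integrals shows that the
singular set is null. -/
theorem volume_det_submatrix_eq_zero {κ J : Type*} [Fintype κ] [DecidableEq κ] [Fintype J]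
    [DecidableEq J] (e : κ → J) (he : Function.Injective e) :
    volume {B : κ × J → ℂ | (Matrix.of fun i j => B (i, e j)).det = 0} = 0 := by
  set S : Set (κ × J → ℂ) := {B | (Matrix.of fun i j => B (i, e j)).det = 0} with hS
  let w : κ × J → ℂ := fun p => if e p.1 = p.2 then 1 else 0
  have hSm : MeasurableSet S := by
    refine (isClosed_singleton.preimage (f := fun B : κ × J → ℂ =>
      (Matrix.of fun i j => B (i, e j)).det) ?_ (t := {0})).measurableSet
    exact Continuous.matrix_det (continuous_matrix fun i j => continuous_apply _)
  have hshift : ∀ (t : ℝ) (B : κ × J → ℂ), B + (t : ℂ) • w ∈ S ↔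
      ((Matrix.of fun i j => B (i, e j)) + (t : ℂ) • (1 : Matrix κ κ ℂ)).det = 0 := by
    intro t B
    have : (Matrix.of fun i j => (B + (t : ℂ) • w) (i, e j)) =
        (Matrix.of fun i j => B (i, e j)) + (t : ℂ) • (1 : Matrix κ κ ℂ) := by
      ext i j
      simp [w, Matrix.one_apply, he.eq_iff]
    rw [hS, Set.mem_ofPred_eq, this]
  have hm : Measurable fun p : ℝ × (κ × J → ℂ) => S.indicator (1 : (κ × J → ℂ) → ENNReal)
      (p.2 + (p.1 : ℂ) • w) :=
    (measurable_one.indicator hSm).comp (Continuous.measurable (by fun_prop))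
  have h1 : ∀ t : ℝ, ∫⁻ B, S.indicator (1 : (κ × J → ℂ) → ENNReal) (B + (t : ℂ) • w) = volume S := by
    intro t
    rw [lintegral_add_right_eq_self (fun B => S.indicator (1 : (κ × J → ℂ) → ENNReal) B),
      lintegral_indicator_one hSm]
  have h2 : ∀ B : κ × J → ℂ, ∫⁻ t in Set.Icc (0 : ℝ) 1,
      S.indicator (1 : (κ × J → ℂ) → ENNReal) (B + (t : ℂ) • w) = 0 := by
    intro B
    have hf := finite_setOf_det_add_smul_one_eq_zero (Matrix.of fun i j => B (i, e j))
    have : ∀ᵐ t : ℝ ∂(volume.restrict (Set.Icc (0 : ℝ) 1)),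
        S.indicator (1 : (κ × J → ℂ) → ENNReal) (B + (t : ℂ) • w) = 0 := by
      refine ae_restrict_of_ae ?_
      filter_upwards [hf.countable.ae_notMem volume] with t ht
      rw [Set.indicator_of_notMem]
      rw [hshift]
      exact ht
    rw [lintegral_congr_ae this, lintegral_zero]
  have h3 : ∫⁻ t in Set.Icc (0 : ℝ) 1, ∫⁻ B, S.indicator (1 : (κ × J → ℂ) → ENNReal)
    (B + (t : ℂ) • w) = 0 := by
    rw [lintegral_lintegral_swap hm.aemeasurable]
    simp only [h2, lintegral_zero]
  simp only [h1] at h3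
  simpa using h3

theorem ae_det_submatrix_ne_zero {κ J : Type*} [Fintype κ] [DecidableEq κ] [Fintype J]
    [DecidableEq J] (e : κ → J) (he : Function.Injective e) :
    ∀ᵐ B ∂gaussPi (κ × J), (Matrix.of fun i j => B (i, e j)).det ≠ 0 := by
  have h : ∀ᵐ B : κ × J → ℂ, (Matrix.of fun i j => B (i, e j)).det ≠ 0 := by
    rw [ae_iff]
    simpa using volume_det_submatrix_eq_zero e he
  exact (gaussPi_absolutelyContinuous _).ae_le h

/-! ### Gaussian moments and the mean Gram determinant -/

theorem integral_gaussC (f : ℂ → ℂ) :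
    ∫ z, f z ∂gaussC = ∫ z, (gaussDensity z : ℂ) * f z := by
  rw [gaussC, integral_withDensity_eq_integral_toReal_smul (by fun_prop) (by simp)]
  refine integral_congr_ae (Filter.Eventually.of_forall fun z => ?_)
  simp [ENNReal.toReal_ofReal (gaussDensity_nonneg z)]

theorem integral_norm_sq_gaussC : ∫ z, z * star z ∂gaussC = 1 := by
  rw [integral_gaussC]
  have h := integral_norm_pow_mul_exp 1 one_pos
  have h2 : ∀ z : ℂ, (gaussDensity z : ℂ) * (z * star z) =
      ((Real.pi⁻¹ * (‖z‖ ^ (2 * 1) * Real.exp (-1 * ‖z‖ ^ 2)) : ℝ) : ℂ) := by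
    intro z
    have : z * star z = ((‖z‖ ^ 2 : ℝ) : ℂ) := by
      rw [← Complex.normSq_eq_norm_sq, Complex.normSq_eq_conj_mul_self, mul_comm]
      rfl
    rw [this, gaussDensity]
    push_cast
    ring_nf
  simp only [h2]
  rw [integral_complex_ofReal, integral_const_mul, h]
  simp

theorem integrable_norm_sq_gaussC : Integrable (fun z : ℂ => z * star z) gaussC := by
  by_contra h
  have := integral_undef h
  rw [integral_norm_sq_gaussC] at this
  norm_num at this

theorem integrable_id_gaussC : Integrable (fun z : ℂ => z) gaussC := by
  refine ((integrable_const (1 : ℝ)).add integrable_norm_sq_gaussC.norm).mono'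
    (by fun_prop) (Filter.Eventually.of_forall fun z => ?_)
  simp only [Pi.add_apply, norm_mul, norm_star]
  nlinarith [sq_nonneg (‖z‖ - 1), norm_nonneg z]

theorem integrable_star_gaussC : Integrable (fun z : ℂ => star z) gaussC := by
  refine integrable_id_gaussC.mono (by fun_prop) (Filter.Eventually.of_forall fun z => ?_)
  simp

theorem integral_odd_gaussC (f : ℂ → ℂ) (hf : ∀ z, f (-z) = -f z) : ∫ z, f z ∂gaussC = 0 := by
  rw [integral_gaussC]
  have h := integral_neg_eq_self (fun z => (gaussDensity z : ℂ) * f z) volume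
  simp only [hf, mul_neg, integral_neg] at h
  have h2 : ∀ z, gaussDensity (-z) = gaussDensity z := fun z => by simp [gaussDensity]
  simp only [h2] at h
  linear_combination (-1 / 2 : ℂ) * h

theorem integral_monomial_gaussC (p q : Prop) [Decidable p] [Decidable q] :
    ∫ z, ((if p then z else 1) * (if q then star z else 1)) ∂gaussC =
      if (p ↔ q) then 1 else 0 := by
  by_cases hp : p <;> by_cases hq : q <;> simp only [hp, hq, if_true, if_false, mul_one, one_mul,
    iff_true, iff_false, not_true]
  · exact integral_norm_sq_gaussC
  · exact integral_odd_gaussC _ fun z => rfl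
  · exact integral_odd_gaussC _ fun z => star_neg z
  · simp

theorem integrable_monomial_gaussC (p q : Prop) [Decidable p] [Decidable q] :
    Integrable (fun z : ℂ => (if p then z else 1) * (if q then star z else 1)) gaussC := by
  by_cases hp : p <;> by_cases hq : q <;> simp only [hp, hq, if_true, if_false, mul_one, one_mul]
  · exact integrable_norm_sq_gaussC
  · exact integrable_id_gaussC
  · exact integrable_star_gaussC
  · exact integrable_const _

/-- The matrix with the entries of a vector indexed by pairs. -/
abbrev toMat {κ J : Type*} (B : κ × J → ℂ) : Matrix κ J ℂ := Matrix.of fun i j => B (i, j)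

/-- Regrouping the factors by matrix entry makes independence applicable: each entry occurs at most
once plain and at most once conjugated. -/
theorem monomial_eq_prod {κ J : Type*} [Fintype κ] [DecidableEq κ] [Fintype J] [DecidableEq J]
    (σ : Equiv.Perm κ) (c : κ → J) (B : κ × J → ℂ) :
    ∏ i, B (σ i, c i) * star (B (i, c i)) =
      ∏ p : κ × J, ((if c (σ⁻¹ p.1) = p.2 then B p else 1) *
        (if c p.1 = p.2 then star (B p) else 1)) := by
  rw [Finset.prod_mul_distrib, Finset.prod_mul_distrib, Fintype.prod_prod_type,
    Fintype.prod_prod_type]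
  congr 1
  · conv_rhs => rw [← Equiv.prod_comp σ]
    refine Finset.prod_congr rfl fun i _ => ?_
    simp [Finset.prod_ite_eq]
  · refine Finset.prod_congr rfl fun i _ => ?_
    simp [Finset.prod_ite_eq]

theorem integrable_monomial_gaussPi {κ J : Type*} [Fintype κ] [DecidableEq κ] [Fintype J]
    [DecidableEq J] (σ : Equiv.Perm κ) (c : κ → J) :
    Integrable (fun B : κ × J → ℂ => ∏ i, B (σ i, c i) * star (B (i, c i))) (gaussPi (κ × J)) := by
  simp only [monomial_eq_prod]
  exact Integrable.fintype_prod (𝕜 := ℂ) (μ := fun _ => gaussC)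
    (f := fun (p : κ × J) (z : ℂ) => ((if c (σ⁻¹ p.1) = p.2 then z else 1) *
        (if c p.1 = p.2 then star z else 1))) fun p => integrable_monomial_gaussC _ _

theorem integral_monomial_gaussPi {κ J : Type*} [Fintype κ] [DecidableEq κ] [Fintype J]
    [DecidableEq J] (σ : Equiv.Perm κ) (c : κ → J) :
    ∫ B, ∏ i, B (σ i, c i) * star (B (i, c i)) ∂gaussPi (κ × J) =
      if c ∘ σ = c then 1 else 0 := by
  simp only [monomial_eq_prod]
  rw [gaussPi, integral_fintype_prod_eq_prod (𝕜 := ℂ)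
    (fun (p : κ × J) (z : ℂ) => ((if c (σ⁻¹ p.1) = p.2 then z else 1) *
        (if c p.1 = p.2 then star z else 1)))]
  simp only [integral_monomial_gaussC]
  rw [Finset.prod_ite_zero]
  simp only [Finset.mem_univ, true_implies, Finset.prod_const_one]
  congr 1
  rw [eq_iff_iff]
  constructor
  · intro h
    funext i
    have := (h (σ i, c i)).1 (by simp)
    exact this
  · intro h p
    have h2 : c (σ⁻¹ p.1) = c p.1 := by
      have := congrFun h (σ⁻¹ p.1)
      rw [Function.comp_apply, show σ (σ⁻¹ p.1) = p.1 from Equiv.apply_symm_apply σ p.1] at this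
      exact this.symm
    rw [h2]

theorem det_mul_conjTranspose_expand {κ J : Type*} [Fintype κ] [DecidableEq κ] [Fintype J]
    [DecidableEq J] (B : κ × J → ℂ) :
    (toMat B * (toMat B)ᴴ).det = ∑ σ : Equiv.Perm κ, ∑ c : κ → J,
      ((Equiv.Perm.sign σ : ℤ) : ℂ) * ∏ i, B (σ i, c i) * star (B (i, c i)) := by
  rw [Matrix.det_apply']
  refine Finset.sum_congr rfl fun σ _ => ?_
  rw [← Finset.mul_sum]
  congr 1
  simp only [Matrix.mul_apply, Matrix.conjTranspose_apply, Matrix.of_apply]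
  rw [Finset.prod_univ_sum, Fintype.piFinset_univ]

/-- If c takes one value at a ≠ b, multiplication by the transposition of a and b preserves the
condition c ∘ σ = c and flips the sign, so the sum cancels. If c is injective, only the identity
contributes. -/
theorem sum_sign_stabilizer {κ J : Type*} [Fintype κ] [DecidableEq κ] [DecidableEq J]
    (c : κ → J) : ∑ σ : Equiv.Perm κ, ((Equiv.Perm.sign σ : ℤ) : ℂ) * (if c ∘ σ = c then 1 else 0) =
      if Function.Injective c then 1 else 0 := by
  classical
  by_cases hc : Function.Injective c
  · rw [if_pos hc, Finset.sum_eq_single 1]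
    · simp
    · intro σ _ hσ
      rw [if_neg, mul_zero]
      intro h
      exact hσ (Equiv.ext fun i => hc (congrFun h i))
    · simp
  · rw [if_neg hc]
    obtain ⟨a, b, hab, hne⟩ : ∃ a b, c a = c b ∧ a ≠ b := by
      simpa [Function.Injective] using hc
    have h := Equiv.sum_comp (Equiv.mulLeft (Equiv.swap a b)) fun σ : Equiv.Perm κ =>
      ((Equiv.Perm.sign σ : ℤ) : ℂ) * (if c ∘ σ = c then 1 else 0)
    have hswap : c ∘ (Equiv.swap a b) = c := by
      funext i
      rcases eq_or_ne i a with rfl | hia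
      · simp [hab]
      · rcases eq_or_ne i b with rfl | hib
        · simp [hab]
        · simp [Equiv.swap_apply_of_ne_of_ne hia hib]
    have h2 : ∀ σ : Equiv.Perm κ, c ∘ (Equiv.swap a b * σ : Equiv.Perm κ) = c ∘ σ := by
      intro σ
      rw [Equiv.Perm.coe_mul, ← Function.comp_assoc, hswap]
    simp only [Equiv.coe_mulLeft, h2, Equiv.Perm.sign_mul, Equiv.Perm.sign_swap hne] at h
    simp only [one_mul, Units.val_neg, Int.cast_neg, neg_mul,
      Finset.sum_neg_distrib] at h
    linear_combination (-1 / 2 : ℂ) * h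

/-- In the Leibniz expansion a term survives the expectation only if plain and conjugated entries
pair up. The signed sum over permutations then leaves exactly the injective column choices, which
the descending factorial counts. -/
theorem lintegral_det_mul_conjTranspose {κ J : Type*} [Fintype κ] [DecidableEq κ] [Fintype J]
    [DecidableEq J] :
    ∫⁻ B, ENNReal.ofReal ((toMat B * (toMat B)ᴴ).det.re) ∂gaussPi (κ × J) =
      ((Fintype.card J).descFactorial (Fintype.card κ) : ENNReal) := by
  have hi : Integrable (fun B : κ × J → ℂ => (toMat B * (toMat B)ᴴ).det) (gaussPi (κ × J)) := by
    simp only [det_mul_conjTranspose_expand]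
    exact integrable_finsetSum _ fun σ _ => integrable_finsetSum _ fun c _ =>
      (integrable_monomial_gaussPi σ c).const_mul _
  have hI : ∫ B, (toMat B * (toMat B)ᴴ).det ∂gaussPi (κ × J) =
      ((Fintype.card J).descFactorial (Fintype.card κ) : ℂ) := by
    simp only [det_mul_conjTranspose_expand]
    rw [integral_finsetSum _ fun σ _ => integrable_finsetSum _ fun c _ =>
      (integrable_monomial_gaussPi σ c).const_mul _]
    simp only [integral_finsetSum _ fun c _ => (integrable_monomial_gaussPi _ c).const_mul _,
      integral_const_mul, integral_monomial_gaussPi]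
    rw [Finset.sum_comm]
    simp only [sum_sign_stabilizer]
    rw [Finset.sum_boole, ← Fintype.card_embedding_eq, ← Fintype.card_subtype,
      Fintype.card_congr (Equiv.subtypeInjectiveEquivEmbedding κ J)]
  have hre : Integrable (fun B : κ × J → ℂ => (toMat B * (toMat B)ᴴ).det.re) (gaussPi (κ × J)) :=
    hi.re
  rw [← ofReal_integral_eq_lintegral_ofReal hre (Filter.Eventually.of_forall fun B => ?_)]
  · have : ∫ B, ((toMat B * (toMat B)ᴴ).det).re ∂gaussPi (κ × J) =
        ((Fintype.card J).descFactorial (Fintype.card κ) : ℝ) := by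
      have h := integral_re hi
      rw [hI] at h
      simpa using h
    rw [this, ENNReal.ofReal_natCast]
  · have := (Matrix.posSemidef_self_mul_conjTranspose (toMat B)).det_nonneg
    exact (Complex.le_def.1 this).1

/-! ### Determinants of positive matrices -/

section MatrixLemmas

open scoped MatrixOrder

theorem Matrix.PosDef.exists_eq_mul_conjTranspose {κ : Type*} [Fintype κ] [DecidableEq κ]
    {K : Matrix κ κ ℂ} (hK : K.PosDef) : ∃ F : Matrix κ κ ℂ, F.det ≠ 0 ∧ K = F * Fᴴ := by
  obtain ⟨F, hF⟩ := CStarAlgebra.nonneg_iff_eq_mul_star_self.mp hK.posSemidef.nonneg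
  refine ⟨F, fun h => ?_, hF⟩
  have := hK.det_pos.ne'
  rw [hF, Matrix.det_mul, h, zero_mul] at this
  exact this rfl

end MatrixLemmas

theorem Matrix.PosSemidef.det_re_nonneg {κ : Type*} [Fintype κ] [DecidableEq κ]
    {A : Matrix κ κ ℂ} (hA : A.PosSemidef) : 0 ≤ A.det.re := (Complex.le_def.1 hA.det_nonneg).1

theorem Matrix.PosSemidef.det_eq_re {κ : Type*} [Fintype κ] [DecidableEq κ]
    {A : Matrix κ κ ℂ} (hA : A.PosSemidef) : A.det = (A.det.re : ℂ) := by
  have := (Complex.le_def.1 hA.det_nonneg).2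
  exact Complex.ext rfl (by simpa using this.symm)

theorem Matrix.PosDef.det_re_pos {κ : Type*} [Fintype κ] [DecidableEq κ]
    {A : Matrix κ κ ℂ} (hA : A.PosDef) : 0 < A.det.re := (Complex.lt_def.1 hA.det_pos).1

theorem Matrix.PosSemidef.det_re_le_one {κ : Type*} [Fintype κ] [DecidableEq κ]
    {A : Matrix κ κ ℂ} (hA : A.PosSemidef) (hA1 : (1 - A).PosSemidef) : A.det.re ≤ 1 := by
  rw [hA.1.det_eq_prod_eigenvalues]
  have : ((∏ i, (hA.1.eigenvalues i : ℂ)) : ℂ).re = ∏ i, hA.1.eigenvalues i := by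
    rw [← Complex.ofReal_prod, Complex.ofReal_re]
  refine le_of_eq_of_le this (Finset.prod_le_one (fun i _ => hA.eigenvalues_nonneg i) fun i _ => ?_)
  have h := hA1.re_dotProduct_nonneg (hA.1.eigenvectorBasis i).ofLp
  rw [Matrix.sub_mulVec, dotProduct_sub, Matrix.one_mulVec, map_sub, ← hA.1.eigenvalues_eq] at h
  have h2 : star (hA.1.eigenvectorBasis i).ofLp ⬝ᵥ (hA.1.eigenvectorBasis i).ofLp = 1 := by
    have := (hA.1.eigenvectorBasis.orthonormal.1 i)
    have h3 := inner_self_eq_norm_sq_to_K (𝕜 := ℂ) (hA.1.eigenvectorBasis i)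
    rw [this, EuclideanSpace.inner_eq_star_dotProduct, dotProduct_comm] at h3
    simpa using h3
  rw [h2] at h
  simpa using h

/-- Writing the larger matrix as FF* and conjugating by F⁻¹ reduces monotonicity of the determinant
to comparison with the identity. -/
theorem Matrix.PosSemidef.det_re_le_of_sub {κ : Type*} [Fintype κ] [DecidableEq κ]
    {A B : Matrix κ κ ℂ} (hA : A.PosSemidef) (hB : B.PosDef) (hAB : (B - A).PosSemidef) :
    A.det.re ≤ B.det.re := by
  obtain ⟨F, hF, rfl⟩ := hB.exists_eq_mul_conjTranspose
  have hu : IsUnit F.det := isUnit_iff_ne_zero.2 hF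
  have hl : F * F⁻¹ = 1 := Matrix.mul_nonsing_inv F hu
  have hr : F⁻¹ * F = 1 := Matrix.nonsing_inv_mul F hu
  have hl' : F⁻¹ᴴ * Fᴴ = 1 := by rw [← Matrix.conjTranspose_mul, hl, Matrix.conjTranspose_one]
  have hr' : Fᴴ * F⁻¹ᴴ = 1 := by rw [← Matrix.conjTranspose_mul, hr, Matrix.conjTranspose_one]
  have h1 := hA.mul_mul_conjTranspose_same F⁻¹
  have h2 := hAB.mul_mul_conjTranspose_same F⁻¹
  have h3 : F⁻¹ * (F * Fᴴ - A) * F⁻¹ᴴ = 1 - F⁻¹ * A * F⁻¹ᴴ := by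
    rw [Matrix.mul_sub, Matrix.sub_mul, ← Matrix.mul_assoc, hr, Matrix.one_mul, hr']
  rw [h3] at h2
  have h4 := h1.det_re_le_one h2
  have h5 : A = F * (F⁻¹ * A * F⁻¹ᴴ) * Fᴴ := by
    rw [Matrix.mul_assoc, Matrix.mul_assoc, Matrix.mul_assoc, hl', Matrix.mul_one,
      ← Matrix.mul_assoc, hl, Matrix.one_mul]
  have h6 : A.det = ((‖F.det‖ ^ 2 : ℝ) : ℂ) * (F⁻¹ * A * F⁻¹ᴴ).det := by
    conv_lhs => rw [h5]
    rw [Matrix.det_mul, Matrix.det_mul, Matrix.det_conjTranspose, ← Complex.normSq_eq_norm_sq,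
      Complex.normSq_eq_conj_mul_self, ← starRingEnd_apply]
    ring
  have h7 : (F * Fᴴ).det = ((‖F.det‖ ^ 2 : ℝ) : ℂ) := by
    rw [Matrix.det_mul, Matrix.det_conjTranspose, ← Complex.normSq_eq_norm_sq,
      Complex.normSq_eq_conj_mul_self, ← starRingEnd_apply]
    ring
  rw [h6, h7, Complex.re_ofReal_mul, Complex.ofReal_re]
  exact mul_le_of_le_one_right (by positivity) h4

/-! ### A QR decomposition and the volume of the admissible columns -/

/-- A QR decomposition: a tall matrix is a unitary times a matrix with vanishing lower block. -/
theorem exists_unitary_mul_fromRows_zero {T X : Type*} [Fintype T] [Fintype X] [DecidableEq T]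
    [DecidableEq X] (M : Matrix (T ⊕ X) T ℂ) :
    ∃ (V : Matrix (T ⊕ X) (T ⊕ X) ℂ) (C : Matrix T T ℂ), Vᴴ * V = 1 ∧ V * Vᴴ = 1 ∧
      M = V * Matrix.fromRows C (0 : Matrix X T ℂ) := by
  let e : T ⊕ X ≃ Fin (Fintype.card (T ⊕ X)) := Fintype.equivFin _
  let f : Fin (Fintype.card (T ⊕ X)) → EuclideanSpace ℂ (T ⊕ X) := fun j =>
    Sum.elim (fun t => WithLp.toLp 2 fun i => M i t) (fun _ => 0) (e.symm j)
  have hcard : Module.finrank ℂ (EuclideanSpace ℂ (T ⊕ X)) =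
      Fintype.card (Fin (Fintype.card (T ⊕ X))) := by simp
  let b := InnerProductSpace.gramSchmidtOrthonormalBasis hcard f
  -- The columns of M are padded with zero vectors. At a padded slot Gram–Schmidt produces zero, so
  -- the basis vector that fills the slot is orthogonal to every column.
  have hb0 : ∀ (x : X) (j), inner ℂ (b (e (Sum.inr x))) (f j) = 0 := by
    intro x j
    refine InnerProductSpace.inner_gramSchmidtOrthonormalBasis_eq_zero hcard ?_ j
    have hf : f (e (Sum.inr x)) = 0 := by simp [f]
    have : InnerProductSpace.gramSchmidt ℂ f (e (Sum.inr x)) = 0 := by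
      rw [InnerProductSpace.gramSchmidt_def, hf]
      have := InnerProductSpace.gramSchmidt_def ℂ f (e (Sum.inr x))
      rw [zero_sub, neg_eq_zero]
      refine Finset.sum_eq_zero fun i hi => ?_
      rw [map_zero]
    simp [InnerProductSpace.gramSchmidtNormed, this]
  let V : Matrix (T ⊕ X) (T ⊕ X) ℂ := Matrix.of fun i j => b (e j) i
  have hV : Vᴴ * V = 1 := by
    ext i j
    have h := b.inner_eq_ite (e i) (e j)
    rw [EuclideanSpace.inner_eq_star_dotProduct, dotProduct_comm] at h
    simp only [EmbeddingLike.apply_eq_iff_eq] at h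
    rw [Matrix.one_apply, ← h]
    rfl
  have hV' : V * Vᴴ = 1 := mul_eq_one_comm.1 hV
  refine ⟨V, Matrix.of fun i t => (Vᴴ * M) (Sum.inl i) t, hV, hV', ?_⟩
  have : Matrix.fromRows (Matrix.of fun i t => (Vᴴ * M) (Sum.inl i) t)
      (0 : Matrix X T ℂ) = Vᴴ * M := by
    ext i t
    rcases i with i | x
    · rfl
    · have h := hb0 x (e (Sum.inl t))
      rw [EuclideanSpace.inner_eq_star_dotProduct, dotProduct_comm] at h
      simp only [f, Equiv.symm_apply_apply, Sum.elim_inl] at h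
      exact h.symm
  rw [this, ← Matrix.mul_assoc, hV', Matrix.one_mul]

/-- With K = FF* and a QR decomposition of F⁻¹M, the coordinates V*F⁻¹a separate the two conditions:
the first involves only the T-block, through C*, and the second is a bound on the full norm. The
volume is thus at most that of a product of two balls, with Jacobian det K for the change of
coordinates and 1/|det C|² = 1/det(M*K⁻¹M) for the T-block. -/
theorem volume_inter_le {T X : Type*} [Fintype T] [Fintype X] [DecidableEq T] [DecidableEq X]
    (K : Matrix (T ⊕ X) (T ⊕ X) ℂ) (hK : K.PosDef) (M : Matrix (T ⊕ X) T ℂ)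
    (hN : (Mᴴ * K⁻¹ * M).det ≠ 0) {s e : ℝ} (hs : 0 < s) (he : 0 < e) :
    volume {a : T ⊕ X → ℂ | sqNorm ((Mᴴ * K⁻¹) *ᵥ a) < s ∧ (star a ⬝ᵥ K⁻¹ *ᵥ a).re < e} ≤
      ENNReal.ofReal (s ^ Fintype.card T * Real.pi ^ Fintype.card T / (Fintype.card T).factorial *
        (e ^ Fintype.card X * Real.pi ^ Fintype.card X / (Fintype.card X).factorial) *
        (K.det.re / (Mᴴ * K⁻¹ * M).det.re)) := by
  obtain ⟨F, hF, rfl⟩ := hK.exists_eq_mul_conjTranspose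
  have hu : IsUnit F.det := isUnit_iff_ne_zero.2 hF
  have hl : F * F⁻¹ = 1 := Matrix.mul_nonsing_inv F hu
  have hr : F⁻¹ * F = 1 := Matrix.nonsing_inv_mul F hu
  have hr' : Fᴴ * F⁻¹ᴴ = 1 := by rw [← Matrix.conjTranspose_mul, hr, Matrix.conjTranspose_one]
  have hinv : (F * Fᴴ)⁻¹ = F⁻¹ᴴ * F⁻¹ := by
    refine Matrix.inv_eq_right_inv ?_
    rw [Matrix.mul_assoc, ← Matrix.mul_assoc Fᴴ, hr', Matrix.one_mul, hl]
  obtain ⟨V, C, hV, hV', hM⟩ := exists_unitary_mul_fromRows_zero (F⁻¹ * M)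
  have hVdet : ‖V.det‖ = 1 := by
    have := congrArg (fun M => ‖M.det‖) hV
    simp only [Matrix.det_mul, Matrix.det_conjTranspose, norm_mul, Matrix.det_one, norm_one] at this
    rw [norm_star] at this
    nlinarith [norm_nonneg V.det]
  have hMF : Mᴴ * F⁻¹ᴴ = (Matrix.fromRows C (0 : Matrix X T ℂ))ᴴ * Vᴴ := by
    rw [← Matrix.conjTranspose_mul, hM, Matrix.conjTranspose_mul]
  have hN' : Mᴴ * (F * Fᴴ)⁻¹ * M = Cᴴ * C := by
    rw [hinv, ← Matrix.mul_assoc, hMF, Matrix.mul_assoc, hM, Matrix.mul_assoc,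
      ← Matrix.mul_assoc Vᴴ,
      hV, Matrix.one_mul, Matrix.conjTranspose_fromRows_eq_fromCols_conjTranspose,
      Matrix.fromCols_mul_fromRows]
    simp
  rw [hN'] at hN ⊢
  have hCdet : (Cᴴ * C).det.re = ‖C.det‖ ^ 2 := by
    rw [Matrix.det_mul, Matrix.det_conjTranspose, ← Complex.normSq_eq_norm_sq, ← starRingEnd_apply,
      ← Complex.normSq_eq_conj_mul_self, Complex.ofReal_re]
  have hFdet : (F * Fᴴ).det.re = ‖F.det‖ ^ 2 := by
    rw [Matrix.det_mul, Matrix.det_conjTranspose, ← Complex.normSq_eq_norm_sq,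
      mul_comm, ← starRingEnd_apply, ← Complex.normSq_eq_conj_mul_self, Complex.ofReal_re]
  have hC : C.det ≠ 0 := by
    rintro h
    rw [Matrix.det_mul, h, mul_zero] at hN
    exact hN rfl
  set W : Matrix (T ⊕ X) (T ⊕ X) ℂ := Vᴴ * F⁻¹ with hW
  have hWdet : ‖W.det‖ ^ 2 = (‖F.det‖ ^ 2)⁻¹ := by
    rw [hW, Matrix.det_mul, Matrix.det_conjTranspose, norm_mul, norm_star, hVdet, one_mul,
      Matrix.det_nonsing_inv, Ring.inverse_eq_inv', norm_inv, inv_pow]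
  -- Only an inclusion holds: the bound on the whole norm is relaxed to its X-block, which is what
  -- makes the set a product.
  have hset : {a : T ⊕ X → ℂ | sqNorm ((Mᴴ * (F * Fᴴ)⁻¹) *ᵥ a) < s ∧
      (star a ⬝ᵥ (F * Fᴴ)⁻¹ *ᵥ a).re < e} ⊆ (W *ᵥ ·) ⁻¹'
      ((MeasurableEquiv.sumPiEquivProdPi fun _ : T ⊕ X => ℂ) ⁻¹'
        (((Cᴴ *ᵥ ·) ⁻¹' {z : T → ℂ | sqNorm z < s}) ×ˢ {z : X → ℂ | sqNorm z < e})) := by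
    rintro a ⟨h1, h2⟩
    have e1 : (Mᴴ * (F * Fᴴ)⁻¹) *ᵥ a = Cᴴ *ᵥ fun t => (W *ᵥ a) (Sum.inl t) := by
      rw [hinv, ← Matrix.mul_assoc, hMF, Matrix.mul_assoc, ← hW, ← Matrix.mulVec_mulVec,
        Matrix.conjTranspose_fromRows_eq_fromCols_conjTranspose]
      rw [show W *ᵥ a = Sum.elim (fun t => (W *ᵥ a) (Sum.inl t)) (fun t => (W *ᵥ a) (Sum.inr t)) by
        ext i; rcases i with i | i <;> rfl, Matrix.fromCols_mulVec]
      simp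
    have e2 : (star a ⬝ᵥ (F * Fᴴ)⁻¹ *ᵥ a).re = sqNorm (W *ᵥ a) := by
      have : star a ⬝ᵥ (F * Fᴴ)⁻¹ *ᵥ a = (sqNorm (W *ᵥ a) : ℂ) := by
        rw [sqNorm_eq_dotProduct, Matrix.star_mulVec, ← Matrix.dotProduct_mulVec,
          Matrix.mulVec_mulVec, hinv, hW, Matrix.conjTranspose_mul,
            Matrix.conjTranspose_conjTranspose,
          Matrix.mul_assoc, ← Matrix.mul_assoc V, hV', Matrix.one_mul]
      rw [this, Complex.ofReal_re]
    rw [e1] at h1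
    rw [e2] at h2
    refine ⟨h1, lt_of_le_of_lt ?_ h2⟩
    simp only [sqNorm, Fintype.sum_sum_type]
    have : 0 ≤ ∑ t, ‖(W *ᵥ a) (Sum.inl t)‖ ^ 2 := Finset.sum_nonneg fun _ _ => by positivity
    simpa [MeasurableEquiv.sumPiEquivProdPi, Equiv.sumPiEquivProdPi] using this
  refine (measure_mono hset).trans ?_
  have hm1 : MeasurableSet ((Cᴴ *ᵥ ·) ⁻¹' {z : T → ℂ | sqNorm z < s}) :=
    (isOpen_lt (continuous_sqNorm.comp (by fun_prop)) continuous_const).measurableSet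
  have hm2 : MeasurableSet {z : X → ℂ | sqNorm z < e} :=
    (isOpen_lt continuous_sqNorm continuous_const).measurableSet
  rw [volume_preimage_mulVec, (volume_measurePreserving_sumPiEquivProdPi fun _ : T ⊕ X =>
    ℂ).measure_preimage (hm1.prod hm2).nullMeasurableSet, Measure.volume_eq_prod, Measure.prod_prod,
    volume_preimage_mulVec, volume_sqNorm_lt s hs, volume_sqNorm_lt e he, hWdet, inv_inv, hCdet,
    hFdet, Matrix.det_conjTranspose, norm_star, ← ENNReal.ofReal_mul (by positivity),
    ← ENNReal.ofReal_mul (by positivity), ← ENNReal.ofReal_mul (by positivity)]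
  · refine le_of_eq ?_
    congr 1
    ring
  · rw [Matrix.det_conjTranspose]
    exact star_ne_zero.2 hC
  · intro h
    rw [h] at hWdet
    have : 0 < (‖F.det‖ ^ 2)⁻¹ := by positivity
    simp only [norm_zero] at hWdet
    rw [← hWdet] at this
    norm_num at this

/-! ### Measurability of matrix operations -/

instance matrixMeasurableSpace (m n : Type*) : MeasurableSpace (Matrix m n ℂ) :=
  inferInstanceAs (MeasurableSpace (m → n → ℂ))

instance matrixBorelSpace (m n : Type*) [Finite m] [Finite n] : BorelSpace (Matrix m n ℂ) :=
  inferInstanceAs (BorelSpace (m → n → ℂ))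

instance matrixSecondCountable (m n : Type*) [Finite m] [Finite n] :
    SecondCountableTopology (Matrix m n ℂ) :=
  inferInstanceAs (SecondCountableTopology (m → n → ℂ))

@[fun_prop]
theorem Measurable.matrix_inv {α κ : Type*} [MeasurableSpace α] [Fintype κ] [DecidableEq κ]
    {M : α → Matrix κ κ ℂ} (hM : Measurable M) : Measurable fun x => (M x)⁻¹ := by
  have h1 : Measurable fun x => (M x).det :=
    (Continuous.matrix_det continuous_id).measurable.comp hM
  have h2 : Measurable fun x => (M x).adjugate :=
    (Continuous.matrix_adjugate continuous_id).measurable.comp hM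
  simp only [Matrix.inv_def, Ring.inverse_eq_inv']
  exact h1.inv.smul h2

@[fun_prop]
theorem Measurable.matrix_mul {α l m n : Type*} [MeasurableSpace α] [Fintype l] [Fintype m]
    [Fintype n] {M : α → Matrix l m ℂ} {N : α → Matrix m n ℂ} (hM : Measurable M)
    (hN : Measurable N) : Measurable fun x => M x * N x := by
  have h : Continuous fun p : Matrix l m ℂ × Matrix m n ℂ => p.1 * p.2 := by fun_prop
  exact h.measurable.comp (hM.prodMk hN)

@[fun_prop]
theorem Measurable.matrix_det {α κ : Type*} [MeasurableSpace α] [Fintype κ] [DecidableEq κ]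
    {M : α → Matrix κ κ ℂ} (hM : Measurable M) : Measurable fun x => (M x).det :=
  (Continuous.matrix_det continuous_id).measurable.comp hM

@[fun_prop]
theorem Measurable.matrix_conjTranspose {α m n : Type*} [MeasurableSpace α] [Fintype m] [Fintype n]
    {M : α → Matrix m n ℂ} (hM : Measurable M) : Measurable fun x => (M x)ᴴ :=
  (Continuous.matrix_conjTranspose continuous_id).measurable.comp hM

/-! ### Row projections and the weight at the base state -/

/-- The orthogonal projection onto the row space of a matrix with independent rows. -/
def rowProj {κ I : Type*} [Fintype κ] [DecidableEq κ] [Fintype I] (A : Matrix κ I ℂ) :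
    Matrix I I ℂ := Aᴴ * (A * Aᴴ)⁻¹ * A

/-- The regularised Kac–Rice weight at a base point `o` with tangent coordinates `t`. -/
def criticalWeight {I T : Type*} [Fintype T] [DecidableEq T] (o : I) (t : T → I) (τ s e : ℝ)
    (Q : Matrix I I ℂ) : ENNReal :=
  open Classical in
  if sqNorm (fun j => Q (t j) o) < s ∧ (Q o o).re < e then
    ENNReal.ofReal (‖(Q.submatrix t t + (τ : ℂ) • (1 : Matrix T T ℂ)).det‖ ^ 2) else 0

theorem measurable_criticalWeight {I T : Type*} [Finite I] [Fintype T] [DecidableEq T] (o : I)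
    (t : T → I) (τ s e : ℝ) : Measurable (criticalWeight o t τ s e) := by
  classical
  unfold criticalWeight
  refine Measurable.ite (IsOpen.measurableSet ?_) (ENNReal.measurable_ofReal.comp
    (Continuous.measurable ?_)) measurable_const
  · have h1 : IsOpen {Q : Matrix I I ℂ | sqNorm (fun j => Q (t j) o) < s} :=
      isOpen_lt (continuous_sqNorm.comp (continuous_pi fun j => continuous_id.matrix_elem _ _))
        continuous_const
    have h2 : IsOpen {Q : Matrix I I ℂ | (Q o o).re < e} :=
      isOpen_lt (Complex.continuous_re.comp (continuous_id.matrix_elem _ _)) continuous_const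
    exact h1.inter h2
  · fun_prop

section RankOne

variable {κ : Type*} [Fintype κ] [DecidableEq κ]

/-- This is the Sherman–Morrison formula. It makes the dependence of the row projection on one
column explicit. -/
theorem inv_add_vecMulVec {K : Matrix κ κ ℂ} (hK : K.PosDef) (a : κ → ℂ) :
    (K + Matrix.vecMulVec a (star a))⁻¹ = K⁻¹ - (1 + star a ⬝ᵥ K⁻¹ *ᵥ a)⁻¹ •
      Matrix.vecMulVec (K⁻¹ *ᵥ a) (star (K⁻¹ *ᵥ a)) := by
  have hu : IsUnit K.det := isUnit_iff_ne_zero.2 hK.det_pos.ne'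
  have hα : 0 ≤ star a ⬝ᵥ K⁻¹ *ᵥ a := hK.inv.posSemidef.dotProduct_mulVec_nonneg a
  have hα1 : 1 + star a ⬝ᵥ K⁻¹ *ᵥ a ≠ 0 := (add_pos_of_pos_of_nonneg one_pos hα).ne'
  refine Matrix.inv_eq_right_inv ?_
  have e1 : K * Matrix.vecMulVec (K⁻¹ *ᵥ a) (star (K⁻¹ *ᵥ a)) =
      Matrix.vecMulVec a (star (K⁻¹ *ᵥ a)) := by
    rw [Matrix.mul_vecMulVec, Matrix.mulVec_mulVec, Matrix.mul_nonsing_inv K hu, Matrix.one_mulVec]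
  have e2 : Matrix.vecMulVec a (star a) * K⁻¹ = Matrix.vecMulVec a (star (K⁻¹ *ᵥ a)) := by
    rw [Matrix.vecMulVec_mul, Matrix.star_mulVec, hK.inv.isHermitian.eq]
  have e3 : Matrix.vecMulVec a (star a) * Matrix.vecMulVec (K⁻¹ *ᵥ a) (star (K⁻¹ *ᵥ a)) =
      (star a ⬝ᵥ K⁻¹ *ᵥ a) • Matrix.vecMulVec a (star (K⁻¹ *ᵥ a)) := by
    rw [Matrix.vecMulVec_mul_vecMulVec, Matrix.vecMulVec_smul]
  rw [Matrix.add_mul, Matrix.mul_sub, Matrix.mul_sub, Matrix.mul_smul, Matrix.mul_smul, e1, e2, e3,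
    Matrix.mul_nonsing_inv K hu]
  set α := star a ⬝ᵥ K⁻¹ *ᵥ a
  have : (1 : ℂ) - (1 + α)⁻¹ - (1 + α)⁻¹ * α = 0 := by field_simp; ring
  rw [smul_smul]
  calc _ = (1 : Matrix κ κ ℂ) + ((1 : ℂ) - (1 + α)⁻¹ - (1 + α)⁻¹ * α) •
        Matrix.vecMulVec a (star (K⁻¹ *ᵥ a)) := by
        simp only [sub_smul, one_smul]; abel
    _ = 1 := by rw [this, zero_smul, add_zero]

theorem inv_add_vecMulVec_mulVec {K : Matrix κ κ ℂ} (hK : K.PosDef) (a : κ → ℂ) :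
    (K + Matrix.vecMulVec a (star a))⁻¹ *ᵥ a = (1 + star a ⬝ᵥ K⁻¹ *ᵥ a)⁻¹ • K⁻¹ *ᵥ a := by
  have hα : 0 ≤ star a ⬝ᵥ K⁻¹ *ᵥ a := hK.inv.posSemidef.dotProduct_mulVec_nonneg a
  have hα1 : 1 + star a ⬝ᵥ K⁻¹ *ᵥ a ≠ 0 := (add_pos_of_pos_of_nonneg one_pos hα).ne'
  have e : star (K⁻¹ *ᵥ a) ⬝ᵥ a = star a ⬝ᵥ K⁻¹ *ᵥ a := by
    rw [Matrix.star_mulVec, hK.inv.isHermitian.eq, Matrix.dotProduct_mulVec]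
  rw [inv_add_vecMulVec hK, Matrix.sub_mulVec, Matrix.smul_mulVec, Matrix.vecMulVec_mulVec, e]
  ext i
  simp only [Pi.sub_apply, Pi.smul_apply, smul_eq_mul, MulOpposite.smul_eq_mul_unop,
    MulOpposite.unop_op]
  field_simp
  ring

end RankOne

/-- The matrix with one more column. -/
abbrev consCol {κ J : Type*} (a : κ → ℂ) (B : Matrix κ J ℂ) : Matrix κ (Unit ⊕ J) ℂ :=
  Matrix.of fun i => Sum.elim (fun _ => a i) (B i)

theorem consCol_mul_conjTranspose {κ J : Type*} [Fintype J] (a : κ → ℂ) (B : Matrix κ J ℂ) :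
    consCol a B * (consCol a B)ᴴ = B * Bᴴ + Matrix.vecMulVec a (star a) := by
  ext i j
  simp [Matrix.mul_apply, Matrix.vecMulVec_apply, add_comm]

/-! ### Dependence of the weight on the base column -/

section Upper

variable {κ T R : Type*} [Fintype κ] [DecidableEq κ] [Fintype T] [Fintype R]

/-- The columns with index in the left summand. -/
abbrev leftCols (B : Matrix κ (T ⊕ R) ℂ) : Matrix κ T ℂ := B.submatrix id Sum.inl

/-- The compression of the row projection to the left columns. -/
abbrev leftGram (B : Matrix κ (T ⊕ R) ℂ) : Matrix T T ℂ :=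
  (leftCols B)ᴴ * (B * Bᴴ)⁻¹ * leftCols B

theorem posSemidef_leftGram (B : Matrix κ (T ⊕ R) ℂ) : (leftGram B).PosSemidef := by
  have := (Matrix.posSemidef_self_mul_conjTranspose B).inv.mul_mul_conjTranspose_same (leftCols B)ᴴ
  rwa [Matrix.conjTranspose_conjTranspose] at this

theorem posDef_add_smul_one {T : Type*} [DecidableEq T] {A : Matrix T T ℂ} (hA : A.PosSemidef)
    {τ : ℝ} (hτ : 0 < τ) :
    (A + (τ : ℂ) • (1 : Matrix T T ℂ)).PosDef :=
  Matrix.PosDef.posSemidef_add hA (Matrix.PosDef.one.smul (by exact_mod_cast hτ))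

/-- With β = a*K⁻¹a and v = M*K⁻¹a, where M consists of the tangent columns, the rank-one update
gives the value β/(1+β) and the gradient v/(1+β). The value condition is then β < e/(1-e), which
also bounds 1+β by 1/(1-e) in the gradient condition. Adding the column a lowers the tangent
compression by the positive matrix vv*/(1+β), so its determinant is bounded by the one formed from B
alone, which no longer depends on a. -/
theorem criticalWeight_rowProj_le [DecidableEq T] {B : Matrix κ (T ⊕ R) ℂ} (hK : (B * Bᴴ).PosDef)
    (a : κ → ℂ)
    {τ s e : ℝ} (hτ : 0 < τ) (he1 : e < 1) :
    criticalWeight (Sum.inl ()) (fun j : T => Sum.inr (Sum.inl j)) τ s e (rowProj (consCol a B)) ≤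
      {a : κ → ℂ | sqNorm (((leftCols B)ᴴ * (B * Bᴴ)⁻¹) *ᵥ a) < s / (1 - e) ^ 2 ∧
        (star a ⬝ᵥ (B * Bᴴ)⁻¹ *ᵥ a).re < e / (1 - e)}.indicator
        (fun _ => ENNReal.ofReal
          ((leftGram B + (τ : ℂ) • (1 : Matrix T T ℂ)).det.re ^ 2)) a := by
  classical
  set K := B * Bᴴ with hKdef
  have hα : 0 ≤ star a ⬝ᵥ K⁻¹ *ᵥ a := hK.inv.posSemidef.dotProduct_mulVec_nonneg a
  set α := star a ⬝ᵥ K⁻¹ *ᵥ a with hαdef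
  obtain ⟨β, hβ0, hβ⟩ : ∃ β : ℝ, 0 ≤ β ∧ α = β := by
    refine ⟨α.re, (Complex.le_def.1 hα).1, Complex.ext rfl ?_⟩
    simpa using (Complex.le_def.1 hα).2.symm
  set v := ((leftCols B)ᴴ * K⁻¹) *ᵥ a with hv
  have hS : consCol a B * (consCol a B)ᴴ = K + Matrix.vecMulVec a (star a) :=
    consCol_mul_conjTranspose a B
  have hSpd : (K + Matrix.vecMulVec a (star a)).PosDef :=
    hK.add_posSemidef (Matrix.posSemidef_vecMulVec_self_star a)
  have hcol : ∀ p, rowProj (consCol a B) p (Sum.inl ()) =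
      (1 + (β : ℂ))⁻¹ * (star (fun i => consCol a B i p) ⬝ᵥ K⁻¹ *ᵥ a) := by
    intro p
    have : rowProj (consCol a B) p (Sum.inl ()) =
        star (fun i => consCol a B i p) ⬝ᵥ (K + Matrix.vecMulVec a (star a))⁻¹ *ᵥ a := by
      rw [rowProj, hS, Matrix.mul_assoc, Matrix.mul_apply']
      rfl
    rw [this, inv_add_vecMulVec_mulVec hK, dotProduct_smul, ← hαdef, hβ, smul_eq_mul]
  have h00 : (rowProj (consCol a B) (Sum.inl ()) (Sum.inl ())).re = β / (1 + β) := by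
    rw [hcol]
    have : star (fun i => consCol a B i (Sum.inl ())) ⬝ᵥ K⁻¹ *ᵥ a = β := by rw [← hβ]; rfl
    rw [this]
    have : (1 + (β : ℂ))⁻¹ * β = ((β / (1 + β) : ℝ) : ℂ) := by push_cast; ring
    rw [this, Complex.ofReal_re]
  have hG : (fun j : T => rowProj (consCol a B) (Sum.inr (Sum.inl j)) (Sum.inl ())) =
      (1 + (β : ℂ))⁻¹ • v := by
    funext j
    rw [hcol, Pi.smul_apply, smul_eq_mul, hv, ← Matrix.mulVec_mulVec]
    rfl
  have hGn : sqNorm ((1 + (β : ℂ))⁻¹ • v) = sqNorm v / (1 + β) ^ 2 := by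
    simp only [sqNorm, Pi.smul_apply, smul_eq_mul, norm_mul, norm_inv, mul_pow, ← Finset.mul_sum]
    have : ‖(1 + (β : ℂ))‖ = 1 + β := by
      rw [← Complex.ofReal_one, ← Complex.ofReal_add, Complex.norm_of_nonneg (by linarith)]
    rw [this, inv_pow]
    field_simp
  have hsub : (rowProj (consCol a B)).submatrix (fun j : T => Sum.inr (Sum.inl j))
      (fun j : T => Sum.inr (Sum.inl j)) = (leftCols B)ᴴ * (K + Matrix.vecMulVec a (star a))⁻¹ *
        leftCols B := by
    rw [rowProj, hS]
    rfl
  have hdiff : leftGram B - (leftCols B)ᴴ * (K + Matrix.vecMulVec a (star a))⁻¹ * leftCols B =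
      (1 + (β : ℂ))⁻¹ • Matrix.vecMulVec v (star v) := by
    rw [inv_add_vecMulVec hK, ← hαdef, hβ, Matrix.mul_sub, Matrix.sub_mul, sub_sub_cancel,
      Matrix.mul_smul, Matrix.smul_mul, Matrix.mul_vecMulVec, Matrix.vecMulVec_mul, hv,
      Matrix.mulVec_mulVec]
    congr 2
    rw [← Matrix.mulVec_mulVec, Matrix.star_mulVec (leftCols B)ᴴ]
    simp
  unfold criticalWeight
  rw [h00, hG, hGn, hsub]
  split_ifs with hc
  · obtain ⟨h1, h2⟩ := hc
    have hb : 0 < 1 + β := by linarith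
    have he' : 0 < 1 - e := by linarith
    -- This is β/(1+β) < e with denominators cleared; both conditions on a follow from it.
    have hβe : (1 + β) * (1 - e) < 1 := by
      rw [div_lt_iff₀ hb] at h2
      nlinarith
    rw [Set.indicator_of_mem]
    · refine ENNReal.ofReal_le_ofReal ?_
      have hp : ((leftCols B)ᴴ * (K + Matrix.vecMulVec a (star a))⁻¹ * leftCols B).PosSemidef := by
        have := hSpd.inv.posSemidef.mul_mul_conjTranspose_same (leftCols B)ᴴ
        rwa [Matrix.conjTranspose_conjTranspose] at this
      have hp1 := posDef_add_smul_one hp hτ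
      have hp2 := posDef_add_smul_one (posSemidef_leftGram B) hτ
      rw [hp1.posSemidef.det_eq_re, Complex.norm_of_nonneg hp1.det_re_pos.le]
      refine pow_le_pow_left₀ hp1.det_re_pos.le ?_ 2
      refine hp1.posSemidef.det_re_le_of_sub hp2 ?_
      rw [add_sub_add_right_eq_sub, hdiff]
      refine (Matrix.posSemidef_vecMulVec_self_star v).smul ?_
      have : (1 + (β : ℂ))⁻¹ = (((1 + β)⁻¹ : ℝ) : ℂ) := by push_cast; rfl
      rw [this]
      exact_mod_cast (inv_pos.2 hb).le
    · constructor
      · rw [lt_div_iff₀ (by positivity)]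
        rw [div_lt_iff₀ (by positivity)] at h1
        have hs0 : 0 ≤ sqNorm v := sqNorm_nonneg v
        have hspos : 0 < s := by
          by_contra hs
          push Not at hs
          nlinarith [sq_nonneg (1 + β)]
        calc sqNorm v * (1 - e) ^ 2 < s * (1 + β) ^ 2 * (1 - e) ^ 2 := by
              exact mul_lt_mul_of_pos_right h1 (by positivity)
          _ = s * ((1 + β) * (1 - e)) ^ 2 := by ring
          _ ≤ s * 1 := by
              refine mul_le_mul_of_nonneg_left ?_ hspos.le
              exact pow_le_one₀ (by positivity) hβe.le
          _ = s := mul_one s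
      · show α.re < _
        rw [hβ, Complex.ofReal_re, lt_div_iff₀ he']
        nlinarith
  · exact zero_le

end Upper

/-! ### Integrating out the base column -/

instance gaussPiSFinite (ι : Type*) [Fintype ι] : SFinite (gaussPi ι) :=
  inferInstance

theorem measurePreserving_gaussPi_congr {ι ι' : Type*} [Fintype ι] [Fintype ι'] (e : ι ≃ ι') :
    MeasurePreserving (fun (z : ι → ℂ) i => z (e.symm i)) (gaussPi ι) (gaussPi ι') := by
  have h := measurePreserving_piCongrLeft (α := fun _ : ι' => ℂ) (fun _ => gaussC) e
  unfold gaussPi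
  convert h using 1
  funext z i
  obtain ⟨j, rfl⟩ := e.surjective i
  rw [Equiv.symm_apply_apply]
  exact (Equiv.piCongrLeft_apply_apply (fun _ : ι' => ℂ) e z j).symm

theorem measurePreserving_gaussPi_split {ι α β : Type*} [Fintype ι] [Fintype α] [Fintype β]
    (e : ι ≃ α ⊕ β) :
    MeasurePreserving
      (fun z : ι → ℂ => ((fun a => z (e.symm (Sum.inl a))), fun b => z (e.symm (Sum.inr b))))
      (gaussPi ι) ((gaussPi α).prod (gaussPi β)) :=
  (measurePreserving_sumPiEquivProdPi (X := fun _ : α ⊕ β => ℂ) fun _ => gaussC).comp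
    (measurePreserving_gaussPi_congr e)

theorem gaussPi_apply_le {ι : Type*} [Fintype ι] (S : Set (ι → ℂ)) :
    gaussPi ι S ≤ ENNReal.ofReal ((Real.pi⁻¹) ^ Fintype.card ι) * volume S := by
  rw [gaussPi_eq_withDensity]
  have h : (volume.withDensity fun z : ι → ℂ =>
      ENNReal.ofReal ((Real.pi⁻¹) ^ Fintype.card ι * Real.exp (-sqNorm z))) ≤
      volume.withDensity fun _ : ι → ℂ => ENNReal.ofReal ((Real.pi⁻¹) ^ Fintype.card ι) := by
    refine withDensity_mono (Filter.Eventually.of_forall fun z => ENNReal.ofReal_le_ofReal ?_)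
    refine mul_le_of_le_one_right (by positivity) (Real.exp_le_one_iff.2 ?_)
    linarith [sqNorm_nonneg z]
  refine (h S).trans ?_
  rw [withDensity_const]
  rfl

section Upper

variable {T X R : Type*} [Fintype T] [Fintype X] [Fintype R] [DecidableEq T] [DecidableEq X]

/-- One square submatrix suffices: all tangent columns together with as many other columns as X has
elements. It is almost surely invertible, which makes the rows of B independent and also its tangent
columns. -/
theorem ae_posDef [DecidableEq R] (hc : Fintype.card X ≤ Fintype.card R) :
    ∀ᵐ B ∂gaussPi ((T ⊕ X) × (T ⊕ R)),
      (toMat B * (toMat B)ᴴ).PosDef ∧ (leftGram (toMat B)).PosDef ∧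
        ((leftCols (toMat B))ᴴ * leftCols (toMat B)).PosDef := by
  obtain ⟨f⟩ := Function.Embedding.nonempty_of_card_le hc
  let g : T ⊕ X → T ⊕ R := Sum.map id f
  have hg : Function.Injective g := Function.Injective.sumMap Function.injective_id f.injective
  filter_upwards [ae_det_submatrix_ne_zero g hg] with B hB
  set D : Matrix (T ⊕ X) (T ⊕ X) ℂ := Matrix.of fun i j => B (i, g j) with hD
  have hDu : IsUnit D := (Matrix.isUnit_iff_isUnit_det D).2 (isUnit_iff_ne_zero.2 hB)
  have h1 : (toMat B * (toMat B)ᴴ).PosDef := by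
    refine Matrix.PosDef.mul_conjTranspose_self _ fun v w hvw => ?_
    refine Matrix.vecMul_injective_of_isUnit hDu ?_
    funext j
    exact congrFun hvw (g j)
  have h2 : Function.Injective (leftCols (toMat B)).mulVec := by
    intro v w hvw
    have h3 : D *ᵥ (Sum.elim v 0) = D *ᵥ (Sum.elim w 0) := by
      funext i
      have := congrFun hvw i
      simp only [Matrix.mulVec, dotProduct, Fintype.sum_sum_type, Sum.elim_inl, Sum.elim_inr,
        Pi.zero_apply, mul_zero, Finset.sum_const_zero, add_zero] at this ⊢
      exact this
    have h4 := Matrix.mulVec_injective_of_isUnit hDu h3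
    funext t
    exact congrFun h4 (Sum.inl t)
  exact ⟨h1, h1.inv.conjTranspose_mul_mul_same h2, Matrix.PosDef.conjTranspose_mul_self _ h2⟩

/-- For fixed B the bound on the weight is constant on a set of columns a. The Gaussian density is
at most π^(-n) in n complex variables, so the volume estimate `volume_inter_le` bounds the inner
integral. -/
theorem lintegral_criticalWeight_le [DecidableEq R] (hc : Fintype.card X ≤ Fintype.card R)
    {τ s e : ℝ} (hτ : 0 < τ) (hs : 0 < s) (he : 0 < e) (he1 : e < 1) :
    ∫⁻ A, criticalWeight (Sum.inl ()) (fun j : T => Sum.inr (Sum.inl j)) τ s e (rowProj (toMat A))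
      ∂gaussPi ((T ⊕ X) × (Unit ⊕ (T ⊕ R))) ≤
    ENNReal.ofReal ((s / (1 - e) ^ 2) ^ Fintype.card T / (Fintype.card T).factorial *
      ((e / (1 - e)) ^ Fintype.card X / (Fintype.card X).factorial)) *
    ∫⁻ B, ENNReal.ofReal ((leftGram (toMat B) + (τ : ℂ) • (1 : Matrix T T ℂ)).det.re ^ 2 *
      ((toMat B * (toMat B)ᴴ).det.re / (leftGram (toMat B)).det.re))
      ∂gaussPi ((T ⊕ X) × (T ⊕ R)) := by
  classical
  let eq : (T ⊕ X) × (Unit ⊕ (T ⊕ R)) ≃ (T ⊕ X) ⊕ (T ⊕ X) × (T ⊕ R) :=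
    (Equiv.prodSumDistrib (T ⊕ X) Unit (T ⊕ R)).trans
      (Equiv.sumCongr (Equiv.prodPUnit (T ⊕ X)) (Equiv.refl _))
  have hmp := measurePreserving_gaussPi_split eq
  let W : Matrix (Unit ⊕ (T ⊕ R)) (Unit ⊕ (T ⊕ R)) ℂ → ENNReal :=
    criticalWeight (Sum.inl ()) (fun j : T => Sum.inr (Sum.inl j)) τ s e
  have hW : Measurable W := measurable_criticalWeight _ _ _ _ _
  have hcons : Measurable fun p : (T ⊕ X → ℂ) × ((T ⊕ X) × (T ⊕ R) → ℂ) =>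
      consCol p.1 (toMat p.2) := by
    refine Continuous.measurable (continuous_matrix fun i j => ?_)
    rcases j with j | j
    · exact (continuous_apply i).comp continuous_fst
    · exact (continuous_apply (i, j)).comp continuous_snd
  have hmeas : Measurable fun p : (T ⊕ X → ℂ) × ((T ⊕ X) × (T ⊕ R) → ℂ) =>
      W (rowProj (consCol p.1 (toMat p.2))) := by
    unfold rowProj
    exact hW.comp (by fun_prop)
  have h1 := hmp.lintegral_comp hmeas
  have h2 : ∀ A : (T ⊕ X) × (Unit ⊕ (T ⊕ R)) → ℂ,
      consCol (fun a => A (eq.symm (Sum.inl a))) (toMat fun b => A (eq.symm (Sum.inr b))) =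
        toMat A := by
    intro A
    ext i j
    rcases j with j | j <;> rfl
  simp only [h2] at h1
  show ∫⁻ A, W (rowProj (toMat A)) ∂_ ≤ _
  rw [h1, lintegral_prod_symm _ hmeas.aemeasurable,
    ← lintegral_const_mul' _ _ ENNReal.ofReal_ne_top]
  refine lintegral_mono_ae ?_
  filter_upwards [ae_posDef hc] with B hB
  obtain ⟨hK, hN, -⟩ := hB
  have he' : 0 < 1 - e := by linarith
  refine (lintegral_mono fun a => criticalWeight_rowProj_le hK a hτ he1).trans ?_
  refine (lintegral_indicator_const_le _ _).trans ?_
  refine (mul_le_mul_right ((gaussPi_apply_le _).trans (mul_le_mul_right (volume_inter_le _ hK _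
    hN.det_pos.ne' (div_pos hs (by positivity)) (div_pos he he')) _)) _).trans ?_
  have hd : 0 ≤ (toMat B * (toMat B)ᴴ).det.re / (leftGram (toMat B)).det.re :=
    div_nonneg hK.det_re_pos.le hN.det_re_pos.le
  rw [← ENNReal.ofReal_mul (by positivity), ← ENNReal.ofReal_mul (by positivity),
    ← ENNReal.ofReal_mul (by positivity)]
  refine ENNReal.ofReal_le_ofReal (le_of_eq ?_)
  -- The powers of π from the two balls cancel the normalisation of the Gaussian on ℂ^(|T|+|X|).
  have hpi : (Real.pi⁻¹) ^ Fintype.card (T ⊕ X) * Real.pi ^ Fintype.card T *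
      Real.pi ^ Fintype.card X = 1 := by
    rw [Fintype.card_sum, mul_assoc, ← pow_add, ← mul_pow, inv_mul_cancel₀ Real.pi_ne_zero, one_pow]
  linear_combination ((leftGram (toMat B) + (τ : ℂ) • (1 : Matrix T T ℂ)).det.re ^ 2 *
    ((s / (1 - e) ^ 2) ^ Fintype.card T / (Fintype.card T).factorial *
      ((e / (1 - e)) ^ Fintype.card X / (Fintype.card X).factorial)) *
      ((toMat B * (toMat B)ᴴ).det.re / (leftGram (toMat B)).det.re)) * hpi

end Upper

/-! ### The mean of the product of the two determinants -/

@[fun_prop]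
theorem measurable_toMat {κ J : Type*} [Fintype κ] [Fintype J] :
    Measurable (toMat : (κ × J → ℂ) → Matrix κ J ℂ) := by
  have h : Continuous (toMat : (κ × J → ℂ) → Matrix κ J ℂ) :=
    continuous_matrix fun i j => continuous_apply (i, j)
  exact h.measurable

theorem toMat_kronecker_mulVec {κ J : Type*} [Fintype κ] [Fintype J] (V : Matrix κ κ ℂ)
    (U : Matrix J J ℂ) (B : κ × J → ℂ) : toMat ((V ⊗ₖ Uᵀ) *ᵥ B) = V * toMat B * U := by
  ext i j
  simp only [Matrix.of_apply, Matrix.mulVec, dotProduct, Matrix.kroneckerMap_apply,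
    Matrix.transpose_apply, Matrix.mul_apply, Finset.sum_mul, Fintype.sum_prod_type]
  rw [Finset.sum_comm]
  exact Finset.sum_congr rfl fun _ _ => Finset.sum_congr rfl fun _ _ => by ring

theorem lintegral_gaussPi_unitary_mul_mul {κ J : Type*} [Fintype κ] [Fintype J] [DecidableEq κ]
    [DecidableEq J] {V : Matrix κ κ ℂ} {U : Matrix J J ℂ} (hV : Vᴴ * V = 1) (hU : U * Uᴴ = 1)
    (F : Matrix κ J ℂ → ENNReal) (hF : Measurable F) :
    ∫⁻ B, F (V * toMat B * U) ∂gaussPi (κ × J) = ∫⁻ B, F (toMat B) ∂gaussPi (κ × J) := by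
  have hVU : (V ⊗ₖ Uᵀ)ᴴ * (V ⊗ₖ Uᵀ) = 1 := by
    rw [Matrix.conjTranspose_kronecker, ← Matrix.mul_kronecker_mul, hV,
      show (Uᵀ)ᴴ = (Uᴴ)ᵀ from rfl, ← Matrix.transpose_mul, hU, Matrix.transpose_one,
      Matrix.one_kronecker_one]
  simp only [← toMat_kronecker_mulVec]
  exact lintegral_gaussPi_unitary hVU (fun B => F (toMat B)) (hF.comp measurable_toMat)

/-- This is Jacobi's identity for complementary minors: K maps a block triangular matrix built from
the first block column of K⁻¹ to one built from the second block column of K. -/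
theorem det_inv_toBlocks₁₁_mul_det {T X : Type*} [Fintype T] [Fintype X] [DecidableEq T]
    [DecidableEq X] (K : Matrix (T ⊕ X) (T ⊕ X) ℂ) (hK : K.det ≠ 0) :
    K⁻¹.toBlocks₁₁.det * K.det = K.toBlocks₂₂.det := by
  have h : Matrix.fromBlocks K.toBlocks₁₁ K.toBlocks₁₂ K.toBlocks₂₁ K.toBlocks₂₂ *
      Matrix.fromBlocks K⁻¹.toBlocks₁₁ K⁻¹.toBlocks₁₂ K⁻¹.toBlocks₂₁ K⁻¹.toBlocks₂₂ =
      Matrix.fromBlocks 1 0 0 1 := by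
    rw [Matrix.fromBlocks_toBlocks, Matrix.fromBlocks_toBlocks, Matrix.fromBlocks_one]
    exact Matrix.mul_nonsing_inv K (isUnit_iff_ne_zero.2 hK)
  rw [Matrix.fromBlocks_multiply, Matrix.fromBlocks_inj] at h
  obtain ⟨h1, -, h2, -⟩ := h
  have h3 : K * Matrix.fromBlocks K⁻¹.toBlocks₁₁ 0 K⁻¹.toBlocks₂₁ 1 =
      Matrix.fromBlocks 1 K.toBlocks₁₂ 0 K.toBlocks₂₂ := by
    conv_lhs => rw [← Matrix.fromBlocks_toBlocks K]
    rw [Matrix.fromBlocks_multiply]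
    simp only [Matrix.fromBlocks_toBlocks, h1, h2, Matrix.mul_zero, Matrix.mul_one, zero_add]
  have h4 := congrArg Matrix.det h3
  rw [Matrix.det_mul, Matrix.det_fromBlocks_zero₁₂, Matrix.det_fromBlocks_zero₂₁] at h4
  simp only [Matrix.det_one, mul_one, one_mul] at h4
  rw [← h4, mul_comm]

theorem re_det_conjTranspose_mul_self {T : Type*} [Fintype T] [DecidableEq T] (C : Matrix T T ℂ) :
    (Cᴴ * C).det.re = ‖C.det‖ ^ 2 := by
  rw [Matrix.det_mul, Matrix.det_conjTranspose, ← Complex.normSq_eq_norm_sq, ← starRingEnd_apply,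
    ← Complex.normSq_eq_conj_mul_self, Complex.ofReal_re]

theorem lintegral_det_toRows₂ {T X R : Type*} [Fintype T] [Fintype X] [Fintype R] [DecidableEq X]
    [DecidableEq R] :
    ∫⁻ B, ENNReal.ofReal (((toMat B).toRows₂ * (toMat B).toRows₂ᴴ).det.re)
      ∂gaussPi ((T ⊕ X) × R) =
      ((Fintype.card R).descFactorial (Fintype.card X) : ENNReal) := by
  rw [← lintegral_det_mul_conjTranspose (κ := X) (J := R)]
  have hmp := measurePreserving_gaussPi_split (Equiv.sumProdDistrib T X R)
  have h1 := hmp.lintegral_comp (f := fun p : (T × R → ℂ) × (X × R → ℂ) =>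
    ENNReal.ofReal ((toMat p.2 * (toMat p.2)ᴴ).det.re)) (by fun_prop)
  rw [lintegral_prod _ (by fun_prop)] at h1
  simp only [lintegral_const, measure_univ, mul_one] at h1
  exact h1

section Expectation

variable {T X R : Type*} [Fintype T] [Fintype X] [Fintype R] [DecidableEq T] [DecidableEq X]

/-- After the rotation V* the tangent columns are supported in the upper block, so Jacobi's identity
turns det N · det K into det(C*C) times a Gram determinant of the lower rows. Those rows vanish on
the tangent columns, hence only the remaining columns enter. This decouples the two groups of
columns. -/
theorem det_leftGram_mul_det_le {V : Matrix (T ⊕ X) (T ⊕ X) ℂ} (hV : Vᴴ * V = 1)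
    (C : Matrix T T ℂ) (B : Matrix (T ⊕ X) (T ⊕ R) ℂ)
    (hB : leftCols B = V * Matrix.fromRows C (0 : Matrix X T ℂ)) :
    (leftGram B).det.re * (B * Bᴴ).det.re ≤ (Cᴴ * C).det.re *
      ((Vᴴ * B.submatrix id Sum.inr).toRows₂ * (Vᴴ * B.submatrix id Sum.inr).toRows₂ᴴ).det.re := by
  have hV' : V * Vᴴ = 1 := mul_eq_one_comm.1 hV
  -- In the singular case the left side vanishes; stating an inequality avoids an exceptional set.
  by_cases hdet : (B * Bᴴ).det = 0
  · rw [hdet, Complex.zero_re, mul_zero]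
    exact mul_nonneg (Matrix.posSemidef_conjTranspose_mul_self _).det_re_nonneg
      (Matrix.posSemidef_self_mul_conjTranspose _).det_re_nonneg
  set K' := (Vᴴ * B) * (Vᴴ * B)ᴴ with hK'
  have hKK : B * Bᴴ = V * K' * Vᴴ := by
    rw [hK', Matrix.conjTranspose_mul, Matrix.conjTranspose_conjTranspose]
    simp only [← Matrix.mul_assoc, hV', Matrix.one_mul]
    rw [Matrix.mul_assoc (B * Bᴴ), hV', Matrix.mul_one]
  have hVd : V.det * Vᴴ.det = 1 := by rw [← Matrix.det_mul, hV', Matrix.det_one]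
  have hdetK : (B * Bᴴ).det = K'.det := by
    rw [hKK, Matrix.det_mul, Matrix.det_mul, mul_right_comm, hVd, one_mul]
  have hK'0 : K'.det ≠ 0 := by rwa [← hdetK]
  have hinv : (B * Bᴴ)⁻¹ = V * K'⁻¹ * Vᴴ := by
    refine Matrix.inv_eq_right_inv ?_
    rw [hKK]
    calc _ = V * K' * (Vᴴ * V) * K'⁻¹ * Vᴴ := by simp only [Matrix.mul_assoc]
      _ = 1 := by
        rw [hV, Matrix.mul_one, Matrix.mul_assoc V, Matrix.mul_nonsing_inv K'
          (isUnit_iff_ne_zero.2 hK'0), Matrix.mul_one, hV']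
  have hgram : leftGram B = Cᴴ * K'⁻¹.toBlocks₁₁ * C := by
    have h1 : Vᴴ * leftCols B = Matrix.fromRows C (0 : Matrix X T ℂ) := by
      rw [hB, ← Matrix.mul_assoc, hV, Matrix.one_mul]
    have h2 : leftGram B = (Vᴴ * leftCols B)ᴴ * K'⁻¹ * (Vᴴ * leftCols B) := by
      rw [leftGram, hinv, Matrix.conjTranspose_mul, Matrix.conjTranspose_conjTranspose]
      simp only [Matrix.mul_assoc]
    rw [h2, h1, ← Matrix.fromBlocks_toBlocks K'⁻¹, Matrix.mul_assoc,
      Matrix.fromBlocks_mul_fromRows, Matrix.conjTranspose_fromRows_eq_fromCols_conjTranspose,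
      Matrix.fromCols_mul_fromRows]
    simp [Matrix.mul_assoc]
  have h22 : K'.toBlocks₂₂ = (Vᴴ * B.submatrix id Sum.inr).toRows₂ *
      (Vᴴ * B.submatrix id Sum.inr).toRows₂ᴴ := by
    have h0 : ∀ (i : X) (t : T), (Vᴴ * B) (Sum.inr i) (Sum.inl t) = 0 := by
      intro i t
      have h1 : Vᴴ * leftCols B = Matrix.fromRows C (0 : Matrix X T ℂ) := by
        rw [hB, ← Matrix.mul_assoc, hV, Matrix.one_mul]
      have h2 := congrFun (congrFun h1 (Sum.inr i)) t
      exact h2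
    ext i j
    rw [hK']
    simp only [Matrix.toBlocks₂₂, Matrix.of_apply]
    rw [Matrix.mul_apply, Fintype.sum_sum_type]
    simp only [h0, zero_mul, Finset.sum_const_zero, zero_add]
    rw [Matrix.mul_apply]
    rfl
  have h3 : (leftGram B).det * (B * Bᴴ).det = (Cᴴ * C).det * K'.toBlocks₂₂.det := by
    rw [hgram, hdetK, ← det_inv_toBlocks₁₁_mul_det K' hK'0]
    simp only [Matrix.det_mul]
    ring
  have hp1 := posSemidef_leftGram B
  have hp2 := Matrix.posSemidef_self_mul_conjTranspose B
  have hp3 := Matrix.posSemidef_conjTranspose_mul_self C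
  have hp4 := Matrix.posSemidef_self_mul_conjTranspose (Vᴴ * B.submatrix id Sum.inr).toRows₂
  rw [h22, hp1.det_eq_re, hp2.det_eq_re, hp3.det_eq_re, hp4.det_eq_re] at h3
  exact_mod_cast h3.le

theorem lintegral_det_conjTranspose_mul_self {κ : Type*} [Fintype κ] [DecidableEq κ] :
    ∫⁻ B, ENNReal.ofReal (((toMat B)ᴴ * toMat B).det.re) ∂gaussPi (κ × T) =
      ((Fintype.card κ).descFactorial (Fintype.card T) : ENNReal) := by
  rw [← lintegral_det_mul_conjTranspose (κ := T) (J := κ)]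
  have hmp := measurePreserving_gaussPi_congr (Equiv.prodComm κ T)
  have h1 := hmp.lintegral_comp (f := fun p : T × κ → ℂ =>
    ENNReal.ofReal ((toMat p * (toMat p)ᴴ).det.re)) (by fun_prop)
  rw [← h1]
  refine lintegral_congr fun B => ?_
  rw [← Matrix.det_transpose, Matrix.transpose_mul]
  rfl

/-- With the tangent columns fixed, the rotation V depends on them only, so left invariance of the
other Gaussian columns removes it. What is left is a product of two mean Gram determinants: a tall
|T|+|X| by |T| block and a wide |X| by |R| block. -/
theorem lintegral_det_leftGram_mul_det_le [DecidableEq R] :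
    ∫⁻ B, ENNReal.ofReal ((leftGram (toMat B)).det.re * (toMat B * (toMat B)ᴴ).det.re)
      ∂gaussPi ((T ⊕ X) × (T ⊕ R)) ≤
      ((Fintype.card T + Fintype.card X).descFactorial (Fintype.card T) : ENNReal) *
        ((Fintype.card R).descFactorial (Fintype.card X) : ENNReal) := by
  have hmp := measurePreserving_gaussPi_split (Equiv.prodSumDistrib (T ⊕ X) T R)
  let F : Matrix (T ⊕ X) (T ⊕ R) ℂ → ENNReal := fun B =>
    ENNReal.ofReal ((leftGram B).det.re * (B * Bᴴ).det.re)
  have hsub : Measurable fun B : Matrix (T ⊕ X) (T ⊕ R) ℂ => leftCols B :=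
    (continuous_id.matrix_submatrix _ _).measurable
  have hF : Measurable F := by
    refine ENNReal.measurable_ofReal.comp (Measurable.mul ?_ ?_)
    · refine Complex.measurable_re.comp (Measurable.matrix_det ?_)
      unfold leftGram
      fun_prop
    · fun_prop
  have hcols : Measurable fun p : ((T ⊕ X) × T → ℂ) × ((T ⊕ X) × R → ℂ) =>
      Matrix.fromCols (toMat p.1) (toMat p.2) := by
    refine (continuous_matrix fun i j => ?_).measurable
    rcases j with j | j
    · exact (continuous_apply (i, j)).comp continuous_fst
    · exact (continuous_apply (i, j)).comp continuous_snd
  have hFc : Measurable fun p : ((T ⊕ X) × T → ℂ) × ((T ⊕ X) × R → ℂ) =>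
      F (Matrix.fromCols (toMat p.1) (toMat p.2)) := hF.comp hcols
  have h1 := hmp.lintegral_comp hFc
  have h2 : ∀ B : (T ⊕ X) × (T ⊕ R) → ℂ, Matrix.fromCols
      (toMat fun a => B ((Equiv.prodSumDistrib (T ⊕ X) T R).symm (Sum.inl a)))
      (toMat fun b => B ((Equiv.prodSumDistrib (T ⊕ X) T R).symm (Sum.inr b))) = toMat B := by
    intro B
    ext i j
    rcases j with j | j <;> rfl
  simp only [h2] at h1
  refine h1.trans_le ?_
  rw [lintegral_prod _ hFc.aemeasurable]
  have h3 : ∀ BT : (T ⊕ X) × T → ℂ,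
      ∫⁻ BR, F (Matrix.fromCols (toMat BT) (toMat BR)) ∂gaussPi ((T ⊕ X) × R) ≤
        ENNReal.ofReal (((toMat BT)ᴴ * toMat BT).det.re) *
          ((Fintype.card R).descFactorial (Fintype.card X) : ENNReal) := by
    intro BT
    obtain ⟨V, C, hV, hV', hBT⟩ := exists_unitary_mul_fromRows_zero (toMat BT)
    have hC : (toMat BT)ᴴ * toMat BT = Cᴴ * C := by
      rw [hBT, Matrix.conjTranspose_mul, Matrix.mul_assoc, ← Matrix.mul_assoc Vᴴ, hV,
        Matrix.one_mul, Matrix.conjTranspose_fromRows_eq_fromCols_conjTranspose,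
        Matrix.fromCols_mul_fromRows]
      simp
    rw [hC]
    have hle : ∀ BR : (T ⊕ X) × R → ℂ, F (Matrix.fromCols (toMat BT) (toMat BR)) ≤
        ENNReal.ofReal ((Cᴴ * C).det.re) * (fun M : Matrix (T ⊕ X) R ℂ =>
          ENNReal.ofReal ((M.toRows₂ * M.toRows₂ᴴ).det.re)) (Vᴴ * toMat BR *
            (1 : Matrix R R ℂ)) := by
      intro BR
      rw [Matrix.mul_one,
        ← ENNReal.ofReal_mul (Matrix.posSemidef_conjTranspose_mul_self C).det_re_nonneg]
      exact ENNReal.ofReal_le_ofReal (det_leftGram_mul_det_le hV C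
        (Matrix.fromCols (toMat BT) (toMat BR)) hBT)
    refine (lintegral_mono hle).trans ?_
    have hm : Measurable fun M : Matrix (T ⊕ X) R ℂ =>
        ENNReal.ofReal ((M.toRows₂ * M.toRows₂ᴴ).det.re) := by
      have : Measurable fun M : Matrix (T ⊕ X) R ℂ => M.toRows₂ :=
        (continuous_id.matrix_submatrix Sum.inr id).measurable
      fun_prop
    rw [lintegral_const_mul' _ _ ENNReal.ofReal_ne_top,
      lintegral_gaussPi_unitary_mul_mul (by rwa [Matrix.conjTranspose_conjTranspose])
        (by simp) _ hm, lintegral_det_toRows₂]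
  refine (lintegral_mono h3).trans ?_
  rw [lintegral_mul_const' _ _ (ENNReal.natCast_ne_top _), lintegral_det_conjTranspose_mul_self,
    Fintype.card_sum]

end Expectation

/-! ### Domination and the limit τ → 0 -/

theorem sqNorm_mulVec_le {κ J : Type*} [Fintype κ] [Fintype J] (M : Matrix κ J ℂ) (v : J → ℂ) :
    sqNorm (M *ᵥ v) ≤ (∑ i, ∑ j, ‖M i j‖ ^ 2) * sqNorm v := by
  rw [sqNorm, Finset.sum_mul]
  refine Finset.sum_le_sum fun i _ => ?_
  have h1 : ‖(M *ᵥ v) i‖ ≤ ∑ j, ‖M i j‖ * ‖v j‖ :=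
    (norm_sum_le _ _).trans (Finset.sum_le_sum fun j _ => (norm_mul _ _).le)
  exact (pow_le_pow_left₀ (norm_nonneg _) h1 2).trans (Finset.sum_mul_sq_le_sq_mul_sq _ _ _)

theorem posSemidef_smul_one_sub_conjTranspose_mul_self {κ J : Type*} [Fintype κ] [Fintype J]
    [DecidableEq J] (M : Matrix κ J ℂ) {c : ℝ} (hc : ∑ i, ∑ j, ‖M i j‖ ^ 2 ≤ c) :
    ((c : ℂ) • (1 : Matrix J J ℂ) - Mᴴ * M).PosSemidef := by
  refine Matrix.PosSemidef.of_dotProduct_mulVec_nonneg ?_ fun v => ?_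
  · simp [Matrix.IsHermitian, Matrix.conjTranspose_sub, Matrix.conjTranspose_smul]
  · have h1 : star v ⬝ᵥ (Mᴴ * M) *ᵥ v = (sqNorm (M *ᵥ v) : ℂ) := by
      rw [sqNorm_eq_dotProduct, Matrix.star_mulVec, ← Matrix.dotProduct_mulVec,
        Matrix.mulVec_mulVec]
    rw [Matrix.sub_mulVec, dotProduct_sub, Matrix.smul_mulVec, Matrix.one_mulVec,
      dotProduct_smul, ← sqNorm_eq_dotProduct, h1, smul_eq_mul, ← Complex.ofReal_mul,
      ← Complex.ofReal_sub, Complex.zero_le_real, sub_nonneg]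
    exact (sqNorm_mulVec_le M v).trans (mul_le_mul_of_nonneg_right hc (sqNorm_nonneg v))

theorem det_re_real_smul_one {T : Type*} [Fintype T] [DecidableEq T] (c : ℝ) (A : Matrix T T ℂ) :
    ((c : ℂ) • A).det.re = c ^ Fintype.card T * A.det.re := by
  rw [Matrix.det_smul, ← Complex.ofReal_pow, Complex.re_ofReal_mul]

section Bounds

variable {κ T R : Type*} [Fintype κ] [DecidableEq κ] [Fintype T] [DecidableEq T] [Fintype R]
  [DecidableEq R] {B : Matrix κ (T ⊕ R) ℂ}

theorem posSemidef_one_sub_leftGram (hK : (B * Bᴴ).PosDef) : (1 - leftGram B).PosSemidef := by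
  have hu : IsUnit (B * Bᴴ).det := isUnit_iff_ne_zero.2 hK.det_pos.ne'
  have hh : (1 - rowProj B)ᴴ = 1 - rowProj B := by
    rw [rowProj, Matrix.conjTranspose_sub, Matrix.conjTranspose_one, Matrix.conjTranspose_mul,
      Matrix.conjTranspose_mul, hK.inv.1, Matrix.conjTranspose_conjTranspose, Matrix.mul_assoc]
  have h2 : rowProj B * rowProj B = rowProj B := by
    rw [rowProj]
    calc _ = Bᴴ * (B * Bᴴ)⁻¹ * ((B * Bᴴ) * (B * Bᴴ)⁻¹) * B := by simp only [Matrix.mul_assoc]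
      _ = _ := by rw [Matrix.mul_nonsing_inv _ hu, Matrix.mul_one]
  have h1 : 1 - rowProj B = (1 - rowProj B)ᴴ * (1 - rowProj B) := by
    rw [hh, Matrix.mul_sub, Matrix.sub_mul, Matrix.sub_mul, h2]
    simp
  have h3 : (1 - rowProj B).PosSemidef := by
    rw [h1]; exact Matrix.posSemidef_conjTranspose_mul_self _
  have h4 := h3.submatrix (Sum.inl : T → T ⊕ R)
  convert h4 using 1
  ext i j
  simp only [Matrix.sub_apply, Matrix.submatrix_apply, Matrix.one_apply, Sum.inl.injEq]
  rfl

/-- Three operator inequalities combine: N ≤ 1, because N is a compression of a projection; K ≤ c;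
and M*M ≤ cN for the tangent columns M. The last one moves the singularity from det N to det(M*M),
whose inverse has a computable Gaussian mean. -/
theorem det_leftGram_add_one_mul_div_le (hK : (B * Bᴴ).PosDef) (hN : (leftGram B).PosDef)
    (hM : ((leftCols B)ᴴ * leftCols B).PosDef) {c : ℝ} (hc0 : 0 < c)
    (hc : ∑ i, ∑ j, ‖B i j‖ ^ 2 ≤ c) :
    (leftGram B + 1).det.re ^ 2 * ((B * Bᴴ).det.re / (leftGram B).det.re) ≤
      4 ^ Fintype.card T * c ^ (Fintype.card κ + Fintype.card T) /
        ((leftCols B)ᴴ * leftCols B).det.re := by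
  have h1 : (leftGram B + 1).det.re ≤ 2 ^ Fintype.card T := by
    have h := Matrix.PosSemidef.det_re_le_of_sub
      (A := leftGram B + 1) (B := ((2 : ℝ) : ℂ) • (1 : Matrix T T ℂ))
      ((posSemidef_leftGram B).add Matrix.PosSemidef.one)
      (Matrix.PosDef.one.smul (by norm_num)) (by
        convert posSemidef_one_sub_leftGram hK using 1
        push_cast
        rw [two_smul]; abel)
    rw [det_re_real_smul_one] at h
    simpa using h
  have h2 : (B * Bᴴ).det.re ≤ c ^ Fintype.card κ := by
    have hB : ∑ i, ∑ j, ‖Bᴴ i j‖ ^ 2 ≤ c := by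
      rw [Finset.sum_comm]
      simpa using hc
    have h := Matrix.PosSemidef.det_re_le_of_sub hK.posSemidef
      (B := (c : ℂ) • (1 : Matrix κ κ ℂ)) (Matrix.PosDef.one.smul (by exact_mod_cast hc0))
      (by simpa using posSemidef_smul_one_sub_conjTranspose_mul_self Bᴴ hB)
    rw [det_re_real_smul_one] at h
    simpa using h
  have hu : IsUnit (B * Bᴴ).det := isUnit_iff_ne_zero.2 hK.det_pos.ne'
  have h3 : ((leftCols B)ᴴ * leftCols B).det.re ≤ c ^ Fintype.card T * (leftGram B).det.re := by
    rw [← det_re_real_smul_one]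
    refine Matrix.PosSemidef.det_re_le_of_sub hM.posSemidef (hN.smul (by exact_mod_cast hc0)) ?_
    -- Conjugating c - B*B by M*K⁻¹B gives exactly cN - M*M, since BB* = K.
    have h := (posSemidef_smul_one_sub_conjTranspose_mul_self B hc).mul_mul_conjTranspose_same
      ((leftCols B)ᴴ * (B * Bᴴ)⁻¹ * B)
    have h5 : ((leftCols B)ᴴ * (B * Bᴴ)⁻¹ * B)ᴴ = Bᴴ * (B * Bᴴ)⁻¹ * leftCols B := by
      rw [Matrix.conjTranspose_mul, Matrix.conjTranspose_mul, hK.inv.1,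
        Matrix.conjTranspose_conjTranspose, Matrix.mul_assoc]
    convert h using 1
    rw [h5, Matrix.mul_sub, Matrix.sub_mul, Matrix.mul_smul, Matrix.smul_mul, Matrix.mul_one]
    congr 1
    · congr 1
      calc _ = (leftCols B)ᴴ * (B * Bᴴ)⁻¹ * (B * Bᴴ * (B * Bᴴ)⁻¹) * leftCols B := by
            rw [Matrix.mul_nonsing_inv _ hu, Matrix.mul_one]
        _ = _ := by simp only [Matrix.mul_assoc]
    · calc _ = (leftCols B)ᴴ * ((B * Bᴴ)⁻¹ * (B * Bᴴ)) * (B * Bᴴ * (B * Bᴴ)⁻¹) * leftCols B := by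
            rw [Matrix.mul_nonsing_inv _ hu, Matrix.nonsing_inv_mul _ hu, Matrix.mul_one,
              Matrix.mul_one]
        _ = _ := by simp only [Matrix.mul_assoc]
  have hN0 := hN.det_re_pos
  have hM0 := hM.det_re_pos
  have h0 : 0 ≤ (leftGram B + 1).det.re :=
    ((posSemidef_leftGram B).add Matrix.PosSemidef.one).det_re_nonneg
  have h4 : (leftGram B + 1).det.re ^ 2 ≤ 4 ^ Fintype.card T := by
    refine (pow_le_pow_left₀ h0 h1 2).trans (le_of_eq ?_)
    rw [← pow_mul, mul_comm, pow_mul]; norm_num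
  rw [mul_div_assoc]
  refine mul_le_mul h4 ?_ (div_nonneg hK.det_re_pos.le hN0.le) (by positivity)
  rw [div_le_div_iff₀ hN0 hM0, pow_add, mul_assoc]
  exact mul_le_mul h2 h3 hM0.le (by positivity)

end Bounds

theorem lintegral_exp_neg_quadratic {ι : Type*} [Fintype ι] [DecidableEq ι] {P : Matrix ι ι ℂ}
    (hP : P.PosDef) :
    ∫⁻ z : ι → ℂ, ENNReal.ofReal (Real.exp (-(star z ⬝ᵥ P *ᵥ z).re)) =
      ENNReal.ofReal (Real.pi ^ Fintype.card ι / P.det.re) := by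
  have h1 : ∫⁻ z : ι → ℂ, ENNReal.ofReal (Real.exp (-sqNorm z)) =
      ENNReal.ofReal (Real.pi ^ Fintype.card ι) := by
    have h := lintegral_gaussPi (ι := ι) (fun _ => 1) measurable_const
    simp only [lintegral_const, measure_univ, mul_one] at h
    have h2 : ∀ z : ι → ℂ, ENNReal.ofReal (Real.exp (-sqNorm z)) =
        ENNReal.ofReal (Real.pi ^ Fintype.card ι) *
          ENNReal.ofReal ((Real.pi⁻¹) ^ Fintype.card ι * Real.exp (-sqNorm z)) := by
      intro z
      rw [← ENNReal.ofReal_mul (by positivity), ← mul_assoc, ← mul_pow,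
        mul_inv_cancel₀ Real.pi_ne_zero, one_pow, one_mul]
    simp only [h2]
    rw [lintegral_const_mul' _ _ ENNReal.ofReal_ne_top, ← h, mul_one]
  obtain ⟨F, hF, rfl⟩ := hP.exists_eq_mul_conjTranspose
  have hF' : Fᴴ.det ≠ 0 := by rw [Matrix.det_conjTranspose]; exact star_ne_zero.2 hF
  have hm : Measurable (Fᴴ *ᵥ · : (ι → ℂ) → ι → ℂ) := Continuous.measurable (by fun_prop)
  have hmap : (volume : Measure (ι → ℂ)).map (Fᴴ *ᵥ ·) =
      ENNReal.ofReal ((‖Fᴴ.det‖ ^ 2)⁻¹) • volume := by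
    ext s hs
    rw [Measure.map_apply hm hs, volume_preimage_mulVec hF', Measure.smul_apply, smul_eq_mul]
  have h3 : ∀ z : ι → ℂ, (star z ⬝ᵥ (F * Fᴴ) *ᵥ z).re = sqNorm (Fᴴ *ᵥ z) := by
    intro z
    have : star z ⬝ᵥ (F * Fᴴ) *ᵥ z = (sqNorm (Fᴴ *ᵥ z) : ℂ) := by
      rw [sqNorm_eq_dotProduct, Matrix.star_mulVec, ← Matrix.dotProduct_mulVec,
        Matrix.mulVec_mulVec, Matrix.conjTranspose_conjTranspose]
    rw [this, Complex.ofReal_re]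
  simp only [h3]
  rw [← lintegral_map (f := fun z : ι → ℂ => ENNReal.ofReal (Real.exp (-sqNorm z))) (by fun_prop) hm,
    hmap, lintegral_smul_measure, h1, smul_eq_mul, ← ENNReal.ofReal_mul (by positivity)]
  congr 1
  have h4 := re_det_conjTranspose_mul_self Fᴴ
  rw [Matrix.conjTranspose_conjTranspose] at h4
  rw [h4]
  ring

section Finiteness

variable {κ : Type*} [Fintype κ] [DecidableEq κ]

/-- The quadratic form `½ ‖B‖² + ‖(leftCols B) z‖²` as a matrix. -/
def halfPlusRankOne (κ : Type*) [DecidableEq κ] {J : Type*} [DecidableEq J] (w : J → ℂ) :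
    Matrix (κ × J) (κ × J) ℂ :=
  (1 : Matrix κ κ ℂ) ⊗ₖ (Matrix.vecMulVec (star w) w + ((1 / 2 : ℝ) : ℂ) • (1 : Matrix J J ℂ))

theorem posDef_halfPlusRankOne {J : Type*} [Fintype J] [DecidableEq J] (w : J → ℂ) :
    (halfPlusRankOne κ w).PosDef :=
  Matrix.PosDef.one.kronecker (posDef_add_smul_one (Matrix.posSemidef_vecMulVec_star_self w)
    (by norm_num))

theorem det_halfPlusRankOne {J : Type*} [Fintype J] [DecidableEq J] (w : J → ℂ) :
    (halfPlusRankOne κ w).det.re =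
      ((1 / 2) ^ Fintype.card J * (1 + 2 * sqNorm w)) ^ Fintype.card κ := by
  have h1 : Matrix.vecMulVec (star w) w + ((1 / 2 : ℝ) : ℂ) • (1 : Matrix J J ℂ) =
      ((1 / 2 : ℝ) : ℂ) • (1 + Matrix.replicateCol Unit ((2 : ℂ) • star w) *
        Matrix.replicateRow Unit w) := by
    ext i j
    simp [Matrix.vecMulVec_apply, Matrix.mul_apply]
    ring
  have h2 : (Matrix.vecMulVec (star w) w + ((1 / 2 : ℝ) : ℂ) • (1 : Matrix J J ℂ)).det =
      (((1 / 2) ^ Fintype.card J * (1 + 2 * sqNorm w) : ℝ) : ℂ) := by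
    rw [h1, Matrix.det_smul, Matrix.det_one_add_replicateCol_mul_replicateRow, dotProduct_smul,
      dotProduct_comm, ← sqNorm_eq_dotProduct]
    push_cast
    simp
  rw [halfPlusRankOne, Matrix.det_kronecker, Matrix.det_one, one_pow, one_mul, h2,
    ← Complex.ofReal_pow, Complex.ofReal_re]

theorem quadratic_halfPlusRankOne {J : Type*} [Fintype J] [DecidableEq J] (w : J → ℂ)
    (B : κ × J → ℂ) :
    (star B ⬝ᵥ halfPlusRankOne κ w *ᵥ B).re = sqNorm B / 2 + sqNorm (toMat B *ᵥ w) := by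
  have h1 : halfPlusRankOne κ w =
      (1 : Matrix κ κ ℂ) ⊗ₖ Matrix.vecMulVec (star w) w +
        ((1 / 2 : ℝ) : ℂ) • (1 : Matrix (κ × J) (κ × J) ℂ) := by
    rw [halfPlusRankOne, Matrix.kronecker_add, Matrix.kronecker_smul, Matrix.one_kronecker_one]
  have h2 : star B ⬝ᵥ ((1 : Matrix κ κ ℂ) ⊗ₖ Matrix.vecMulVec (star w) w) *ᵥ B =
      (sqNorm (toMat B *ᵥ w) : ℂ) := by
    rw [sqNorm_eq_dotProduct]
    simp only [dotProduct, Matrix.mulVec, Fintype.sum_prod_type, Matrix.kroneckerMap_apply,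
      Matrix.one_apply, Matrix.vecMulVec_apply, Pi.star_apply, Matrix.of_apply, ite_mul, zero_mul,
      one_mul, star_sum, star_mul', Finset.sum_mul]
    refine Finset.sum_congr rfl fun i _ => Finset.sum_congr rfl fun j _ => ?_
    rw [Finset.sum_comm]
    simp only [Finset.sum_ite_eq, Finset.mem_univ, if_true, Finset.mul_sum]
    exact Finset.sum_congr rfl fun _ _ => by ring
  rw [h1, Matrix.add_mulVec, dotProduct_add, h2, Matrix.smul_mulVec, Matrix.one_mulVec,
    dotProduct_smul, ← sqNorm_eq_dotProduct, smul_eq_mul, ← Complex.ofReal_mul,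
    ← Complex.ofReal_add, Complex.ofReal_re]
  ring

theorem lintegral_inv_one_add_sqNorm_pow_lt_top {T : Type*} [Fintype T] (k : ℕ)
    (hk : Fintype.card T < k) :
    ∫⁻ z : T → ℂ, ENNReal.ofReal ((1 + 2 * sqNorm z) ^ k)⁻¹ < ⊤ := by
  have hfr : Module.finrank ℝ (T → ℂ) = 2 * Fintype.card T := by
    rw [Module.finrank_pi_fintype]; simp [mul_comm]
  have h := finite_integral_one_add_norm (E := T → ℂ) (μ := volume) (r := ((2 * k : ℕ) : ℝ))
    (by rw [hfr]; exact_mod_cast (by omega))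
  have h2 : ∫⁻ z : T → ℂ, ENNReal.ofReal (2 ^ k) *
      ENNReal.ofReal ((1 + ‖z‖) ^ (-((2 * k : ℕ) : ℝ))) < ⊤ := by
    rw [lintegral_const_mul' _ _ ENNReal.ofReal_ne_top]
    exact ENNReal.mul_lt_top ENNReal.ofReal_lt_top h
  refine lt_of_le_of_lt (lintegral_mono fun z => ?_) h2
  have hz : ‖z‖ ^ 2 ≤ sqNorm z := by
    have h3 : ‖z‖ ≤ √(sqNorm z) := by
      rw [pi_norm_le_iff_of_nonneg (Real.sqrt_nonneg _)]
      exact fun i => Real.le_sqrt_of_sq_le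
        (Finset.single_le_sum (f := fun i => ‖z i‖ ^ 2) (fun _ _ => by positivity)
          (Finset.mem_univ i))
    calc ‖z‖ ^ 2 ≤ √(sqNorm z) ^ 2 := pow_le_pow_left₀ (norm_nonneg _) h3 2
      _ = _ := Real.sq_sqrt (sqNorm_nonneg z)
  rw [← ENNReal.ofReal_mul (by positivity)]
  refine ENNReal.ofReal_le_ofReal ?_
  have hn := norm_nonneg z
  rw [Real.rpow_neg (by positivity), Real.rpow_natCast, ← div_eq_mul_inv, inv_eq_one_div,
    div_le_div_iff₀ (by have := sqNorm_nonneg z; positivity) (by positivity), one_mul, pow_mul,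
    ← mul_pow]
  refine pow_le_pow_left₀ (by positivity) ?_ k
  nlinarith [sq_nonneg (1 - ‖z‖)]

end Finiteness

section Limit

variable {T X R : Type*} [Fintype T] [Fintype X] [Fintype R] [DecidableEq T] [DecidableEq X]

/-- The integrand of the regularised upper bound. -/
abbrev regularisedWeight (τ : ℝ) (B : (T ⊕ X) × (T ⊕ R) → ℂ) : ℝ :=
  (leftGram (toMat B) + (τ : ℂ) • (1 : Matrix T T ℂ)).det.re ^ 2 *
    ((toMat B * (toMat B)ᴴ).det.re / (leftGram (toMat B)).det.re)

theorem measurable_regularisedWeight (τ : ℝ) :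
    Measurable (regularisedWeight τ : ((T ⊕ X) × (T ⊕ R) → ℂ) → ℝ) := by
  have hsub : Measurable fun B : Matrix (T ⊕ X) (T ⊕ R) ℂ => leftCols B :=
    (continuous_id.matrix_submatrix _ _).measurable
  have hg : Measurable fun B : (T ⊕ X) × (T ⊕ R) → ℂ => leftGram (toMat B) := by
    unfold leftGram
    fun_prop
  have hd : ∀ τ : ℝ, Measurable fun M : Matrix T T ℂ => (M + (τ : ℂ) • (1 : Matrix T T ℂ)).det := by
    intro τ
    exact (Continuous.matrix_det (by fun_prop)).measurable
  unfold regularisedWeight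
  have h1 := (hd τ).comp hg
  refine Measurable.mul ?_ (Measurable.div ?_ ?_)
  · exact (Complex.measurable_re.comp h1).pow_const 2
  · fun_prop
  · exact Complex.measurable_re.comp hg.matrix_det

variable [DecidableEq R]

/-- The inverse determinant is itself a Gaussian integral, of exp(-‖Mz‖²) over z in ℂ^T. Exchanging
the order and integrating B first leaves a constant times (1 + 2‖z‖²)^(-(|T|+|X|)). This is
integrable over 2|T| real dimensions because X is nonempty. -/
theorem lintegral_exp_div_det_lt_top (hX : 0 < Fintype.card X)
    (hc : Fintype.card X ≤ Fintype.card R) :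
    ∫⁻ B, ENNReal.ofReal (Real.exp (sqNorm B / 2) /
      ((leftCols (toMat B))ᴴ * leftCols (toMat B)).det.re)
        ∂gaussPi ((T ⊕ X) × (T ⊕ R)) < ⊤ := by
  let G : ((T ⊕ X) × (T ⊕ R) → ℂ) → (T → ℂ) → ENNReal := fun B z =>
    ENNReal.ofReal ((Real.pi⁻¹) ^ Fintype.card T *
      Real.exp (sqNorm B / 2 - sqNorm (toMat B *ᵥ Sum.elim z 0)))
  have hG : Measurable (Function.uncurry G) := by
    refine Continuous.measurable ?_
    have h1 : Continuous fun p : ((T ⊕ X) × (T ⊕ R) → ℂ) × (T → ℂ) =>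
        toMat p.1 *ᵥ (Sum.elim p.2 0 : T ⊕ R → ℂ) := by
      refine Continuous.matrix_mulVec ?_ ?_
      · exact continuous_matrix fun i j => (continuous_apply (i, j)).comp continuous_fst
      · refine continuous_pi fun j => ?_
        rcases j with j | j
        · exact (continuous_apply j).comp continuous_snd
        · exact continuous_const
    exact ENNReal.continuous_ofReal.comp (continuous_const.mul (Real.continuous_exp.comp
      (((continuous_sqNorm.comp continuous_fst).div_const 2).sub (continuous_sqNorm.comp h1))))
  have h1 : ∫⁻ B, ENNReal.ofReal (Real.exp (sqNorm B / 2) /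
      ((leftCols (toMat B))ᴴ * leftCols (toMat B)).det.re) ∂gaussPi ((T ⊕ X) × (T ⊕ R)) =
      ∫⁻ B, ∫⁻ z, G B z ∂volume ∂gaussPi ((T ⊕ X) × (T ⊕ R)) := by
    refine lintegral_congr_ae ?_
    filter_upwards [ae_posDef hc] with B hB
    have hM := hB.2.2
    have h2 : ∀ z, G B z = ENNReal.ofReal ((Real.pi⁻¹) ^ Fintype.card T * Real.exp (sqNorm B / 2)) *
        ENNReal.ofReal (Real.exp
          (-(star z ⬝ᵥ ((leftCols (toMat B))ᴴ * leftCols (toMat B)) *ᵥ z).re)) := by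
      intro z
      have h3 : toMat B *ᵥ (Sum.elim z 0 : T ⊕ R → ℂ) = leftCols (toMat B) *ᵥ z := by
        funext i
        simp [Matrix.mulVec, dotProduct, Fintype.sum_sum_type]
      have h4 : star z ⬝ᵥ ((leftCols (toMat B))ᴴ * leftCols (toMat B)) *ᵥ z =
          (sqNorm (toMat B *ᵥ (Sum.elim z 0 : T ⊕ R → ℂ)) : ℂ) := by
        rw [h3, sqNorm_eq_dotProduct, Matrix.star_mulVec, ← Matrix.dotProduct_mulVec,
          Matrix.mulVec_mulVec]
      rw [h4, Complex.ofReal_re, ← ENNReal.ofReal_mul (by positivity), mul_assoc, ← Real.exp_add,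
        ← sub_eq_add_neg]
    simp only [h2]
    rw [lintegral_const_mul' _ _ ENNReal.ofReal_ne_top, lintegral_exp_neg_quadratic hM,
      ← ENNReal.ofReal_mul (by positivity)]
    congr 1
    rw [mul_right_comm, mul_div_assoc', ← mul_pow, inv_mul_cancel₀ Real.pi_ne_zero, one_pow,
      div_mul_eq_mul_div, one_mul]
  rw [h1, lintegral_lintegral_swap hG.aemeasurable]
  set N := Fintype.card ((T ⊕ X) × (T ⊕ R)) with hN
  set c : ℝ := (Real.pi⁻¹) ^ N * (Real.pi⁻¹) ^ Fintype.card T with hc'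
  have hc0 : 0 ≤ c := by positivity
  have h2 : ∀ z, ∫⁻ B, G B z ∂gaussPi ((T ⊕ X) × (T ⊕ R)) =
      ENNReal.ofReal (c * (Real.pi ^ N /
        ((1 / 2) ^ Fintype.card (T ⊕ R)) ^ Fintype.card (T ⊕ X))) *
        ENNReal.ofReal ((1 + 2 * sqNorm z) ^ Fintype.card (T ⊕ X))⁻¹ := by
    intro z
    have hGz : Measurable fun B => G B z := hG.of_uncurry_right
    rw [lintegral_gaussPi (fun B => G B z) hGz]
    have h3 : ∀ B : (T ⊕ X) × (T ⊕ R) → ℂ,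
        ENNReal.ofReal ((Real.pi⁻¹) ^ Fintype.card ((T ⊕ X) × (T ⊕ R)) * Real.exp (-sqNorm B)) *
          G B z = ENNReal.ofReal c * ENNReal.ofReal (Real.exp
            (-(star B ⬝ᵥ halfPlusRankOne (T ⊕ X) (Sum.elim z 0 : T ⊕ R → ℂ) *ᵥ B).re)) := by
      intro B
      rw [quadratic_halfPlusRankOne, ← ENNReal.ofReal_mul (by positivity), ← ENNReal.ofReal_mul hc0,
        hc', mul_mul_mul_comm, ← Real.exp_add]
      congr 3
      ring
    simp only [h3]
    have h4 : sqNorm (Sum.elim z 0 : T ⊕ R → ℂ) = sqNorm z := by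
      simp [sqNorm, Fintype.sum_sum_type]
    rw [lintegral_const_mul' _ _ ENNReal.ofReal_ne_top,
      lintegral_exp_neg_quadratic (posDef_halfPlusRankOne _), det_halfPlusRankOne, h4,
      ← ENNReal.ofReal_mul hc0, ← ENNReal.ofReal_mul (by positivity), mul_pow]
    congr 1
    rw [hN]
    field_simp
  simp only [h2]
  rw [lintegral_const_mul' _ _ ENNReal.ofReal_ne_top]
  exact ENNReal.mul_lt_top ENNReal.ofReal_lt_top (lintegral_inv_one_add_sqNorm_pow_lt_top _ (by
    rw [Fintype.card_sum]; omega))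

theorem lintegral_regularisedWeight_one_lt_top (hX : 0 < Fintype.card X)
    (hc : Fintype.card X ≤ Fintype.card R) :
    ∫⁻ B, ENNReal.ofReal (regularisedWeight 1 B) ∂gaussPi ((T ⊕ X) × (T ⊕ R)) < ⊤ := by
  set p := Fintype.card (T ⊕ X) + Fintype.card T with hp
  set c : ℝ := 4 ^ Fintype.card T * (2 ^ p * p.factorial * Real.exp (1 / 2)) with hcdef
  have h2 : ∫⁻ B, ENNReal.ofReal c * ENNReal.ofReal (Real.exp (sqNorm B / 2) /
      ((leftCols (toMat B))ᴴ * leftCols (toMat B)).det.re)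
        ∂gaussPi ((T ⊕ X) × (T ⊕ R)) < ⊤ := by
    rw [lintegral_const_mul' _ _ ENNReal.ofReal_ne_top]
    exact ENNReal.mul_lt_top ENNReal.ofReal_lt_top (lintegral_exp_div_det_lt_top hX hc)
  refine lt_of_le_of_lt (lintegral_mono_ae ?_) h2
  filter_upwards [ae_posDef hc] with B hB
  obtain ⟨hK, hN, hM⟩ := hB
  rw [← ENNReal.ofReal_mul (by positivity)]
  refine ENNReal.ofReal_le_ofReal ?_
  have hs : ∑ i, ∑ j, ‖toMat B i j‖ ^ 2 ≤ 1 + sqNorm B := by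
    rw [sqNorm, Fintype.sum_prod_type]
    simp
  have h3 := det_leftGram_add_one_mul_div_le hK hN hM
    (by have := sqNorm_nonneg B; positivity) hs
  -- The polynomial growth is absorbed by u^p/p! ≤ exp u at u = (1 + ‖B‖²)/2, which costs only half
  -- of the Gaussian exponent.
  have h4 : (1 + sqNorm B) ^ p ≤ 2 ^ p * p.factorial * Real.exp (1 / 2) *
      Real.exp (sqNorm B / 2) := by
    have h5 := Real.pow_div_factorial_le_exp ((1 + sqNorm B) / 2)
      (by have := sqNorm_nonneg B; positivity) p
    rw [div_pow, div_div, div_le_iff₀ (by positivity)] at h5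
    refine h5.trans (le_of_eq ?_)
    rw [add_div, Real.exp_add]
    ring
  have h6 : regularisedWeight 1 B ≤ 4 ^ Fintype.card T * (1 + sqNorm B) ^ p /
      ((leftCols (toMat B))ᴴ * leftCols (toMat B)).det.re := by
    refine le_trans (le_of_eq ?_) h3
    simp [regularisedWeight]
  refine h6.trans ?_
  rw [mul_div_assoc', div_le_div_iff_of_pos_right hM.det_re_pos, hcdef, mul_assoc]
  exact mul_le_mul_of_nonneg_left h4 (by positivity)

theorem tendsto_lintegral_regularisedWeight (hX : 0 < Fintype.card X)
    (hc : Fintype.card X ≤ Fintype.card R) :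
    Filter.Tendsto (fun j : ℕ => ∫⁻ B, ENNReal.ofReal (regularisedWeight (1 / ((j : ℝ) + 1)) B)
      ∂gaussPi ((T ⊕ X) × (T ⊕ R))) Filter.atTop
      (nhds (∫⁻ B, ENNReal.ofReal (regularisedWeight 0 B) ∂gaussPi ((T ⊕ X) × (T ⊕ R)))) := by
  refine tendsto_lintegral_of_dominated_convergence
    (fun B => ENNReal.ofReal (regularisedWeight 1 B))
    (fun j => (measurable_regularisedWeight _).ennreal_ofReal) (fun j => ?_)
    (lintegral_regularisedWeight_one_lt_top hX hc).ne ?_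
  · filter_upwards [ae_posDef hc] with B hB
    obtain ⟨hK, hN, -⟩ := hB
    refine ENNReal.ofReal_le_ofReal (mul_le_mul_of_nonneg_right (pow_le_pow_left₀ ?_ ?_ 2)
      (div_nonneg hK.det_re_pos.le hN.det_re_pos.le))
    · exact (posDef_add_smul_one hN.posSemidef (by positivity)).posSemidef.det_re_nonneg
    · refine Matrix.PosSemidef.det_re_le_of_sub
        (posDef_add_smul_one hN.posSemidef (by positivity)).posSemidef
        (posDef_add_smul_one hN.posSemidef one_pos) ?_
      rw [add_sub_add_left_eq_sub, ← sub_smul, ← Complex.ofReal_sub]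
      refine Matrix.PosSemidef.one.smul ?_
      rw [Complex.zero_le_real, sub_nonneg, div_le_one (by positivity)]
      have : (0 : ℝ) ≤ j := by positivity
      linarith
  · filter_upwards with B
    have hcont : Continuous fun τ : ℝ => ENNReal.ofReal (regularisedWeight τ B) := by
      unfold regularisedWeight
      refine ENNReal.continuous_ofReal.comp (Continuous.mul (Continuous.pow ?_ 2) continuous_const)
      exact Complex.continuous_re.comp (Continuous.matrix_det
        (continuous_const.add (Complex.continuous_ofReal.smul continuous_const)))
    exact (hcont.tendsto 0).comp tendsto_one_div_add_atTop_nhds_zero_nat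

theorem lintegral_regularisedWeight_zero_le (hc : Fintype.card X ≤ Fintype.card R) :
    ∫⁻ B, ENNReal.ofReal (regularisedWeight 0 B) ∂gaussPi ((T ⊕ X) × (T ⊕ R)) ≤
      ((Fintype.card T + Fintype.card X).descFactorial (Fintype.card T) : ENNReal) *
        ((Fintype.card R).descFactorial (Fintype.card X) : ENNReal) := by
  refine le_trans (le_of_eq (lintegral_congr_ae ?_)) lintegral_det_leftGram_mul_det_le
  filter_upwards [ae_posDef hc] with B hB
  have h := hB.2.1.det_re_pos
  congr 1
  simp only [regularisedWeight, Complex.ofReal_zero, zero_smul, add_zero]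
  field_simp

end Limit

/-! ### Determinants of the maps k ↦ Nk + C k̄ -/

section ConjLinear

variable {T : Type*} [Fintype T]

/-- The real-linear map `k ↦ A k + C k̄`. -/
def conjLinear (A C : Matrix T T ℂ) : (T → ℂ) →ₗ[ℝ] (T → ℂ) where
  toFun k := A *ᵥ k + C *ᵥ star k
  map_add' k l := by
    rw [star_add, Matrix.mulVec_add, Matrix.mulVec_add]; abel
  map_smul' c k := by
    rw [star_smul, star_trivial, Matrix.mulVec_smul, Matrix.mulVec_smul, RingHom.id_apply, smul_add]

theorem conjLinear_apply (A C : Matrix T T ℂ) (k : T → ℂ) :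
    conjLinear A C k = A *ᵥ k + C *ᵥ star k := rfl

/-- For symmetric C the bilinear form is a difference of two values of the quadratic form by
polarisation, and the parallelogram law adds up the two bounds. -/
theorem norm_dotProduct_mulVec_le_of_symm {C : Matrix T T ℂ} (hC : Cᵀ = C)
    (h : ∀ k, ‖k ⬝ᵥ C *ᵥ k‖ ≤ sqNorm k) (x y : T → ℂ) :
    ‖x ⬝ᵥ C *ᵥ y‖ ≤ (sqNorm x + sqNorm y) / 2 := by
  have hs : y ⬝ᵥ C *ᵥ x = x ⬝ᵥ C *ᵥ y := by
    rw [Matrix.dotProduct_mulVec, ← Matrix.mulVec_transpose, hC, dotProduct_comm]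
  have h1 : (4 : ℂ) * (x ⬝ᵥ C *ᵥ y) =
      (x + y) ⬝ᵥ C *ᵥ (x + y) - (x - y) ⬝ᵥ C *ᵥ (x - y) := by
    simp only [Matrix.mulVec_add, Matrix.mulVec_sub, dotProduct_add, dotProduct_sub,
      add_dotProduct, sub_dotProduct, hs]
    ring
  have h2 : sqNorm (x + y) + sqNorm (x - y) = 2 * sqNorm x + 2 * sqNorm y := by
    simp only [sqNorm, Finset.mul_sum, ← Finset.sum_add_distrib]
    refine Finset.sum_congr rfl fun i _ => ?_
    have := parallelogram_law_with_norm ℝ (x i) (y i)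
    simp only [Pi.add_apply, Pi.sub_apply]
    linarith
  have h3 : ‖(4 : ℂ) * (x ⬝ᵥ C *ᵥ y)‖ ≤ sqNorm (x + y) + sqNorm (x - y) := by
    rw [h1]
    exact (norm_sub_le _ _).trans (add_le_add (h _) (h _))
  rw [norm_mul, h2] at h3
  norm_num at h3
  linarith

/-- The bilinear bound at x = v̄ and y = C*v reads ‖C*v‖² ≤ (‖v‖² + ‖C*v‖²)/2. -/
theorem posSemidef_one_sub_of_symm [DecidableEq T] {C : Matrix T T ℂ} (hC : Cᵀ = C)
    (h : ∀ k, ‖k ⬝ᵥ C *ᵥ k‖ ≤ sqNorm k) : (1 - C * Cᴴ).PosSemidef := by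
  refine Matrix.PosSemidef.of_dotProduct_mulVec_nonneg ?_ fun v => ?_
  · simp [Matrix.IsHermitian, Matrix.conjTranspose_sub]
  have h1 : star v ⬝ᵥ (C * Cᴴ) *ᵥ v = (sqNorm (Cᴴ *ᵥ v) : ℂ) := by
    rw [sqNorm_eq_dotProduct, Matrix.star_mulVec, ← Matrix.dotProduct_mulVec,
      Matrix.mulVec_mulVec, Matrix.conjTranspose_conjTranspose]
  rw [Matrix.sub_mulVec, dotProduct_sub, Matrix.one_mulVec, h1, ← sqNorm_eq_dotProduct,
    ← Complex.ofReal_sub, Complex.zero_le_real, sub_nonneg]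
  have h2 : ((sqNorm (Cᴴ *ᵥ v) : ℝ) : ℂ) = star v ⬝ᵥ C *ᵥ (Cᴴ *ᵥ v) := by
    rw [← h1, Matrix.mulVec_mulVec]
  have h3 := norm_dotProduct_mulVec_le_of_symm hC h (star v) (Cᴴ *ᵥ v)
  rw [← h2, Complex.norm_real, Real.norm_of_nonneg (sqNorm_nonneg _)] at h3
  have h4 : sqNorm (star v) = sqNorm v := by simp [sqNorm]
  linarith

/-- For symmetric C, composing k + C k̄ with k - C k̄ gives the complex-linear map 1 - CC*.
Multiplication by i intertwines the two factors, so they have equal real determinants. The square of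
the determinant is therefore |det(1 - CC*)|² ≤ 1. -/
theorem abs_det_conjLinear_one_le [DecidableEq T] {C : Matrix T T ℂ} (hC : Cᵀ = C)
    (h : ∀ k, ‖k ⬝ᵥ C *ᵥ k‖ ≤ sqNorm k) : |LinearMap.det (conjLinear 1 C)| ≤ 1 := by
  have hCc : ∀ k : T → ℂ, star (C *ᵥ k) = Cᴴ *ᵥ star k := by
    intro k
    have h1 : (Cᴴ)ᵀ = Cᴴ := by
      ext i j
      exact (congrArg star (congrFun (congrFun hC i) j)).symm
    rw [Matrix.star_mulVec, ← Matrix.mulVec_transpose, h1]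
  have h1 : conjLinear 1 C ∘ₗ conjLinear 1 (-C) =
      (Matrix.mulVecLin (1 - C * Cᴴ)).restrictScalars ℝ := by
    refine LinearMap.ext fun k => ?_
    simp only [LinearMap.comp_apply, conjLinear_apply, LinearMap.restrictScalars_apply,
      Matrix.mulVecLin_apply, Matrix.one_mulVec, star_add, star_neg, Matrix.neg_mulVec, hCc,
      Matrix.mulVec_add, Matrix.mulVec_neg, star_star, Matrix.sub_mulVec, ← Matrix.mulVec_mulVec]
    abel
  let J : (T → ℂ) →ₗ[ℝ] (T → ℂ) :=
    (Matrix.mulVecLin (Complex.I • (1 : Matrix T T ℂ))).restrictScalars ℝ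
  have hJ : ∀ k, J k = Complex.I • k := fun k => by
    simp [J]
  have h2 : J ∘ₗ conjLinear 1 C = conjLinear 1 (-C) ∘ₗ J := by
    refine LinearMap.ext fun k => ?_
    simp only [LinearMap.comp_apply, hJ, conjLinear_apply, Matrix.one_mulVec, smul_add, star_smul,
      Matrix.mulVec_smul, Matrix.neg_mulVec]
    simp
  have hJd : LinearMap.det J ≠ 0 := by
    rw [← abs_ne_zero, abs_det_restrictScalars_mulVecLin, Matrix.det_smul]
    simp
  have h3 : LinearMap.det (conjLinear 1 (-C)) = LinearMap.det (conjLinear 1 C) := by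
    have := congrArg LinearMap.det h2
    rw [LinearMap.det_comp, LinearMap.det_comp, mul_comm] at this
    exact (mul_right_cancel₀ hJd this).symm
  have h4 := congrArg (fun f => |LinearMap.det f|) h1
  simp only [LinearMap.det_comp, h3, abs_det_restrictScalars_mulVecLin, abs_mul] at h4
  have h5 : ‖(1 - C * Cᴴ).det‖ ≤ 1 := by
    have hp := posSemidef_one_sub_of_symm hC h
    rw [hp.det_eq_re, Complex.norm_real, Real.norm_of_nonneg hp.det_re_nonneg]
    refine hp.det_re_le_one ?_
    rw [sub_sub_cancel]
    exact Matrix.posSemidef_self_mul_conjTranspose C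
  have h6 := pow_le_pow_left₀ (norm_nonneg _) h5 2
  rw [← h4, one_pow] at h6
  nlinarith [abs_nonneg (LinearMap.det (conjLinear 1 C))]

/-- With N = FF* the map factors as F ∘ (k ↦ k + C'k̄) ∘ F*, where C' = F⁻¹C(F⁻¹)ᵀ is again
symmetric. The outer factors contribute |det F|⁴ = (det N)². -/
theorem abs_det_conjLinear_le [DecidableEq T] {N C : Matrix T T ℂ} (hN : N.PosDef) (hC : Cᵀ = C)
    (h : ∀ k, ‖star k ⬝ᵥ C *ᵥ star k‖ ≤ (star k ⬝ᵥ N *ᵥ k).re) :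
    |LinearMap.det (conjLinear N C)| ≤ N.det.re ^ 2 := by
  obtain ⟨F, hF, rfl⟩ := hN.exists_eq_mul_conjTranspose
  have hu : IsUnit F.det := isUnit_iff_ne_zero.2 hF
  have hl : F * F⁻¹ = 1 := Matrix.mul_nonsing_inv F hu
  have hr : F⁻¹ * F = 1 := Matrix.nonsing_inv_mul F hu
  set C' := F⁻¹ * C * (F⁻¹)ᵀ with hC'def
  have hC' : C'ᵀ = C' := by
    simp only [hC'def, Matrix.transpose_mul, Matrix.transpose_transpose, hC, Matrix.mul_assoc]
  have hcomp : conjLinear (F * Fᴴ) C = (Matrix.mulVecLin F).restrictScalars ℝ ∘ₗ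
      conjLinear 1 C' ∘ₗ (Matrix.mulVecLin Fᴴ).restrictScalars ℝ := by
    refine LinearMap.ext fun k => ?_
    have h1 : star (Fᴴ *ᵥ k) = Fᵀ *ᵥ star k := by
      rw [Matrix.star_mulVec, Matrix.conjTranspose_conjTranspose, Matrix.mulVec_transpose]
    simp only [LinearMap.comp_apply, conjLinear_apply, LinearMap.restrictScalars_apply,
      Matrix.mulVecLin_apply, Matrix.mulVec_add, Matrix.mulVec_mulVec, h1, Matrix.one_mul]
    congr 2
    calc C = (F * F⁻¹) * C * (F * F⁻¹)ᵀ := by simp [hl]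
      _ = _ := by simp only [hC'def, Matrix.transpose_mul, Matrix.mul_assoc]
  have hb : ∀ k, ‖k ⬝ᵥ C' *ᵥ k‖ ≤ sqNorm k := by
    intro k
    set z : T → ℂ := star ((F⁻¹)ᵀ *ᵥ k) with hz
    have h1 : k ⬝ᵥ C' *ᵥ k = star z ⬝ᵥ C *ᵥ star z := by
      rw [hz, star_star, hC'def, ← Matrix.mulVec_mulVec, ← Matrix.mulVec_mulVec,
        Matrix.dotProduct_mulVec k, ← Matrix.mulVec_transpose]
    have h2 : Fᴴ *ᵥ z = star k := by
      have h3 : z = (F⁻¹)ᴴ *ᵥ star k := by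
        rw [hz, Matrix.star_mulVec, ← Matrix.mulVec_transpose]
        rfl
      rw [h3, Matrix.mulVec_mulVec, ← Matrix.conjTranspose_mul, hr, Matrix.conjTranspose_one,
        Matrix.one_mulVec]
    have h4 : star z ⬝ᵥ (F * Fᴴ) *ᵥ z = (sqNorm (Fᴴ *ᵥ z) : ℂ) := by
      rw [sqNorm_eq_dotProduct, Matrix.star_mulVec, ← Matrix.dotProduct_mulVec,
        Matrix.mulVec_mulVec, Matrix.conjTranspose_conjTranspose]
    have h5 := h z
    rw [← h1, h4, Complex.ofReal_re, h2] at h5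
    refine h5.trans (le_of_eq ?_)
    simp [sqNorm]
  rw [hcomp, LinearMap.det_comp, LinearMap.det_comp, abs_mul, abs_mul,
    abs_det_restrictScalars_mulVecLin, abs_det_restrictScalars_mulVecLin,
    Matrix.det_conjTranspose, norm_star]
  have h6 : (F * Fᴴ).det.re = ‖F.det‖ ^ 2 := by
    have := re_det_conjTranspose_mul_self Fᴴ
    rwa [Matrix.conjTranspose_conjTranspose, Matrix.det_conjTranspose, norm_star] at this
  rw [h6]
  have h7 := mul_le_mul_of_nonneg_left (abs_det_conjLinear_one_le hC' hb)
    (show 0 ≤ ‖F.det‖ ^ 2 * ‖F.det‖ ^ 2 by positivity)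
  nlinarith

/-- Strict domination makes the map injective, so the preimage of the unit ball has the volume of
the ball divided by |det|, and |det| ≤ (det N)². This is why the Kac–Rice weight is the square of a
complex determinant and not the full Hessian. -/
theorem le_det_sq_mul_volume_conjLinear [DecidableEq T] {N C : Matrix T T ℂ} (hN : N.PosDef)
    (hC : Cᵀ = C)
    (h : ∀ k, k ≠ 0 → ‖star k ⬝ᵥ C *ᵥ star k‖ < (star k ⬝ᵥ N *ᵥ k).re) :
    ENNReal.ofReal (Real.pi ^ Fintype.card T / (Fintype.card T).factorial) ≤
      ENNReal.ofReal (N.det.re ^ 2) * volume {k : T → ℂ | sqNorm (N *ᵥ k + C *ᵥ star k) < 1} := by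
  have h' : ∀ k, ‖star k ⬝ᵥ C *ᵥ star k‖ ≤ (star k ⬝ᵥ N *ᵥ k).re := by
    intro k
    rcases eq_or_ne k 0 with rfl | hk
    · simp
    · exact (h k hk).le
  have hinj : LinearMap.det (conjLinear N C) ≠ 0 := by
    intro h0
    obtain ⟨k, hk, hk0⟩ := Submodule.exists_mem_ne_zero_of_ne_bot
      (LinearMap.bot_lt_ker_of_det_eq_zero h0).ne'
    have h1 : N *ᵥ k + C *ᵥ star k = 0 := hk
    have h2 := congrArg (fun v => (star k ⬝ᵥ v).re) h1
    simp only [dotProduct_add, dotProduct_zero, Complex.add_re, Complex.zero_re] at h2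
    have h3 := h k hk0
    have h4 := Complex.abs_re_le_norm (star k ⬝ᵥ C *ᵥ star k)
    have h5 := neg_abs_le (star k ⬝ᵥ C *ᵥ star k).re
    linarith
  have hv := Measure.addHaar_preimage_linearMap (volume : Measure (T → ℂ)) hinj
    {k | sqNorm k < 1}
  have hset : {k : T → ℂ | sqNorm (N *ᵥ k + C *ᵥ star k) < 1} =
      conjLinear N C ⁻¹' {k | sqNorm k < 1} := rfl
  rw [hset, hv, volume_sqNorm_lt 1 one_pos, ← ENNReal.ofReal_mul (by positivity),
    ← ENNReal.ofReal_mul (by positivity), abs_inv]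
  refine ENNReal.ofReal_le_ofReal ?_
  rw [one_pow, one_mul, ← mul_assoc]
  refine le_mul_of_one_le_left (by positivity) ?_
  rw [← div_eq_mul_inv, one_le_div (abs_pos.2 hinj)]
  exact abs_det_conjLinear_le hN hC h'

end ConjLinear

/-! ### The weight at an arbitrary product state -/

section ProductWeight

variable {J : Type*}

/-- The orthogonal projection onto the line spanned by `g`. -/
def stateProj [Fintype J] (g : J → ℂ) : Matrix J J ℂ :=
  ((sqNorm g : ℂ)⁻¹) • Matrix.vecMulVec g (star g)

/-- The projection onto the horizontal space of the product states at a product state. -/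
def tangentProj [DecidableEq J] (P₁ P₂ : Matrix J J ℂ) : Matrix (J × J) (J × J) ℂ :=
  (1 - P₁) ⊗ₖ P₂ + P₁ ⊗ₖ (1 - P₂)

/-- The frame independent form of the Kac–Rice weight at the product state `P₁ ⊗ P₂`. -/
@[irreducible]
def productWeight [Fintype J] [DecidableEq J] (p : ℕ) (τ s e : ℝ) (Q : Matrix (J × J) (J × J) ℂ)
    (P₁ P₂ : Matrix J J ℂ) :
    ENNReal :=
  open Classical in
  if (Matrix.trace ((P₁ ⊗ₖ P₂) * (Q * tangentProj P₁ P₂ * Q))).re < s ∧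
      (Matrix.trace ((P₁ ⊗ₖ P₂) * Q)).re < e then
    ENNReal.ofReal (‖(tangentProj P₁ P₂ * Q * tangentProj P₁ P₂ +
      (τ : ℂ) • (1 : Matrix (J × J) (J × J) ℂ)).det‖ ^ 2 / (τ ^ p) ^ 2) else 0

theorem continuous_kronecker {α : Type*} [TopologicalSpace α] {A B : α → Matrix J J ℂ}
    (hA : Continuous A) (hB : Continuous B) : Continuous fun x => A x ⊗ₖ B x :=
  continuous_matrix fun i j => (hA.matrix_elem i.1 j.1).mul (hB.matrix_elem i.2 j.2)

theorem continuous_tangentProj [DecidableEq J] {α : Type*} [TopologicalSpace α]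
    {A B : α → Matrix J J ℂ}
    (hA : Continuous A) (hB : Continuous B) : Continuous fun x => tangentProj (A x) (B x) :=
  (continuous_kronecker (continuous_const.sub hA) hB).add
    (continuous_kronecker hA (continuous_const.sub hB))

theorem measurable_productWeight [Fintype J] [DecidableEq J] (p : ℕ) (τ s e : ℝ) :
    Measurable fun x : Matrix (J × J) (J × J) ℂ × Matrix J J ℂ × Matrix J J ℂ =>
      productWeight p τ s e x.1 x.2.1 x.2.2 := by
  classical
  have h1 : Continuous fun x : Matrix (J × J) (J × J) ℂ × Matrix J J ℂ × Matrix J J ℂ =>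
      x.2.1 ⊗ₖ x.2.2 := continuous_kronecker (by fun_prop) (by fun_prop)
  have h2 : Continuous fun x : Matrix (J × J) (J × J) ℂ × Matrix J J ℂ × Matrix J J ℂ =>
      tangentProj x.2.1 x.2.2 := continuous_tangentProj (by fun_prop) (by fun_prop)
  have h3 : Continuous fun x : Matrix (J × J) (J × J) ℂ × Matrix J J ℂ × Matrix J J ℂ => x.1 :=
    continuous_fst
  unfold productWeight
  refine Measurable.ite (IsOpen.measurableSet ?_) (ENNReal.measurable_ofReal.comp
    (Continuous.measurable ?_)) measurable_const
  · have h4 := isOpen_lt (Complex.continuous_re.comp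
      ((h1.matrix_mul ((h3.matrix_mul h2).matrix_mul h3)).matrix_trace)) (continuous_const (y := s))
    have h5 := isOpen_lt (Complex.continuous_re.comp ((h1.matrix_mul h3).matrix_trace))
      (continuous_const (y := e))
    exact h4.inter h5
  · exact ((((h2.matrix_mul h3).matrix_mul h2).add continuous_const).matrix_det.norm.pow 2).div_const
      _

theorem measurable_stateProj [Fintype J] : Measurable (stateProj : (J → ℂ) → Matrix J J ℂ) := by
  have h : Continuous fun g : J → ℂ => Matrix.vecMulVec g (star g) :=
    continuous_matrix fun i j => by simp only [Matrix.vecMulVec_apply]; fun_prop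
  unfold stateProj
  have h1 : Measurable fun g : J → ℂ => ((sqNorm g : ℂ))⁻¹ :=
    (Complex.continuous_ofReal.comp continuous_sqNorm).measurable.inv
  exact h1.smul h.measurable

theorem stateProj_mulVec [Fintype J] [DecidableEq J] {V : Matrix J J ℂ} (hV : Vᴴ * V = 1)
    (g : J → ℂ) :
    stateProj (V *ᵥ g) = V * stateProj g * Vᴴ := by
  rw [stateProj, stateProj, sqNorm_unitary_mulVec hV, Matrix.mul_smul, Matrix.smul_mul,
    Matrix.mul_vecMulVec, Matrix.vecMulVec_mul, Matrix.star_mulVec]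

theorem stateProj_smul [Fintype J] {c : ℂ} (hc : c ≠ 0) (g : J → ℂ) :
    stateProj (c • g) = stateProj g := by
  have h1 : sqNorm (c • g) = ‖c‖ ^ 2 * sqNorm g := by
    simp [sqNorm, Finset.mul_sum, mul_pow]
  have h2 : Matrix.vecMulVec (c • g) (star (c • g)) =
      ((‖c‖ ^ 2 : ℝ) : ℂ) • Matrix.vecMulVec g (star g) := by
    ext i j
    have : ((‖c‖ ^ 2 : ℝ) : ℂ) = c * star c := by
      rw [← Complex.normSq_eq_norm_sq, ← Complex.mul_conj]; rfl
    rw [this]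
    simp [Matrix.vecMulVec_apply]
    ring
  rw [stateProj, stateProj, h1, h2, smul_smul]
  congr 1
  have : ((‖c‖ ^ 2 : ℝ) : ℂ) ≠ 0 := by exact_mod_cast (by positivity)
  rw [Complex.ofReal_mul, mul_inv, mul_comm, ← mul_assoc, mul_inv_cancel₀ this, one_mul]

/-- The weight is built from traces and determinants of expressions that are all conjugated by u₁ ⊗
u₂. This lets every product state be moved to the base state. -/
theorem productWeight_conj [Fintype J] [DecidableEq J] {u₁ u₂ : Matrix J J ℂ} (h₁ : u₁ᴴ * u₁ = 1)
    (h₂ : u₂ᴴ * u₂ = 1)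
    (p : ℕ) (τ s e : ℝ) (Q : Matrix (J × J) (J × J) ℂ) (P₁ P₂ : Matrix J J ℂ) :
    productWeight p τ s e ((u₁ ⊗ₖ u₂) * Q * (u₁ ⊗ₖ u₂)ᴴ) (u₁ * P₁ * u₁ᴴ) (u₂ * P₂ * u₂ᴴ) =
      productWeight p τ s e Q P₁ P₂ := by
  set u := u₁ ⊗ₖ u₂ with hu
  have hu1 : uᴴ * u = 1 := by
    rw [hu, Matrix.conjTranspose_kronecker, ← Matrix.mul_kronecker_mul, h₁, h₂,
      Matrix.one_kronecker_one]
  have hu2 : u * uᴴ = 1 := mul_eq_one_comm.1 hu1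
  have h₁' : u₁ * u₁ᴴ = 1 := mul_eq_one_comm.1 h₁
  have h₂' : u₂ * u₂ᴴ = 1 := mul_eq_one_comm.1 h₂
  have hk : ∀ A B : Matrix J J ℂ, (u₁ * A * u₁ᴴ) ⊗ₖ (u₂ * B * u₂ᴴ) = u * (A ⊗ₖ B) * uᴴ := by
    intro A B
    rw [hu, Matrix.conjTranspose_kronecker, ← Matrix.mul_kronecker_mul, ← Matrix.mul_kronecker_mul]
  have hc : ∀ M N : Matrix (J × J) (J × J) ℂ, (u * M * uᴴ) * (u * N * uᴴ) = u * (M * N) * uᴴ := by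
    intro M N
    calc _ = u * M * (uᴴ * u) * N * uᴴ := by simp only [Matrix.mul_assoc]
      _ = _ := by rw [hu1, Matrix.mul_one]; simp only [Matrix.mul_assoc]
  have ht : tangentProj (u₁ * P₁ * u₁ᴴ) (u₂ * P₂ * u₂ᴴ) = u * tangentProj P₁ P₂ * uᴴ := by
    have e1 : 1 - u₁ * P₁ * u₁ᴴ = u₁ * (1 - P₁) * u₁ᴴ := by
      rw [Matrix.mul_sub, Matrix.sub_mul, Matrix.mul_one, h₁']
    have e2 : 1 - u₂ * P₂ * u₂ᴴ = u₂ * (1 - P₂) * u₂ᴴ := by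
      rw [Matrix.mul_sub, Matrix.sub_mul, Matrix.mul_one, h₂']
    rw [tangentProj, tangentProj, e1, e2, hk, hk, Matrix.mul_add, Matrix.add_mul]
  have htr : ∀ M : Matrix (J × J) (J × J) ℂ, (u * M * uᴴ).trace = M.trace := by
    intro M
    rw [Matrix.trace_mul_comm, ← Matrix.mul_assoc, hu1, Matrix.one_mul]
  have hdet : ∀ M : Matrix (J × J) (J × J) ℂ,
      (u * M * uᴴ + (τ : ℂ) • (1 : Matrix (J × J) (J × J) ℂ)).det =
        (M + (τ : ℂ) • (1 : Matrix (J × J) (J × J) ℂ)).det := by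
    intro M
    have : u * M * uᴴ + (τ : ℂ) • (1 : Matrix (J × J) (J × J) ℂ) =
        u * (M + (τ : ℂ) • (1 : Matrix (J × J) (J × J) ℂ)) * uᴴ := by
      rw [Matrix.mul_add, Matrix.add_mul, Matrix.mul_smul, Matrix.smul_mul, Matrix.mul_one, hu2]
    have hd : u.det * uᴴ.det = 1 := by rw [← Matrix.det_mul, hu2, Matrix.det_one]
    rw [this, Matrix.det_mul, Matrix.det_mul, mul_right_comm, hd, one_mul]
  unfold productWeight
  rw [ht, hk]
  simp only [hc, htr, hdet]

end ProductWeight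

/-! ### The weight at the first product basis vector -/

section BasePoint

variable {m : ℕ}

/-- The tangent directions at the first product basis vector. -/
def tangentIdx (m : ℕ) : Fin m ⊕ Fin m → Fin (m + 1) × Fin (m + 1) :=
  Sum.elim (fun i => (i.succ, 0)) fun j => (0, j.succ)

theorem tangentIdx_injective : Function.Injective (tangentIdx m) := by
  rintro (a | a) (b | b) h <;> simp [tangentIdx, Fin.ext_iff] at h ⊢ <;> omega

/-- The inclusion of the tangent directions, as a matrix. -/
abbrev tangentIncl (m : ℕ) : Matrix (Fin (m + 1) × Fin (m + 1)) (Fin m ⊕ Fin m) ℂ :=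
  (1 : Matrix _ _ ℂ).submatrix id (tangentIdx m)

theorem mul_tangentIncl (Q : Matrix (Fin (m + 1) × Fin (m + 1)) (Fin (m + 1) × Fin (m + 1)) ℂ) :
    Q * tangentIncl m = Q.submatrix id (tangentIdx m) := by
  ext i j
  simp [Matrix.mul_apply, Matrix.one_apply]

theorem conjTranspose_tangentIncl_mul
    (Q : Matrix (Fin (m + 1) × Fin (m + 1)) (Fin (m + 1) × Fin (m + 1)) ℂ) :
    (tangentIncl m)ᴴ * Q = Q.submatrix (tangentIdx m) id := by
  ext i j
  simp [Matrix.mul_apply, Matrix.one_apply]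

theorem conjTranspose_mul_tangentIncl : (tangentIncl m)ᴴ * tangentIncl m = 1 := by
  ext i j
  simp [Matrix.mul_apply, Matrix.one_apply, tangentIdx_injective.eq_iff]

theorem stateProj_single : stateProj (Pi.single 0 1 : Fin (m + 1) → ℂ) = Matrix.single 0 0 1 := by
  have h : sqNorm (Pi.single 0 1 : Fin (m + 1) → ℂ) = 1 := by
    simp [sqNorm, Fin.sum_univ_succ]
  ext i j
  simp only [stateProj, h, Matrix.smul_apply, Matrix.vecMulVec_apply, Matrix.single_apply,
    Pi.star_apply, Pi.single_apply]
  by_cases hi : i = 0 <;> by_cases hj : j = 0 <;> simp [hi, hj, eq_comm]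

theorem tangentProj_single :
    tangentProj (Matrix.single 0 0 1) (Matrix.single 0 0 1) =
      tangentIncl m * (tangentIncl m)ᴴ := by
  ext ⟨i, j⟩ ⟨k, l⟩
  rw [Matrix.mul_apply, Fintype.sum_sum_type]
  simp only [tangentProj, Matrix.add_apply, Matrix.kroneckerMap_apply, Matrix.sub_apply,
    Matrix.one_apply, Matrix.single_apply, Matrix.submatrix_apply, Matrix.conjTranspose_apply,
    tangentIdx, Sum.elim_inl, Sum.elim_inr, id, Prod.mk.injEq]
  refine Fin.cases ?_ (fun i => ?_) i <;> refine Fin.cases ?_ (fun j => ?_) j <;>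
    refine Fin.cases ?_ (fun k => ?_) k <;> refine Fin.cases ?_ (fun l => ?_) l <;>
    simp [Fin.succ_ne_zero, (Fin.succ_ne_zero _).symm, apply_ite star, Fin.succ_inj,
      Finset.sum_ite_eq]

/-- The orthogonal complement of the tangent space has dimension (m+1)² - 2m = m² + 1 and
contributes only τ^(m²+1) to the large determinant. The tangent block is isolated by det(1 + XY) =
det(1 + YX). -/
theorem det_tangentProj_single
    (Q : Matrix (Fin (m + 1) × Fin (m + 1)) (Fin (m + 1) × Fin (m + 1)) ℂ) {τ : ℝ} (hτ : 0 < τ) :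
    ‖(tangentProj (Matrix.single 0 0 1) (Matrix.single 0 0 1) * Q *
      tangentProj (Matrix.single 0 0 1) (Matrix.single 0 0 1) +
      (τ : ℂ) • (1 : Matrix (Fin (m + 1) × Fin (m + 1)) (Fin (m + 1) × Fin (m + 1)) ℂ)).det‖ ^ 2 /
        (τ ^ (m ^ 2 + 1)) ^ 2 =
      ‖(Q.submatrix (tangentIdx m) (tangentIdx m) +
        (τ : ℂ) • (1 : Matrix (Fin m ⊕ Fin m) (Fin m ⊕ Fin m) ℂ)).det‖ ^ 2 := by
  have hτ' : (τ : ℂ) ≠ 0 := by exact_mod_cast hτ.ne'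
  set E := tangentIncl m with hE
  have h3 : (E * Eᴴ * Q * (E * Eᴴ) + (τ : ℂ) • 1).det =
      (τ : ℂ) ^ (m ^ 2 + 1) * (Q.submatrix (tangentIdx m) (tangentIdx m) + (τ : ℂ) • 1).det := by
    set N := Q.submatrix (tangentIdx m) (tangentIdx m) with hN
    have hN' : Eᴴ * Q * E = N := by
      rw [Matrix.mul_assoc, hE, mul_tangentIncl]
      ext i j
      simp [Matrix.mul_apply, Matrix.one_apply, hN]
    have h4 : E * Eᴴ * Q * (E * Eᴴ) + (τ : ℂ) • 1 = (τ : ℂ) • (1 + (E * ((τ : ℂ)⁻¹ • N)) * Eᴴ) := by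
      rw [smul_add, Matrix.mul_smul, Matrix.smul_mul, smul_smul, mul_inv_cancel₀ hτ', one_smul,
        ← hN']
      simp only [Matrix.mul_assoc]
      exact add_comm _ _
    have h5 : N + (τ : ℂ) • 1 = (τ : ℂ) • (1 + Eᴴ * (E * ((τ : ℂ)⁻¹ • N))) := by
      rw [← Matrix.mul_assoc, hE, conjTranspose_mul_tangentIncl, Matrix.one_mul, smul_add,
        smul_smul, mul_inv_cancel₀ hτ', one_smul]
      exact add_comm _ _
    rw [h4, h5, Matrix.det_smul, Matrix.det_smul, Matrix.det_one_add_mul_comm, ← mul_assoc,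
      ← pow_add]
    congr 2
    simp only [Fintype.card_prod, Fintype.card_sum, Fintype.card_fin]
    ring
  rw [tangentProj_single, ← hE, h3, norm_mul, mul_pow, norm_pow, Complex.norm_real,
    Real.norm_of_nonneg hτ.le, mul_div_cancel_left₀]
  positivity

theorem single_kronecker_single_zero :
    (Matrix.single 0 0 1 : Matrix (Fin (m + 1)) (Fin (m + 1)) ℂ) ⊗ₖ
      (Matrix.single 0 0 1 : Matrix (Fin (m + 1)) (Fin (m + 1)) ℂ) =
      Matrix.single (0, 0) (0, 0) 1 := by
  rw [Matrix.single_kronecker_single, mul_one]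

theorem trace_single_zero_mul
    (M : Matrix (Fin (m + 1) × Fin (m + 1)) (Fin (m + 1) × Fin (m + 1)) ℂ) :
    (Matrix.single (0, 0) (0, 0) (1 : ℂ) * M).trace = M (0, 0) (0, 0) := by
  rw [Matrix.trace_single_mul]
  exact one_smul ℂ _

theorem productWeight_single {Q : Matrix (Fin (m + 1) × Fin (m + 1)) (Fin (m + 1) × Fin (m + 1)) ℂ}
    (hQ : Qᴴ = Q) {τ : ℝ} (hτ : 0 < τ) (s e : ℝ) :
    productWeight (m ^ 2 + 1) τ s e Q (stateProj (Pi.single 0 1)) (stateProj (Pi.single 0 1)) =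
      criticalWeight (0, 0) (tangentIdx m) τ s e Q := by
  set E := tangentIncl m with hE
  have h1 : ((Q * (E * Eᴴ) * Q) (0, 0) (0, 0)).re = sqNorm fun j => Q (tangentIdx m j) (0, 0) := by
    have : Q * (E * Eᴴ) * Q = Q.submatrix id (tangentIdx m) * Q.submatrix (tangentIdx m) id := by
      rw [← mul_tangentIncl, ← conjTranspose_tangentIncl_mul]
      simp only [Matrix.mul_assoc, hE]
    rw [this, Matrix.mul_apply, Complex.re_sum, sqNorm]
    refine Finset.sum_congr rfl fun j _ => ?_
    have h2 : Q (0, 0) (tangentIdx m j) = star (Q (tangentIdx m j) (0, 0)) := by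
      conv_lhs => rw [← hQ]
      rfl
    simp only [Matrix.submatrix_apply, id]
    rw [h2, ← Complex.normSq_eq_norm_sq, ← starRingEnd_apply, ← Complex.normSq_eq_conj_mul_self,
      Complex.ofReal_re]
  unfold productWeight criticalWeight
  rw [stateProj_single, single_kronecker_single_zero]
  simp only [trace_single_zero_mul, det_tangentProj_single Q hτ]
  rw [tangentProj_single, ← hE, h1]

end BasePoint

/-! ### The gradient in unnormalised coordinates -/

section Gradient

variable {J : Type*}

/-- The coordinates of a product vector. -/
def prodVec (x y : J → ℂ) : J × J → ℂ := fun p => x p.1 * y p.2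

theorem stateProj_kronecker_stateProj [Fintype J] (x y : J → ℂ) :
    stateProj x ⊗ₖ stateProj y =
      ((sqNorm x * sqNorm y : ℝ) : ℂ)⁻¹ • Matrix.vecMulVec (prodVec x y) (star (prodVec x y)) := by
  ext ⟨i, j⟩ ⟨k, l⟩
  simp only [stateProj, prodVec, Matrix.kroneckerMap_apply, Matrix.smul_apply,
    Matrix.vecMulVec_apply, Pi.star_apply, smul_eq_mul, star_mul', Complex.ofReal_mul, mul_inv]
  ring

theorem trace_stateProj_kronecker_mul [Fintype J] (x y : J → ℂ) (M : Matrix (J × J) (J × J) ℂ) :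
    ((stateProj x ⊗ₖ stateProj y) * M).trace =
      ((sqNorm x * sqNorm y : ℝ) : ℂ)⁻¹ * (star (prodVec x y) ⬝ᵥ M *ᵥ prodVec x y) := by
  rw [stateProj_kronecker_stateProj, Matrix.smul_mul, Matrix.trace_smul, Matrix.vecMulVec_mul,
    Matrix.trace_vecMulVec, smul_eq_mul, dotProduct_comm, Matrix.dotProduct_mulVec]

/-- The left side is the squared distance from y to the line through g, so every multiple of g gives
an upper bound. -/
theorem sqNorm_sub_smul_ge [Fintype J] [DecidableEq J] {g : J → ℂ} (hg : 0 < sqNorm g) (y : J → ℂ)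
    (a : ℂ) : (star y ⬝ᵥ (1 - stateProj g) *ᵥ y).re ≤ sqNorm (y - a • g) := by
  set P := stateProj g with hP
  have hg' : (sqNorm g : ℂ) ≠ 0 := by exact_mod_cast hg.ne'
  have hPg : (1 - P) *ᵥ g = 0 := by
    rw [Matrix.sub_mulVec, Matrix.one_mulVec, hP, stateProj, Matrix.smul_mulVec,
      Matrix.vecMulVec_mulVec, ← sqNorm_eq_dotProduct, op_smul_eq_smul, smul_smul,
      inv_mul_cancel₀ hg', one_smul, sub_self]
  have hPs : P.PosSemidef := by
    refine (Matrix.posSemidef_vecMulVec_self_star g).smul ?_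
    rw [← Complex.ofReal_inv, Complex.zero_le_real]
    positivity
  have hH : (1 - P)ᴴ = 1 - P := by
    rw [Matrix.conjTranspose_sub, Matrix.conjTranspose_one, hPs.1]
  have h1 : (1 - P) *ᵥ (y - a • g) = (1 - P) *ᵥ y := by
    rw [Matrix.mulVec_sub, Matrix.mulVec_smul, hPg, smul_zero, sub_zero]
  have h2 : star (y - a • g) ⬝ᵥ (1 - P) *ᵥ (y - a • g) = star y ⬝ᵥ (1 - P) *ᵥ y := by
    rw [h1, Matrix.dotProduct_mulVec, Matrix.dotProduct_mulVec]
    congr 1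
    have := congrArg star h1
    rwa [Matrix.star_mulVec, Matrix.star_mulVec, hH] at this
  have h3 := (Complex.le_def.1 (hPs.dotProduct_mulVec_nonneg (y - a • g))).1
  rw [← h2, Matrix.sub_mulVec, dotProduct_sub, Matrix.one_mulVec, ← sqNorm_eq_dotProduct,
    Complex.sub_re, Complex.ofReal_re]
  simp only [Complex.zero_re] at h3
  linarith

theorem quadratic_kronecker_stateProj [Fintype J] (A : Matrix J J ℂ) (g : J → ℂ)
    (w : J × J → ℂ) :
    star w ⬝ᵥ (A ⊗ₖ stateProj g) *ᵥ w = ((sqNorm g : ℂ))⁻¹ *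
      (star (fun i => ∑ j, w (i, j) * star (g j)) ⬝ᵥ A *ᵥ fun i => ∑ j, w (i, j) * star (g j)) := by
  simp only [dotProduct, Matrix.mulVec, Fintype.sum_prod_type, Matrix.kroneckerMap_apply,
    stateProj, Matrix.smul_apply, Matrix.vecMulVec_apply, Pi.star_apply, smul_eq_mul, star_sum,
    star_mul', star_star, Finset.mul_sum, Finset.sum_mul]
  refine Finset.sum_congr rfl fun i _ => ?_
  rw [Finset.sum_comm]
  refine Finset.sum_congr rfl fun k _ => ?_
  rw [Finset.sum_comm]
  exact Finset.sum_congr rfl fun _ _ => Finset.sum_congr rfl fun _ _ => by ring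

theorem quadratic_stateProj_kronecker [Fintype J] (A : Matrix J J ℂ) (g : J → ℂ)
    (w : J × J → ℂ) :
    star w ⬝ᵥ (stateProj g ⊗ₖ A) *ᵥ w = ((sqNorm g : ℂ))⁻¹ *
      (star (fun j => ∑ i, w (i, j) * star (g i)) ⬝ᵥ A *ᵥ fun j => ∑ i, w (i, j) * star (g i)) := by
  have h := quadratic_kronecker_stateProj A g fun p => w p.swap
  simp only [Prod.swap_prod_mk] at h
  rw [← h]
  simp only [dotProduct, Matrix.mulVec, Fintype.sum_prod_type, Matrix.kroneckerMap_apply,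
    Pi.star_apply, Prod.swap_prod_mk]
  rw [Finset.sum_comm]
  refine Finset.sum_congr rfl fun i _ => Finset.sum_congr rfl fun j _ => ?_
  rw [Finset.sum_comm]
  simp only [mul_comm]

/-- The gradient has one component in each factor, the part of a partial contraction orthogonal to x
or y. Norms at least 1 allow the normalising denominators to be dropped, and the free multiples a
and b can be fitted to the affine chart. -/
theorem re_trace_tangentProj_le [Fintype J] [DecidableEq J] {Q : Matrix (J × J) (J × J) ℂ}
    (hQ : Qᴴ = Q) {x y : J → ℂ} (hx : 1 ≤ sqNorm x) (hy : 1 ≤ sqNorm y) (a b : ℂ) :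
    (Matrix.trace ((stateProj x ⊗ₖ stateProj y) *
      (Q * tangentProj (stateProj x) (stateProj y) * Q))).re ≤
      sqNorm ((fun i => ∑ j, (Q *ᵥ prodVec x y) (i, j) * star (y j)) - a • x) +
      sqNorm ((fun j => ∑ i, (Q *ᵥ prodVec x y) (i, j) * star (x i)) - b • y) := by
  set w := Q *ᵥ prodVec x y with hw
  have hx0 : 0 < sqNorm x := by linarith
  have hy0 : 0 < sqNorm y := by linarith
  have h1 : star (prodVec x y) ⬝ᵥ (Q * tangentProj (stateProj x) (stateProj y) * Q) *ᵥ prodVec x y =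
      star w ⬝ᵥ tangentProj (stateProj x) (stateProj y) *ᵥ w := by
    rw [hw, Matrix.star_mulVec, hQ, ← Matrix.dotProduct_mulVec, Matrix.mulVec_mulVec,
      Matrix.mulVec_mulVec, Matrix.mul_assoc]
  rw [trace_stateProj_kronecker_mul, h1, tangentProj, Matrix.add_mulVec, dotProduct_add,
    quadratic_kronecker_stateProj, quadratic_stateProj_kronecker, ← Complex.ofReal_inv,
    ← Complex.ofReal_inv, ← Complex.ofReal_inv, Complex.re_ofReal_mul, Complex.add_re,
    Complex.re_ofReal_mul, Complex.re_ofReal_mul]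
  have h2 := sqNorm_sub_smul_ge hx0 (fun i => ∑ j, w (i, j) * star (y j)) a
  have h3 := sqNorm_sub_smul_ge hy0 (fun j => ∑ i, w (i, j) * star (x i)) b
  have h4 : ∀ {c r S : ℝ}, 1 ≤ c → r ≤ S → 0 ≤ S → c⁻¹ * r ≤ S := by
    intro c r S hc hr hS
    exact (mul_le_mul_of_nonneg_left hr (by positivity)).trans
      (mul_le_of_le_one_left hS (inv_le_one_of_one_le₀ hc))
  exact h4 (one_le_mul_of_one_le_of_one_le hx hy)
    (add_le_add (h4 hy h2 (sqNorm_nonneg _)) (h4 hx h3 (sqNorm_nonneg _)))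
    (add_nonneg (sqNorm_nonneg _) (sqNorm_nonneg _))

end Gradient

/-! ### First and second order conditions at a minimiser -/

theorem eq_zero_and_nonneg_of_quartic_nonneg {a b c e : ℝ}
    (h : ∀ t : ℝ, 0 ≤ a * t + b * t ^ 2 + c * t ^ 3 + e * t ^ 4) : a = 0 ∧ 0 ≤ b := by
  have h1 : ∀ {a b c e : ℝ}, (∀ t : ℝ, 0 ≤ a * t + b * t ^ 2 + c * t ^ 3 + e * t ^ 4) → 0 ≤ a := by
    intro a b c e h
    have hc : Continuous fun t : ℝ => a + b * t + c * t ^ 2 + e * t ^ 3 := by fun_prop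
    have ht := (hc.tendsto 0).mono_left (nhdsWithin_le_nhds (s := Set.Ioi 0))
    have h2 := ge_of_tendsto ht (b := 0) (by
      filter_upwards [self_mem_nhdsWithin] with t ht
      have h3 := h t
      have ht' : 0 < t := ht
      have h4 : a * t + b * t ^ 2 + c * t ^ 3 + e * t ^ 4 =
        t * (a + b * t + c * t ^ 2 + e * t ^ 3) := by ring
      rw [h4] at h3
      exact nonneg_of_mul_nonneg_right h3 ht')
    simpa using h2
  have ha : a = 0 := by
    refine le_antisymm ?_ (h1 h)
    -- Replacing t by -t reverses the odd coefficients, so the same one-sided limit shows -a ≥ 0.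
    have := h1 (a := -a) (b := b) (c := -c) (e := e) fun t => by
      have := h (-t)
      nlinarith
    linarith
  refine ⟨ha, ?_⟩
  have hc : Continuous fun t : ℝ => b + c * t + e * t ^ 2 := by fun_prop
  have ht := (hc.tendsto 0).mono_left (nhdsWithin_le_nhds (s := Set.Ioi 0))
  have h2 := ge_of_tendsto ht (b := 0) (by
    filter_upwards [self_mem_nhdsWithin] with t ht
    have h3 := h t
    have ht' : 0 < t := ht
    have h4 : a * t + b * t ^ 2 + c * t ^ 3 + e * t ^ 4 =
      t ^ 2 * (b + c * t + e * t ^ 2) := by rw [ha]; ring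
    rw [h4] at h3
    exact nonneg_of_mul_nonneg_right h3 (by positivity))
  simpa using h2

section SecondOrder

variable {m : ℕ}

theorem cons_one_smul (k : Fin m → ℂ) (t : ℝ) :
    (Fin.cons 1 (t • k) : Fin (m + 1) → ℂ) = Pi.single 0 1 + (t : ℂ) • Fin.cons 0 k := by
  funext i
  refine Fin.cases ?_ (fun i => ?_) i <;> simp

theorem sqNorm_cons (a : ℂ) (k : Fin m → ℂ) :
    sqNorm (Fin.cons a k : Fin (m + 1) → ℂ) = ‖a‖ ^ 2 + sqNorm k := by
  simp [sqNorm, Fin.sum_univ_succ]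

theorem sqNorm_real_smul {ι : Type*} [Fintype ι] (t : ℝ) (k : ι → ℂ) :
    sqNorm (t • k) = t ^ 2 * sqNorm k := by
  simp [sqNorm, Finset.mul_sum, mul_pow]

/-- The second order part of a product vector near the base point. -/
abbrev mixedVec (k : Fin m ⊕ Fin m → ℂ) : Fin (m + 1) × Fin (m + 1) → ℂ :=
  prodVec (Fin.cons 0 fun i => k (Sum.inl i)) (Fin.cons 0 fun j => k (Sum.inr j))

/-- The product vector with affine coordinates `t • k`. -/
abbrev chartVec (k : Fin m ⊕ Fin m → ℂ) (t : ℝ) : Fin (m + 1) × Fin (m + 1) → ℂ :=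
  prodVec (Fin.cons 1 (t • fun i => k (Sum.inl i))) (Fin.cons 1 (t • fun j => k (Sum.inr j)))

theorem chartVec_eq (k : Fin m ⊕ Fin m → ℂ) (t : ℝ) :
    chartVec k t = Pi.single (0, 0) 1 + (t : ℂ) • (tangentIncl m *ᵥ k) +
      (t : ℂ) ^ 2 • mixedVec k := by
  have hE : ∀ p, (tangentIncl m *ᵥ k) p =
      ∑ a, (if p = tangentIdx m a then (1 : ℂ) else 0) * k a := fun p => by
    simp [Matrix.mulVec, dotProduct, Matrix.one_apply]
  funext ⟨i, j⟩
  simp only [Pi.add_apply, Pi.smul_apply, hE, prodVec, Fintype.sum_sum_type, tangentIdx,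
    Sum.elim_inl, Sum.elim_inr, Prod.mk.injEq, smul_eq_mul]
  refine Fin.cases ?_ (fun i => ?_) i <;> refine Fin.cases ?_ (fun j => ?_) j <;>
    simp [Fin.succ_ne_zero, (Fin.succ_ne_zero _).symm, Fin.succ_inj]
  ring

/-- The block of the second derivative which pairs the two tensor factors. -/
def mixedBlock (Q : Matrix (Fin (m + 1) × Fin (m + 1)) (Fin (m + 1) × Fin (m + 1)) ℂ) :
    Matrix (Fin m ⊕ Fin m) (Fin m ⊕ Fin m) ℂ :=
  Matrix.fromBlocks 0 (Matrix.of fun i j => Q (i.succ, j.succ) (0, 0))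
    (Matrix.of fun i j => Q (j.succ, i.succ) (0, 0)) 0

theorem transpose_mixedBlock
    (Q : Matrix (Fin (m + 1) × Fin (m + 1)) (Fin (m + 1) × Fin (m + 1)) ℂ) :
    (mixedBlock Q)ᵀ = mixedBlock Q := by
  rw [mixedBlock, Matrix.fromBlocks_transpose]
  rfl

theorem mixedBlock_quadratic
    (Q : Matrix (Fin (m + 1) × Fin (m + 1)) (Fin (m + 1) × Fin (m + 1)) ℂ)
    (k : Fin m ⊕ Fin m → ℂ) :
    star k ⬝ᵥ mixedBlock Q *ᵥ star k =
      2 * (star (mixedVec k) ⬝ᵥ Q *ᵥ Pi.single (0, 0) 1) := by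
  have h1 : star (mixedVec k) ⬝ᵥ Q *ᵥ Pi.single (0, 0) 1 =
      ∑ i, ∑ j, star (k (Sum.inl i)) * star (k (Sum.inr j)) * Q (i.succ, j.succ) (0, 0) := by
    rw [Matrix.mulVec_single_one]
    simp [dotProduct, Fintype.sum_prod_type, Fin.sum_univ_succ, prodVec]
  rw [h1, two_mul]
  simp only [dotProduct, Matrix.mulVec, mixedBlock, Fintype.sum_sum_type, Pi.star_apply,
    Matrix.fromBlocks_apply₁₁, Matrix.fromBlocks_apply₁₂, Matrix.fromBlocks_apply₂₁,
    Matrix.fromBlocks_apply₂₂, Matrix.zero_apply, zero_mul, Finset.sum_const_zero, zero_add,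
    add_zero, Matrix.of_apply, Finset.mul_sum]
  congr 1
  · exact Finset.sum_congr rfl fun _ _ => Finset.sum_congr rfl fun _ _ => by ring
  · rw [Finset.sum_comm]
    exact Finset.sum_congr rfl fun _ _ => Finset.sum_congr rfl fun _ _ => by ring

theorem tangent_quadratic (k : Fin m ⊕ Fin m → ℂ) (v : Fin (m + 1) × Fin (m + 1) → ℂ) :
    star (tangentIncl m *ᵥ k) ⬝ᵥ v = star k ⬝ᵥ fun a => v (tangentIdx m a) := by
  rw [Matrix.star_mulVec, ← Matrix.dotProduct_mulVec]
  congr 1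
  funext a
  simp [Matrix.mulVec, dotProduct, Matrix.one_apply]

theorem mulVec_tangentIncl_apply
    (Q : Matrix (Fin (m + 1) × Fin (m + 1)) (Fin (m + 1) × Fin (m + 1)) ℂ)
    (k : Fin m ⊕ Fin m → ℂ) (a : Fin m ⊕ Fin m) :
    (Q *ᵥ (tangentIncl m *ᵥ k)) (tangentIdx m a) =
      (Q.submatrix (tangentIdx m) (tangentIdx m) *ᵥ k) a := by
  rw [Matrix.mulVec_mulVec, mul_tangentIncl]
  rfl

theorem re_quadratic_symm {ι : Type*} [Fintype ι] {Q : Matrix ι ι ℂ} (hQ : Qᴴ = Q) (u v : ι → ℂ) :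
    (star u ⬝ᵥ Q *ᵥ v).re = (star v ⬝ᵥ Q *ᵥ u).re := by
  have : star (star u ⬝ᵥ Q *ᵥ v) = star v ⬝ᵥ Q *ᵥ u := by
    rw [Matrix.star_dotProduct, star_star, Matrix.star_mulVec, hQ, Matrix.dotProduct_mulVec]
  rw [← this]
  rfl

theorem re_quadratic_expand {ι : Type*} [Fintype ι] {Q : Matrix ι ι ℂ} (hQ : Qᴴ = Q)
    (u v w : ι → ℂ) (t : ℝ) :
    (star (u + (t : ℂ) • v + (t : ℂ) ^ 2 • w) ⬝ᵥ Q *ᵥ (u + (t : ℂ) • v + (t : ℂ) ^ 2 • w)).re =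
      (star u ⬝ᵥ Q *ᵥ u).re + 2 * (star v ⬝ᵥ Q *ᵥ u).re * t +
        ((star v ⬝ᵥ Q *ᵥ v).re + 2 * (star w ⬝ᵥ Q *ᵥ u).re) * t ^ 2 +
        2 * (star w ⬝ᵥ Q *ᵥ v).re * t ^ 3 + (star w ⬝ᵥ Q *ᵥ w).re * t ^ 4 := by
  have h1 := re_quadratic_symm hQ u v
  have h2 := re_quadratic_symm hQ u w
  have h3 := re_quadratic_symm hQ v w
  have hs : ∀ c : ℝ, star (c : ℂ) = c := Complex.conj_ofReal
  simp only [Matrix.mulVec_add, Matrix.mulVec_smul, star_add, star_smul, hs,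
    dotProduct_add, add_dotProduct, dotProduct_smul, smul_dotProduct, smul_eq_mul,
    ← Complex.ofReal_pow, Complex.add_re, Complex.re_ofReal_mul, h1, h2, h3]
  ring

variable {Q : Matrix (Fin (m + 1) × Fin (m + 1)) (Fin (m + 1) × Fin (m + 1)) ℂ} {l : ℝ}

/-- Along the chart line t ↦ t • k the product vector is quadratic in t, so minimality says that a
quartic vanishing at 0 is nonnegative. Its linear coefficient is the gradient paired with k. Its
quadratic coefficient is the Hessian form, in which -l‖k‖² comes from the growth of the norms. -/
theorem second_order_of_minimal (hQ : Qᴴ = Q) (hl : Q (0, 0) (0, 0) = l)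
    (hmin : ∀ x y : Fin (m + 1) → ℂ,
      l * (sqNorm x * sqNorm y) ≤ (star (prodVec x y) ⬝ᵥ Q *ᵥ prodVec x y).re) :
    (∀ a, Q (tangentIdx m a) (0, 0) = 0) ∧ ∀ k : Fin m ⊕ Fin m → ℂ, l * sqNorm k ≤
      (star k ⬝ᵥ Q.submatrix (tangentIdx m) (tangentIdx m) *ᵥ k).re +
        (star k ⬝ᵥ mixedBlock Q *ᵥ star k).re := by
  have h00 : (star (Pi.single (0, 0) 1 : Fin (m + 1) × Fin (m + 1) → ℂ) ⬝ᵥ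
      Q *ᵥ Pi.single (0, 0) 1).re = l := by
    rw [Matrix.mulVec_single_one]
    simp [dotProduct, Pi.single_apply, hl, Matrix.col]
  have key : ∀ k : Fin m ⊕ Fin m → ℂ,
      2 * (star k ⬝ᵥ fun a => Q (tangentIdx m a) (0, 0)).re = 0 ∧
      0 ≤ (star k ⬝ᵥ Q.submatrix (tangentIdx m) (tangentIdx m) *ᵥ k).re +
        (star k ⬝ᵥ mixedBlock Q *ᵥ star k).re - l * sqNorm k := by
    intro k
    set c := 2 * (star (mixedVec k) ⬝ᵥ Q *ᵥ (tangentIncl m *ᵥ k)).re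
    set e := (star (mixedVec k) ⬝ᵥ Q *ᵥ mixedVec k).re -
      l * (sqNorm (fun i => k (Sum.inl i)) * sqNorm fun j => k (Sum.inr j))
    refine eq_zero_and_nonneg_of_quartic_nonneg (c := c) (e := e) fun t => ?_
    have h := hmin (Fin.cons 1 (t • fun i => k (Sum.inl i)))
      (Fin.cons 1 (t • fun j => k (Sum.inr j)))
    have hk : sqNorm k = sqNorm (fun i => k (Sum.inl i)) + sqNorm fun j => k (Sum.inr j) := by
      simp [sqNorm, Fintype.sum_sum_type]
    have h1 : star (tangentIncl m *ᵥ k) ⬝ᵥ Q *ᵥ Pi.single (0, 0) 1 =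
        star k ⬝ᵥ fun a => Q (tangentIdx m a) (0, 0) := by
      rw [tangent_quadratic, Matrix.mulVec_single_one]
      rfl
    have h2 : star (tangentIncl m *ᵥ k) ⬝ᵥ Q *ᵥ (tangentIncl m *ᵥ k) =
        star k ⬝ᵥ Q.submatrix (tangentIdx m) (tangentIdx m) *ᵥ k := by
      rw [tangent_quadratic]
      congr 1
      funext a
      exact mulVec_tangentIncl_apply Q k a
    have h3 : (star k ⬝ᵥ mixedBlock Q *ᵥ star k).re =
        2 * (star (mixedVec k) ⬝ᵥ Q *ᵥ Pi.single (0, 0) 1).re := by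
      rw [mixedBlock_quadratic]
      simp
    rw [show prodVec _ _ = chartVec k t from rfl, chartVec_eq, re_quadratic_expand hQ, h00, h1, h2,
      sqNorm_cons, sqNorm_cons, sqNorm_real_smul, sqNorm_real_smul, norm_one, one_pow] at h
    rw [h3, hk]
    nlinarith
  refine ⟨fun a => ?_, fun k => by linarith [(key k).2]⟩
  -- Taking k to be the gradient itself turns the vanishing linear term into its squared norm.
  have h1 := (key fun a => Q (tangentIdx m a) (0, 0)).1
  rw [← sqNorm_eq_dotProduct, Complex.ofReal_re] at h1
  have h2 : ‖Q (tangentIdx m a) (0, 0)‖ ^ 2 ≤ sqNorm fun a => Q (tangentIdx m a) (0, 0) :=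
    Finset.single_le_sum (f := fun a => ‖Q (tangentIdx m a) (0, 0)‖ ^ 2)
      (fun _ _ => by positivity) (Finset.mem_univ a)
  have h3 : ‖Q (tangentIdx m a) (0, 0)‖ ^ 2 = 0 := le_antisymm (by linarith) (by positivity)
  simpa using h3

theorem exists_norm_eq_one_star_sq_mul (z : ℂ) : ∃ u : ℂ, ‖u‖ = 1 ∧ star u ^ 2 * z = -‖z‖ := by
  refine ⟨Complex.exp (((z.arg - Real.pi) / 2 : ℝ) * Complex.I), Complex.norm_exp_ofReal_mul_I _,
    ?_⟩
  have h1 : star (Complex.exp (((z.arg - Real.pi) / 2 : ℝ) * Complex.I)) ^ 2 =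
      Complex.exp (Real.pi * Complex.I) * Complex.exp (-(z.arg * Complex.I)) := by
    rw [← starRingEnd_apply, ← Complex.exp_conj, ← Complex.exp_nat_mul, ← Complex.exp_add]
    congr 1
    simp only [map_mul, Complex.conj_I, Complex.conj_ofReal]
    push_cast
    ring
  have h2 := Complex.norm_mul_exp_arg_mul_I z
  rw [h1, Complex.exp_pi_mul_I]
  calc -1 * Complex.exp (-(z.arg * Complex.I)) * z =
        -1 * Complex.exp (-(z.arg * Complex.I)) * (‖z‖ * Complex.exp (z.arg * Complex.I)) := by
        rw [h2]
    _ = -‖z‖ * (Complex.exp (-(z.arg * Complex.I)) * Complex.exp (z.arg * Complex.I)) := by ring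
    _ = -‖z‖ := by rw [← Complex.exp_add, neg_add_cancel, Complex.exp_zero, mul_one]

/-- A phase change k ↦ uk leaves the Hermitian part alone and multiplies the mixed term by ū².
Choosing u so that this term becomes minus its modulus upgrades the bound on the real part to one on
the modulus. -/
theorem norm_mixedBlock_quadratic_le
    (h : ∀ k : Fin m ⊕ Fin m → ℂ, l * sqNorm k ≤
      (star k ⬝ᵥ Q.submatrix (tangentIdx m) (tangentIdx m) *ᵥ k).re +
        (star k ⬝ᵥ mixedBlock Q *ᵥ star k).re) (k : Fin m ⊕ Fin m → ℂ) :
    ‖star k ⬝ᵥ mixedBlock Q *ᵥ star k‖ + l * sqNorm k ≤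
      (star k ⬝ᵥ Q.submatrix (tangentIdx m) (tangentIdx m) *ᵥ k).re := by
  obtain ⟨u, hu, hz⟩ := exists_norm_eq_one_star_sq_mul (star k ⬝ᵥ mixedBlock Q *ᵥ star k)
  have hu2 : star u * u = 1 := by
    rw [← starRingEnd_apply, ← Complex.normSq_eq_conj_mul_self, Complex.normSq_eq_norm_sq, hu]
    simp
  have h1 := h (u • k)
  have h2 : sqNorm (u • k) = sqNorm k := by
    simp [sqNorm, hu]
  have h3 : star (u • k) ⬝ᵥ Q.submatrix (tangentIdx m) (tangentIdx m) *ᵥ (u • k) =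
      star k ⬝ᵥ Q.submatrix (tangentIdx m) (tangentIdx m) *ᵥ k := by
    rw [star_smul, Matrix.mulVec_smul, smul_dotProduct, dotProduct_smul, smul_smul, hu2, one_smul]
  have h4 : star (u • k) ⬝ᵥ mixedBlock Q *ᵥ star (u • k) =
      star u ^ 2 * (star k ⬝ᵥ mixedBlock Q *ᵥ star k) := by
    rw [star_smul, Matrix.mulVec_smul, smul_dotProduct, dotProduct_smul, smul_smul, smul_eq_mul, sq]
  rw [h2, h3, h4, hz] at h1
  simp only [Complex.neg_re, Complex.ofReal_re] at h1
  linarith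

end SecondOrder

/-! ### The weight near a minimiser -/

section LocalLimit

variable {m : ℕ} {Q : Matrix (Fin (m + 1) × Fin (m + 1)) (Fin (m + 1) × Fin (m + 1)) ℂ} {l : ℝ}

/-- The rescaled gradient of the product overlap along `t ↦ t • k`. -/
def rescaledGradient (Q : Matrix (Fin (m + 1) × Fin (m + 1)) (Fin (m + 1) × Fin (m + 1)) ℂ)
    (k : Fin m ⊕ Fin m → ℂ) (t : ℝ) : Fin m ⊕ Fin m → ℂ :=
  Sum.elim
    (fun i => (Q *ᵥ (tangentIncl m *ᵥ k)) (i.succ, 0) + t * (Q *ᵥ mixedVec k) (i.succ, 0) +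
      ∑ j : Fin m, (Q *ᵥ chartVec k t) (i.succ, j.succ) * star (k (Sum.inr j)) -
      ((Q *ᵥ chartVec k t) (0, 0) +
        t * ∑ j : Fin m, (Q *ᵥ chartVec k t) (0, j.succ) * star (k (Sum.inr j))) * k (Sum.inl i))
    (fun j => (Q *ᵥ (tangentIncl m *ᵥ k)) (0, j.succ) + t * (Q *ᵥ mixedVec k) (0, j.succ) +
      ∑ i : Fin m, (Q *ᵥ chartVec k t) (i.succ, j.succ) * star (k (Sum.inl i)) -
      ((Q *ᵥ chartVec k t) (0, 0) +
        t * ∑ i : Fin m, (Q *ᵥ chartVec k t) (i.succ, 0) * star (k (Sum.inl i))) * k (Sum.inr j))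

theorem continuous_chartVec (k : Fin m ⊕ Fin m → ℂ) : Continuous (chartVec k) := by
  simp only [funext (chartVec_eq k)]
  fun_prop

theorem continuous_rescaledGradient (k : Fin m ⊕ Fin m → ℂ) :
    Continuous (rescaledGradient Q k) := by
  have h : ∀ p, Continuous fun t => (Q *ᵥ chartVec k t) p := fun p =>
    (continuous_apply p).comp (continuous_const.matrix_mulVec (continuous_chartVec k))
  refine continuous_pi fun a => ?_
  rcases a with i | j <;>
  exact ((continuous_const.add (Complex.continuous_ofReal.mul continuous_const)).add
    (continuous_finsetSum _ fun _ _ => (h _).mul continuous_const)).sub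
    (((h _).add (Complex.continuous_ofReal.mul
      (continuous_finsetSum _ fun _ _ => (h _).mul continuous_const))).mul continuous_const)

theorem rescaledGradient_zero (hl : Q (0, 0) (0, 0) = l) (k : Fin m ⊕ Fin m → ℂ) :
    rescaledGradient Q k 0 =
      Q.submatrix (tangentIdx m) (tangentIdx m) *ᵥ k - (l : ℂ) • k + mixedBlock Q *ᵥ star k := by
  have h0 : chartVec k 0 = Pi.single (0, 0) 1 := by
    rw [chartVec_eq]
    simp
  have h1 : ∀ p, (Q *ᵥ (Pi.single (0, 0) 1 : Fin (m + 1) × Fin (m + 1) → ℂ)) p = Q p (0, 0) := by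
    intro p
    rw [Matrix.mulVec_single_one]
    rfl
  funext a
  rw [Pi.add_apply, Pi.sub_apply, ← mulVec_tangentIncl_apply]
  rcases a with i | j <;>
  · simp only [rescaledGradient, Sum.elim_inl, Sum.elim_inr, h0, h1, hl, Complex.ofReal_zero,
      zero_mul,
      add_zero, tangentIdx, mixedBlock, Pi.smul_apply, smul_eq_mul]
    simp only [Matrix.mulVec, dotProduct, Fintype.sum_sum_type, Pi.star_apply,
      Matrix.fromBlocks_apply₁₁, Matrix.fromBlocks_apply₁₂, Matrix.fromBlocks_apply₂₁,
      Matrix.fromBlocks_apply₂₂, Matrix.zero_apply, zero_mul, Finset.sum_const_zero, zero_add,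
      add_zero, Matrix.of_apply]
    ring

/-- The gradient vanishes at the base state, so a factor t can be taken out of it along the chart
line. What remains is continuous in t, and at t = 0 it is the linearised gradient. -/
theorem re_trace_chart_le (hQ : Qᴴ = Q) (h0 : ∀ a, Q (tangentIdx m a) (0, 0) = 0)
    (k : Fin m ⊕ Fin m → ℂ) (t : ℝ) :
    (Matrix.trace ((stateProj (Fin.cons 1 (t • fun i => k (Sum.inl i)) : Fin (m + 1) → ℂ) ⊗ₖ
      stateProj (Fin.cons 1 (t • fun j => k (Sum.inr j)) : Fin (m + 1) → ℂ)) *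
      (Q * tangentProj (stateProj (Fin.cons 1 (t • fun i => k (Sum.inl i))))
        (stateProj (Fin.cons 1 (t • fun j => k (Sum.inr j)))) * Q))).re ≤
      t ^ 2 * sqNorm (rescaledGradient Q k t) := by
  set x : Fin (m + 1) → ℂ := Fin.cons 1 (t • fun i => k (Sum.inl i)) with hx
  set y : Fin (m + 1) → ℂ := Fin.cons 1 (t • fun j => k (Sum.inr j)) with hy
  have hx1 : 1 ≤ sqNorm x := by
    rw [hx, sqNorm_cons]; simp [sqNorm_nonneg]
  have hy1 : 1 ≤ sqNorm y := by
    rw [hy, sqNorm_cons]; simp [sqNorm_nonneg]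
  set w := Q *ᵥ prodVec x y with hw
  have hwc : w = Q *ᵥ chartVec k t := rfl
  have hwt : ∀ a, w (tangentIdx m a) = t * ((Q *ᵥ (tangentIncl m *ᵥ k)) (tangentIdx m a) +
      t * (Q *ᵥ mixedVec k) (tangentIdx m a)) := by
    intro a
    rw [hwc, chartVec_eq, Matrix.mulVec_add, Matrix.mulVec_add, Matrix.mulVec_smul,
      Matrix.mulVec_smul, Matrix.mulVec_single_one]
    simp only [Pi.add_apply, Pi.smul_apply, smul_eq_mul, Matrix.col_apply, h0]
    ring
  -- The multiples are the zeroth components of the two contractions. As x and y have zeroth entry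
  -- 1, subtraction cancels the zeroth coordinate.
  refine (re_trace_tangentProj_le hQ hx1 hy1 (∑ j, w (0, j) * star (y j))
    (∑ i, w (i, 0) * star (x i))).trans (le_of_eq ?_)
  rw [← sqNorm_real_smul]
  rw [← hw]
  have hsum : ∀ f g : Fin m → ℂ, ∑ j, f j * star (t • g j) = t * ∑ j, f j * star (g j) := by
    intro f g
    rw [Finset.mul_sum]
    refine Finset.sum_congr rfl fun j _ => ?_
    rw [star_smul, star_trivial, Complex.real_smul]
    ring
  have e1 : ((fun i => ∑ j, w (i, j) * star (y j)) - (∑ j, w (0, j) * star (y j)) • x) =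
      Fin.cons 0 fun i => (t • rescaledGradient Q k t) (Sum.inl i) := by
    funext i
    refine Fin.cases ?_ (fun i => ?_) i
    · simp [hx]
    · have h := hwt (Sum.inl i)
      simp only [tangentIdx, Sum.elim_inl] at h
      simp only [Pi.sub_apply, Pi.smul_apply, Fin.sum_univ_succ, hx, hy, Fin.cons_zero,
        Fin.cons_succ, star_one, mul_one, h, rescaledGradient, Sum.elim_inl, smul_eq_mul, ← hwc,
        hsum]
      rw [Complex.real_smul, Complex.real_smul]
      ring
  have e2 : ((fun j => ∑ i, w (i, j) * star (x i)) - (∑ i, w (i, 0) * star (x i)) • y) =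
      Fin.cons 0 fun j => (t • rescaledGradient Q k t) (Sum.inr j) := by
    funext j
    refine Fin.cases ?_ (fun j => ?_) j
    · simp [hy]
    · have h := hwt (Sum.inr j)
      simp only [tangentIdx, Sum.elim_inr] at h
      simp only [Pi.sub_apply, Pi.smul_apply, Fin.sum_univ_succ, hx, hy, Fin.cons_zero,
        Fin.cons_succ, star_one, mul_one, h, rescaledGradient, Sum.elim_inr, smul_eq_mul, ← hwc,
        hsum]
      rw [Complex.real_smul, Complex.real_smul]
      ring
  rw [e1, e2, sqNorm_cons, sqNorm_cons]
  simp [sqNorm, Fintype.sum_sum_type]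

theorem continuous_stateProj_cons (k : Fin m → ℂ) :
    Continuous fun t : ℝ => stateProj (Fin.cons 1 (t • k) : Fin (m + 1) → ℂ) := by
  have h1 : Continuous fun t : ℝ => (Fin.cons 1 (t • k) : Fin (m + 1) → ℂ) := by
    simp only [cons_one_smul]
    fun_prop
  have h2 : Continuous fun t : ℝ =>
      Matrix.vecMulVec (Fin.cons 1 (t • k) : Fin (m + 1) → ℂ) (star (Fin.cons 1 (t • k))) :=
    continuous_matrix fun i j => ((continuous_apply i).comp h1).mul
      ((continuous_apply j).comp h1).star
  unfold stateProj
  refine Continuous.smul (Continuous.inv₀ (Complex.continuous_ofReal.comp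
    (continuous_sqNorm.comp h1)) fun t => ?_) h2
  simp only [Function.comp_apply]
  rw [sqNorm_cons]
  have h3 : (1 : ℝ) + sqNorm (t • k) ≠ 0 := by
    have := sqNorm_nonneg (t • k)
    positivity
  rw [norm_one, one_pow]
  exact_mod_cast h3

/-- Pointwise limit of the rescaled weight around a minimal product vector. -/
theorem tendsto_productWeight (hQ : Qᴴ = Q) (hl : Q (0, 0) (0, 0) = l) (hl0 : 0 ≤ l)
    (hmin : ∀ x y : Fin (m + 1) → ℂ,
      l * (sqNorm x * sqNorm y) ≤ (star (prodVec x y) ⬝ᵥ Q *ᵥ prodVec x y).re)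
    {τ e : ℝ} (hτ : 0 < τ) (hle : l < e) {k : Fin m ⊕ Fin m → ℂ}
    (hk : sqNorm ((Q.submatrix (tangentIdx m) (tangentIdx m) + (τ : ℂ) • 1) *ᵥ k +
      mixedBlock Q *ᵥ star k) < 1) :
    Tendsto (fun t : ℝ => productWeight (m ^ 2 + 1) τ (t ^ 2) e Q
        (stateProj (Fin.cons 1 (t • fun i => k (Sum.inl i)) : Fin (m + 1) → ℂ))
        (stateProj (Fin.cons 1 (t • fun j => k (Sum.inr j)) : Fin (m + 1) → ℂ))) (𝓝[>] 0)
      (𝓝 (ENNReal.ofReal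
        (‖(Q.submatrix (tangentIdx m) (tangentIdx m) + (τ : ℂ) • 1).det‖ ^ 2))) := by
  obtain ⟨h0, h2⟩ := second_order_of_minimal hQ hl hmin
  set N := Q.submatrix (tangentIdx m) (tangentIdx m) with hN
  set P₁ : ℝ → Matrix (Fin (m + 1)) (Fin (m + 1)) ℂ := fun t =>
    stateProj (Fin.cons 1 (t • fun i => k (Sum.inl i))) with hP₁
  set P₂ : ℝ → Matrix (Fin (m + 1)) (Fin (m + 1)) ℂ := fun t =>
    stateProj (Fin.cons 1 (t • fun j => k (Sum.inr j))) with hP₂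
  have hc₁ : Continuous P₁ := continuous_stateProj_cons _
  have hc₂ : Continuous P₂ := continuous_stateProj_cons _
  have hz : ∀ k : Fin m → ℂ,
      stateProj (Fin.cons 1 ((0 : ℝ) • k) : Fin (m + 1) → ℂ) = Matrix.single 0 0 1 := by
    intro k
    rw [cons_one_smul, Complex.ofReal_zero, zero_smul, add_zero, stateProj_single]
  have hz₁ : P₁ 0 = Matrix.single 0 0 1 := hz _
  have hz₂ : P₂ 0 = Matrix.single 0 0 1 := hz _
  have hgrad : sqNorm (rescaledGradient Q k 0) < 1 := by
    refine lt_of_le_of_lt ?_ hk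
    rw [rescaledGradient_zero hl, ← hN]
    -- H is the true linearised gradient, and the second order condition says Re⟨k, H⟩ ≥ 0. Hence
    -- adding (l + τ)k can only increase its norm, and the hypothesis on (N + τ)k + C k̄ also bounds
    -- H.
    set H := N *ᵥ k - (l : ℂ) • k + mixedBlock Q *ᵥ star k with hH
    have e1 : (N + (τ : ℂ) • 1) *ᵥ k + mixedBlock Q *ᵥ star k = H + ((l + τ : ℝ) : ℂ) • k := by
      rw [hH, Matrix.add_mulVec, Matrix.smul_mulVec, Matrix.one_mulVec, Complex.ofReal_add,
        add_smul]
      abel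
    have e2 : 0 ≤ (star k ⬝ᵥ H).re := by
      have := h2 k
      rw [hH, dotProduct_add, dotProduct_sub, dotProduct_smul, ← sqNorm_eq_dotProduct,
        Complex.add_re, Complex.sub_re, smul_eq_mul, Complex.re_ofReal_mul, Complex.ofReal_re]
      linarith
    have e3 : ∀ c : ℝ, sqNorm (H + (c : ℂ) • k) =
        sqNorm H + 2 * c * (star k ⬝ᵥ H).re + c ^ 2 * sqNorm k := by
      intro c
      have e4 : (star H ⬝ᵥ k).re = (star k ⬝ᵥ H).re := by
        have : star (star H ⬝ᵥ k) = star k ⬝ᵥ H := by rw [Matrix.star_dotProduct, star_star]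
        rw [← this]
        rfl
      have e5 := congrArg Complex.re (sqNorm_eq_dotProduct (H + (c : ℂ) • k))
      have hs : star (c : ℂ) = c := Complex.conj_ofReal c
      rw [Complex.ofReal_re] at e5
      rw [e5]
      simp only [star_add, star_smul, hs, dotProduct_add, add_dotProduct, dotProduct_smul,
        smul_dotProduct, smul_eq_mul, Complex.add_re, Complex.re_ofReal_mul, e4,
        ← sqNorm_eq_dotProduct, Complex.ofReal_re]
      ring
    rw [e1, e3]
    have hlt : 0 ≤ l + τ := by linarith
    have := sqNorm_nonneg k
    nlinarith [mul_nonneg hlt e2, mul_nonneg (sq_nonneg (l + τ)) this]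
  have hev1 : ∀ᶠ t in 𝓝[>] (0 : ℝ), (Matrix.trace ((P₁ t ⊗ₖ P₂ t) *
      (Q * tangentProj (P₁ t) (P₂ t) * Q))).re < t ^ 2 := by
    have hc := ((continuous_sqNorm.comp (continuous_rescaledGradient (Q := Q) k)).tendsto
      0).mono_left (nhdsWithin_le_nhds (s := Set.Ioi 0))
    filter_upwards [hc.eventually_lt_const hgrad, self_mem_nhdsWithin] with t ht ht0
    have ht0' : 0 < t := ht0
    refine (re_trace_chart_le hQ h0 k t).trans_lt ?_
    exact mul_lt_of_lt_one_right (by positivity) ht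
  have hev2 : ∀ᶠ t in 𝓝[>] (0 : ℝ), (Matrix.trace ((P₁ t ⊗ₖ P₂ t) * Q)).re < e := by
    have hc : Continuous fun t => (Matrix.trace ((P₁ t ⊗ₖ P₂ t) * Q)).re :=
      Complex.continuous_re.comp
        ((continuous_kronecker hc₁ hc₂).matrix_mul continuous_const).matrix_trace
    have ht := (hc.tendsto 0).mono_left (nhdsWithin_le_nhds (s := Set.Ioi 0))
    refine ht.eventually_lt_const ?_
    rw [hz₁, hz₂, single_kronecker_single_zero, trace_single_zero_mul, hl, Complex.ofReal_re]
    exact hle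
  have hval : Tendsto (fun t => ENNReal.ofReal (‖(tangentProj (P₁ t) (P₂ t) * Q *
      tangentProj (P₁ t) (P₂ t) + (τ : ℂ) • 1).det‖ ^ 2 / (τ ^ (m ^ 2 + 1)) ^ 2)) (𝓝[>] 0)
      (𝓝 (ENNReal.ofReal (‖(N + (τ : ℂ) • 1).det‖ ^ 2))) := by
    have ht := continuous_tangentProj hc₁ hc₂
    have hc : Continuous fun t => ENNReal.ofReal (‖(tangentProj (P₁ t) (P₂ t) * Q *
        tangentProj (P₁ t) (P₂ t) + (τ : ℂ) • 1).det‖ ^ 2 / (τ ^ (m ^ 2 + 1)) ^ 2) :=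
      ENNReal.continuous_ofReal.comp (((((ht.matrix_mul continuous_const).matrix_mul ht).add
        continuous_const).matrix_det.norm.pow 2).div_const _)
    have h3 := (hc.tendsto 0).mono_left (nhdsWithin_le_nhds (s := Set.Ioi 0))
    simp only [hz₁, hz₂] at h3
    rwa [det_tangentProj_single Q hτ] at h3
  refine hval.congr' ?_
  filter_upwards [hev1, hev2] with t h3 h4
  unfold productWeight
  exact (if_pos ⟨h3, h4⟩).symm

end LocalLimit

/-! ### Averaging over product states in an affine chart -/

theorem lintegral_volume_smul {ι : Type*} [Fintype ι] {c : ℂ} (hc : c ≠ 0)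
    (F : (ι → ℂ) → ENNReal) (hF : Measurable F) :
    ∫⁻ w, F w = ENNReal.ofReal (‖c‖ ^ (2 * Fintype.card ι)) * ∫⁻ h, F (c • h) := by
  classical
  set M : Matrix ι ι ℂ := c • 1 with hM
  have hd : M.det = c ^ Fintype.card ι := by rw [hM, Matrix.det_smul, Matrix.det_one, mul_one]
  have hd0 : M.det ≠ 0 := by rw [hd]; exact pow_ne_zero _ hc
  have hMv : ∀ h, M *ᵥ h = c • h := fun h => by rw [hM, Matrix.smul_mulVec, Matrix.one_mulVec]
  have hm : Measurable (M *ᵥ · : (ι → ℂ) → ι → ℂ) := Continuous.measurable (by fun_prop)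
  have hmap : (volume : Measure (ι → ℂ)).map (M *ᵥ ·) =
      ENNReal.ofReal ((‖M.det‖ ^ 2)⁻¹) • volume := by
    ext s hs
    rw [Measure.map_apply hm hs, volume_preimage_mulVec hd0, Measure.smul_apply, smul_eq_mul]
  simp only [← hMv]
  rw [← lintegral_map hF hm, hmap, lintegral_smul_measure, smul_eq_mul, ← mul_assoc,
    ← ENNReal.ofReal_mul (by positivity), hd, norm_pow, ← pow_mul, mul_comm 2, mul_inv_cancel₀
    (pow_ne_zero _ (norm_ne_zero_iff.2 hc)), ENNReal.ofReal_one, one_mul]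

section Chart

variable {m : ℕ}

/-- The density of a Gaussian line in the affine chart. -/
def chartDensity (h : Fin m → ℂ) : ℝ :=
  (m.factorial / Real.pi ^ m) * ((1 + sqNorm h) ^ (m + 1))⁻¹

theorem chartDensity_nonneg (h : Fin m → ℂ) : 0 ≤ chartDensity h := by
  unfold chartDensity
  have := sqNorm_nonneg h
  positivity

theorem continuous_chartDensity : Continuous (chartDensity : (Fin m → ℂ) → ℝ) := by
  unfold chartDensity
  refine continuous_const.mul (Continuous.inv₀ (by fun_prop) fun h => ?_)
  have := sqNorm_nonneg h
  positivity

theorem continuous_cons_one : Continuous fun h : Fin m → ℂ => (Fin.cons 1 h : Fin (m + 1) → ℂ) :=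
  continuous_pi fun i => by
    refine Fin.cases ?_ (fun i => ?_) i
    · exact continuous_const
    · exact continuous_apply i

/-- A vector z = s(1, h) spans the same line as (1, h). The substitution has Jacobian |s|^(2m), and
integrating |s|^(2m) exp(-(1+‖h‖²)|s|²) over s gives π m!/(1+‖h‖²)^(m+1), hence the Fubini–Study
density. -/
theorem lintegral_stateProj (F : Matrix (Fin (m + 1)) (Fin (m + 1)) ℂ → ENNReal)
    (hF : Measurable F) :
    ∫⁻ g, F (stateProj g) ∂gaussPi (Fin (m + 1)) =
      ∫⁻ h : Fin m → ℂ, ENNReal.ofReal (chartDensity h) * F (stateProj (Fin.cons 1 h)) := by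
  set G : (Fin (m + 1) → ℂ) → ENNReal := fun z =>
    ENNReal.ofReal ((Real.pi⁻¹) ^ (m + 1) * Real.exp (-sqNorm z)) * F (stateProj z) with hG
  have hGm : Measurable G := by
    have := hF.comp measurable_stateProj
    exact Measurable.mul (by fun_prop) this
  rw [lintegral_gaussPi (fun z => F (stateProj z)) (hF.comp measurable_stateProj), Fintype.card_fin]
  have hmp := (volume_preserving_piFinSuccAbove (fun _ : Fin (m + 1) => ℂ) 0).symm
  have h1 := hmp.lintegral_comp hGm
  have hcons : ∀ p : ℂ × (Fin m → ℂ),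
      (MeasurableEquiv.piFinSuccAbove (fun _ : Fin (m + 1) => ℂ) 0).symm p = Fin.cons p.1 p.2 := by
    intro p
    simp [MeasurableEquiv.piFinSuccAbove_symm_apply, Fin.insertNthEquiv]
  have hmc : Measurable fun p : ℂ × (Fin m → ℂ) => (Fin.cons p.1 p.2 : Fin (m + 1) → ℂ) := by
    have := hmp.measurable
    simpa only [funext hcons] using this
  simp only [hcons] at h1
  change ∫⁻ z, G z = _
  rw [← h1, Measure.volume_eq_prod, lintegral_prod (fun p : ℂ × (Fin m → ℂ) => G (Fin.cons p.1 p.2)) (hGm.comp hmc).aemeasurable]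
  have h2 : ∀ s : ℂ, s ≠ 0 → ∫⁻ w : Fin m → ℂ, G (Fin.cons s w) =
      ∫⁻ h : Fin m → ℂ, ENNReal.ofReal ((Real.pi⁻¹) ^ (m + 1) *
        (‖s‖ ^ (2 * m) * Real.exp (-(1 + sqNorm h) * ‖s‖ ^ 2))) * F (stateProj (Fin.cons 1 h)) := by
    intro s hs
    rw [lintegral_volume_smul hs (fun w => G (Fin.cons s w)) (hGm.comp (hmc.comp measurable_prodMk_left)),
      ← lintegral_const_mul' _ _ ENNReal.ofReal_ne_top]
    refine lintegral_congr fun h => ?_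
    have h3 : (Fin.cons s (s • h) : Fin (m + 1) → ℂ) = s • Fin.cons 1 h := by
      funext i
      refine Fin.cases ?_ (fun i => ?_) i <;> simp
    have h4 : sqNorm (s • (Fin.cons 1 h : Fin (m + 1) → ℂ)) = ‖s‖ ^ 2 * (1 + sqNorm h) := by
      rw [← h3, sqNorm_cons]
      simp [sqNorm, Finset.mul_sum, mul_pow, mul_add]
    simp only [hG]
    rw [h3, stateProj_smul hs, h4, ← mul_assoc, ← ENNReal.ofReal_mul (by positivity),
      Fintype.card_fin]
    congr 2
    rw [neg_mul, mul_comm (1 + sqNorm h)]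
    ring
  have h5 : ∫⁻ s : ℂ, ∫⁻ w : Fin m → ℂ, G (Fin.cons s w) =
      ∫⁻ s : ℂ, ∫⁻ h : Fin m → ℂ, ENNReal.ofReal ((Real.pi⁻¹) ^ (m + 1) *
        (‖s‖ ^ (2 * m) * Real.exp (-(1 + sqNorm h) * ‖s‖ ^ 2))) * F (stateProj (Fin.cons 1 h)) := by
    refine lintegral_congr_ae ?_
    have h6 : ∀ᵐ s : ℂ, s ≠ 0 := by
      rw [ae_iff]
      simp
    filter_upwards [h6] with s hs using h2 s hs
  have hFm : Measurable fun h : Fin m → ℂ => F (stateProj (Fin.cons 1 h)) :=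
    hF.comp (measurable_stateProj.comp continuous_cons_one.measurable)
  rw [h5, lintegral_lintegral_swap]
  · refine lintegral_congr fun h => ?_
    have hb : 0 < 1 + sqNorm h := by
      have := sqNorm_nonneg h
      positivity
    rw [lintegral_mul_const _ (by fun_prop), ← ofReal_integral_eq_lintegral_ofReal
      ((integrable_norm_pow_mul_exp m hb).const_mul _) (ae_of_all _ fun s => by positivity),
      integral_const_mul, integral_norm_pow_mul_exp m hb]
    congr 2
    rw [chartDensity, inv_pow]
    field_simp
    ring
  · refine Measurable.aemeasurable (Measurable.mul ?_ (hFm.comp measurable_snd))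
    fun_prop

theorem lintegral_sum_volume {α β : Type*} [Fintype α] [Fintype β]
    (F : (α → ℂ) → (β → ℂ) → ENNReal) (hF : Measurable (Function.uncurry F)) :
    ∫⁻ x, ∫⁻ y, F x y = ∫⁻ k : α ⊕ β → ℂ, F (fun a => k (Sum.inl a)) fun b => k (Sum.inr b) := by
  have hmp := volume_measurePreserving_sumPiEquivProdPi fun _ : α ⊕ β => ℂ
  have h := hmp.lintegral_comp hF
  rw [Measure.volume_eq_prod, lintegral_prod _ hF.aemeasurable] at h
  exact h.symm

/-- The average of the weight over Gaussian product states. -/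
def averagedWeight (τ s e : ℝ) (Q : Matrix (Fin (m + 1) × Fin (m + 1)) (Fin (m + 1) × Fin (m + 1)) ℂ) :
    ENNReal :=
  ∫⁻ g₁, ∫⁻ g₂, productWeight (m ^ 2 + 1) τ s e Q (stateProj g₁) (stateProj g₂)
    ∂gaussPi (Fin (m + 1)) ∂gaussPi (Fin (m + 1))

/-- The weight in the affine chart. -/
@[irreducible]
def chartWeight (τ s e : ℝ) (Q : Matrix (Fin (m + 1) × Fin (m + 1)) (Fin (m + 1) × Fin (m + 1)) ℂ)
    (x y : Fin m → ℂ) : ENNReal :=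
  ENNReal.ofReal (chartDensity x * chartDensity y) *
    productWeight (m ^ 2 + 1) τ s e Q (stateProj (Fin.cons 1 x : Fin (m + 1) → ℂ))
      (stateProj (Fin.cons 1 y : Fin (m + 1) → ℂ))

theorem measurable_productWeight_right (τ s e : ℝ)
    (Q : Matrix (Fin (m + 1) × Fin (m + 1)) (Fin (m + 1) × Fin (m + 1)) ℂ) :
    Measurable fun x : Matrix (Fin (m + 1)) (Fin (m + 1)) ℂ ×
      Matrix (Fin (m + 1)) (Fin (m + 1)) ℂ => productWeight (m ^ 2 + 1) τ s e Q x.1 x.2 :=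
  (measurable_productWeight (J := Fin (m + 1)) (m ^ 2 + 1) τ s e).comp measurable_prodMk_left

theorem measurable_stateProj_cons_one :
    Measurable fun h : Fin m → ℂ => stateProj (Fin.cons 1 h : Fin (m + 1) → ℂ) :=
  measurable_stateProj.comp continuous_cons_one.measurable

theorem measurable_chartWeight (τ s e : ℝ)
    (Q : Matrix (Fin (m + 1) × Fin (m + 1)) (Fin (m + 1) × Fin (m + 1)) ℂ) :
    Measurable (Function.uncurry (chartWeight τ s e Q)) := by
  have hcd : Measurable (chartDensity : (Fin m → ℂ) → ℝ) := continuous_chartDensity.measurable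
  have h1 : Measurable fun x : (Fin m → ℂ) × (Fin m → ℂ) =>
      ENNReal.ofReal (chartDensity x.1 * chartDensity x.2) :=
    ((hcd.comp measurable_fst).mul (hcd.comp measurable_snd)).ennreal_ofReal
  have h2 : Measurable fun x : (Fin m → ℂ) × (Fin m → ℂ) =>
      (stateProj (Fin.cons 1 x.1 : Fin (m + 1) → ℂ),
        stateProj (Fin.cons 1 x.2 : Fin (m + 1) → ℂ)) :=
    (measurable_stateProj_cons_one.comp measurable_fst).prodMk
      (measurable_stateProj_cons_one.comp measurable_snd)
  unfold chartWeight
  exact h1.mul ((measurable_productWeight_right τ s e Q).comp h2)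

theorem averagedWeight_eq_lintegral_lintegral (τ s e : ℝ)
    (Q : Matrix (Fin (m + 1) × Fin (m + 1)) (Fin (m + 1) × Fin (m + 1)) ℂ) :
    averagedWeight τ s e Q = ∫⁻ x : Fin m → ℂ, ∫⁻ y : Fin m → ℂ, chartWeight τ s e Q x y := by
  have hm2 := measurable_productWeight_right τ s e Q
  have h1 : ∀ P, ∫⁻ g₂, productWeight (m ^ 2 + 1) τ s e Q P (stateProj g₂)
      ∂gaussPi (Fin (m + 1)) = ∫⁻ h : Fin m → ℂ, ENNReal.ofReal (chartDensity h) *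
        productWeight (m ^ 2 + 1) τ s e Q P (stateProj (Fin.cons 1 h)) := fun P =>
    lintegral_stateProj _ (hm2.comp measurable_prodMk_left)
  have h3 : Measurable fun P => ∫⁻ g₂, productWeight (m ^ 2 + 1) τ s e Q P (stateProj g₂)
      ∂gaussPi (Fin (m + 1)) := by
    refine Measurable.lintegral_prod_right' (f := fun x : Matrix (Fin (m + 1)) (Fin (m + 1)) ℂ ×
      (Fin (m + 1) → ℂ) => productWeight (m ^ 2 + 1) τ s e Q x.1 (stateProj x.2)) ?_
    exact hm2.comp (measurable_fst.prodMk (measurable_stateProj.comp measurable_snd))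
  unfold averagedWeight
  rw [lintegral_stateProj (m := m) _ h3]
  refine lintegral_congr fun x => ?_
  rw [h1, ← lintegral_const_mul' _ _ ENNReal.ofReal_ne_top]
  refine lintegral_congr fun y => ?_
  rw [chartWeight, ENNReal.ofReal_mul (chartDensity_nonneg _), mul_assoc]

/-- The two charts have 4m real dimensions together, so dilation by t contributes t^(4m). Dividing
by this factor later isolates the behaviour at scale t around the base state. -/
theorem averagedWeight_eq_chart (τ s e : ℝ)
    (Q : Matrix (Fin (m + 1) × Fin (m + 1)) (Fin (m + 1) × Fin (m + 1)) ℂ) {t : ℝ} (ht : 0 < t) :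
    averagedWeight τ s e Q = ENNReal.ofReal (t ^ (4 * m)) *
      ∫⁻ k : Fin m ⊕ Fin m → ℂ, chartWeight τ s e Q (t • fun i => k (Sum.inl i))
        (t • fun j => k (Sum.inr j)) := by
  have hJ := measurable_chartWeight τ s e Q
  have h1 : Measurable fun k : Fin m ⊕ Fin m → ℂ =>
      chartWeight τ s e Q (fun i => k (Sum.inl i)) fun j => k (Sum.inr j) := by
    have h2 : Measurable fun k : Fin m ⊕ Fin m → ℂ =>
        ((fun i => k (Sum.inl i) : Fin m → ℂ), (fun j => k (Sum.inr j) : Fin m → ℂ)) := by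
      fun_prop
    exact hJ.comp h2
  have e1 : ‖(t : ℂ)‖ ^ (2 * Fintype.card (Fin m ⊕ Fin m)) = t ^ (4 * m) := by
    rw [Complex.norm_real, Real.norm_of_nonneg ht.le, Fintype.card_sum, Fintype.card_fin]
    congr 1
    ring
  rw [averagedWeight_eq_lintegral_lintegral, lintegral_sum_volume _ hJ,
    lintegral_volume_smul (c := (t : ℂ)) (by exact_mod_cast ht.ne') _ h1, e1]
  rfl

/-- The lower bound for the averaged weight when the base point is a minimiser. -/
theorem le_liminf_averagedWeight_of_base
    {Q : Matrix (Fin (m + 1) × Fin (m + 1)) (Fin (m + 1) × Fin (m + 1)) ℂ} {l : ℝ}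
    (hQ : Qᴴ = Q) (hQp : Q.PosSemidef) (hl : Q (0, 0) (0, 0) = l) (hl0 : 0 ≤ l)
    (hmin : ∀ x y : Fin (m + 1) → ℂ,
      l * (sqNorm x * sqNorm y) ≤ (star (prodVec x y) ⬝ᵥ Q *ᵥ prodVec x y).re)
    {τ e : ℝ} (hτ : 0 < τ) (hle : l < e) {t : ℕ → ℝ} (ht : ∀ j, 0 < t j)
    (ht0 : Tendsto t atTop (𝓝 0)) :
    ENNReal.ofReal ((m.factorial : ℝ) ^ 2 / (2 * m).factorial) ≤
      liminf (fun j => (ENNReal.ofReal (t j ^ (4 * m)))⁻¹ *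
        averagedWeight τ (t j ^ 2) e Q) atTop := by
  set N := Q.submatrix (tangentIdx m) (tangentIdx m) with hN
  obtain ⟨-, h2⟩ := second_order_of_minimal hQ hl hmin
  have hNp : N.PosSemidef := hQp.submatrix _
  have hNτ := posDef_add_smul_one hNp hτ
  set S : Set (Fin m ⊕ Fin m → ℂ) :=
    {k | sqNorm ((N + (τ : ℂ) • 1) *ᵥ k + mixedBlock Q *ᵥ star k) < 1} with hS
  have hvol := le_det_sq_mul_volume_conjLinear hNτ (transpose_mixedBlock Q) (fun k hk => by
    have h3 := norm_mixedBlock_quadratic_le h2 k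
    have h4 : 0 < sqNorm k := by
      refine lt_of_le_of_ne (sqNorm_nonneg k) fun h => hk ?_
      have := sqNorm_eq_dotProduct k
      rw [← h, Complex.ofReal_zero] at this
      exact dotProduct_star_self_eq_zero.1 this.symm
    rw [Matrix.add_mulVec, dotProduct_add, Complex.add_re, Matrix.smul_mulVec, Matrix.one_mulVec,
      dotProduct_smul, ← sqNorm_eq_dotProduct, smul_eq_mul, Complex.re_ofReal_mul,
      Complex.ofReal_re]
    nlinarith [mul_pos hτ h4, mul_nonneg hl0 h4.le])
  let F : ℕ → (Fin m ⊕ Fin m → ℂ) → ENNReal := fun j k =>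
    chartWeight τ (t j ^ 2) e Q (t j • fun i => k (Sum.inl i)) (t j • fun i => k (Sum.inr i))
  have hFe : ∀ j, (ENNReal.ofReal (t j ^ (4 * m)))⁻¹ * averagedWeight τ (t j ^ 2) e Q =
      ∫⁻ k, F j k := by
    intro j
    have hp : 0 < t j ^ (4 * m) := pow_pos (ht j) _
    rw [averagedWeight_eq_chart τ (t j ^ 2) e Q (ht j), ← mul_assoc, ENNReal.inv_mul_cancel
      (by simpa using hp) ENNReal.ofReal_ne_top, one_mul]
  simp only [hFe]
  have hFm : ∀ j, Measurable (F j) := by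
    intro j
    have h2 : Measurable fun k : Fin m ⊕ Fin m → ℂ =>
        ((t j • fun i => k (Sum.inl i) : Fin m → ℂ), (t j • fun i => k (Sum.inr i) : Fin m → ℂ)) := by
      fun_prop
    exact (measurable_chartWeight τ (t j ^ 2) e Q).comp h2
  -- Fatou's lemma: only the pointwise limit on the set S of small linearised gradient is needed.
  refine le_trans ?_ (lintegral_liminf_le hFm)
  have ht1 : Tendsto t atTop (𝓝[>] 0) :=
    tendsto_nhdsWithin_iff.2 ⟨ht0, Eventually.of_forall ht⟩
  set c : ℝ := (m.factorial / Real.pi ^ m) ^ 2 with hc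
  have hlim : ∀ k ∈ S, liminf (fun j => F j k) atTop =
      ENNReal.ofReal c * ENNReal.ofReal (‖(N + (τ : ℂ) • 1).det‖ ^ 2) := by
    intro k hk
    refine Tendsto.liminf_eq ?_
    have h3 := (tendsto_productWeight hQ hl hl0 hmin hτ hle hk).comp ht1
    have h4 : Tendsto (fun j => ENNReal.ofReal (chartDensity (t j • fun i => k (Sum.inl i)) *
          chartDensity (t j • fun i => k (Sum.inr i)))) atTop (𝓝 (ENNReal.ofReal c)) := by
      have h5 : Continuous fun t : ℝ => ENNReal.ofReal (chartDensity (t • fun i => k (Sum.inl i)) *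
          chartDensity (t • fun i => k (Sum.inr i))) :=
        ENNReal.continuous_ofReal.comp ((continuous_chartDensity.comp (by fun_prop)).mul
          (continuous_chartDensity.comp (by fun_prop)))
      have h6 := (h5.tendsto 0).comp ht0
      have h7 : chartDensity (0 : Fin m → ℂ) = m.factorial / Real.pi ^ m := by
        simp [chartDensity, sqNorm]
      simp only [zero_smul, h7, ← sq] at h6
      exact h6
    simp only [F, chartWeight]
    exact ENNReal.Tendsto.mul h4 (Or.inr ENNReal.ofReal_ne_top) h3 (Or.inr ENNReal.ofReal_ne_top)
  have hSm : MeasurableSet S := by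
    refine (isOpen_lt (continuous_sqNorm.comp ?_) continuous_const).measurableSet
    fun_prop
  have h8 : ∫⁻ k in S, liminf (fun j => F j k) atTop ≤ ∫⁻ k, liminf (fun j => F j k) atTop :=
    setLIntegral_le_lintegral _ _
  refine le_trans ?_ h8
  rw [setLIntegral_congr_fun hSm hlim, setLIntegral_const, mul_assoc]
  have hdn : ‖(N + (τ : ℂ) • 1).det‖ = (N + (τ : ℂ) • 1).det.re := by
    rw [hNτ.posSemidef.det_eq_re, Complex.norm_real, Real.norm_of_nonneg hNτ.det_re_pos.le]
    rfl
  rw [hdn]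
  -- The chart densities at the origin give (m!/π^m)² and the unit ball of ℂ^(2m) gives
  -- π^(2m)/(2m)!; the determinants have cancelled.
  refine le_trans (le_of_eq ?_) (mul_le_mul_right hvol _)
  rw [← ENNReal.ofReal_mul (by positivity), hc, Fintype.card_sum, Fintype.card_fin, ← two_mul]
  congr 1
  have := Real.pi_pos
  field_simp
  ring

end Chart

/-! ### Projections of equal rank are unitarily conjugate -/

section Projections

variable {I : Type*} [Fintype I] [DecidableEq I]

theorem eigenvalues_eq_zero_or_one {Q : Matrix I I ℂ} (hQ : Q.IsHermitian) (hQ2 : Q * Q = Q)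
    (i : I) : hQ.eigenvalues i = 0 ∨ hQ.eigenvalues i = 1 := by
  have h1 := hQ.mulVec_eigenvectorBasis i
  have h2 : (hQ.eigenvalues i * hQ.eigenvalues i) • (hQ.eigenvectorBasis i).ofLp =
      hQ.eigenvalues i • (hQ.eigenvectorBasis i).ofLp := by
    rw [mul_smul, ← h1, ← Matrix.mulVec_smul, ← h1, Matrix.mulVec_mulVec, hQ2]
  have h3 : (hQ.eigenvectorBasis i).ofLp ≠ 0 := fun h =>
    hQ.eigenvectorBasis.orthonormal.ne_zero i (by ext j; exact congrFun h j)
  have h4 := smul_left_injective ℝ h3 h2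
  rcases eq_or_ne (hQ.eigenvalues i) 0 with h | h
  · exact Or.inl h
  · exact Or.inr (mul_left_cancel₀ h (h4.trans (mul_one _).symm))

theorem trace_eq_rank_of_projection {Q : Matrix I I ℂ} (hQ : Q.IsHermitian) (hQ2 : Q * Q = Q) :
    Q.trace = Q.rank := by
  rw [hQ.trace_eq_sum_eigenvalues, hQ.rank_eq_card_non_zero_eigs, Fintype.card_subtype,
    Finset.card_filter]
  push_cast
  refine Finset.sum_congr rfl fun i _ => ?_
  rcases eigenvalues_eq_zero_or_one hQ hQ2 i with h | h <;> simp [h]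

theorem rank_one_sub_of_projection {Q : Matrix I I ℂ} (hQ : Q.IsHermitian) (hQ2 : Q * Q = Q) :
    (1 - Q).rank + Q.rank = Fintype.card I := by
  have h1 : (1 - Q).IsHermitian := Matrix.isHermitian_one.sub hQ
  have h2 : (1 - Q) * (1 - Q) = 1 - Q := by
    rw [Matrix.mul_sub, Matrix.sub_mul, Matrix.sub_mul, hQ2]
    simp
  have h3 := trace_eq_rank_of_projection h1 h2
  rw [Matrix.trace_sub, Matrix.trace_one, trace_eq_rank_of_projection hQ hQ2] at h3
  have h4 : ((Fintype.card I : ℕ) : ℂ) = (1 - Q).rank + Q.rank := by rw [← h3]; ring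
  exact_mod_cast h4.symm

/-- For projections the rank determines the characteristic polynomial. Equal polynomials give
identical eigenvalue functions, so two spectral decompositions can share one diagonal matrix. -/
theorem charpoly_of_projection {Q : Matrix I I ℂ} (hQ : Q.IsHermitian) (hQ2 : Q * Q = Q) :
    Q.charpoly = (Polynomial.X - 1) ^ Q.rank * Polynomial.X ^ (Fintype.card I - Q.rank) := by
  have h1 : ∀ i, (Polynomial.X - Polynomial.C ((hQ.eigenvalues i : ℝ) : ℂ)) =
      if hQ.eigenvalues i ≠ 0 then Polynomial.X - 1 else Polynomial.X := by
    intro i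
    rcases eigenvalues_eq_zero_or_one hQ hQ2 i with h | h <;> simp [h]
  have h2 := Finset.card_filter_add_card_filter_not (s := (Finset.univ : Finset I))
    fun i => hQ.eigenvalues i ≠ 0
  have h3 : Q.rank = (Finset.univ.filter fun i => hQ.eigenvalues i ≠ 0).card := by
    rw [hQ.rank_eq_card_non_zero_eigs, Fintype.card_subtype]
  rw [hQ.charpoly_eq]
  simp only [Complex.coe_algebraMap, h1]
  rw [Finset.prod_ite, Finset.prod_const, Finset.prod_const, ← h3]
  congr 2
  rw [← Finset.card_univ, ← h2, h3]
  omega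

theorem exists_unitary_conj_of_rank_eq {P Q : Matrix I I ℂ} (hP : P.IsHermitian) (hP2 : P * P = P)
    (hQ : Q.IsHermitian) (hQ2 : Q * Q = Q) (h : P.rank = Q.rank) :
    ∃ W : Matrix.unitaryGroup I ℂ, Q = (W : Matrix I I ℂ) * P * (W : Matrix I I ℂ)ᴴ := by
  have h1 : hP.eigenvalues = hQ.eigenvalues := by
    rw [Matrix.IsHermitian.eigenvalues_eq_eigenvalues_iff, charpoly_of_projection hP hP2,
      charpoly_of_projection hQ hQ2, h]
  have hsP := hP.spectral_theorem
  have hsQ := hQ.spectral_theorem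
  rw [Unitary.conjStarAlgAut_apply] at hsP hsQ
  refine ⟨hQ.eigenvectorUnitary * star hP.eigenvectorUnitary, ?_⟩
  set U := hP.eigenvectorUnitary
  set V := hQ.eigenvectorUnitary
  have hU : star (U : Matrix I I ℂ) * (U : Matrix I I ℂ) = 1 := Unitary.coe_star_mul_self U
  rw [h1] at hsP
  conv_lhs => rw [hsQ]
  conv_rhs => rw [hsP]
  simp only [Submonoid.coe_mul, Unitary.coe_star, ← Matrix.star_eq_conjTranspose, star_mul,
    star_star]
  set D := Matrix.diagonal (RCLike.ofReal ∘ hQ.eigenvalues : I → ℂ)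
  calc (V : Matrix I I ℂ) * D * star (V : Matrix I I ℂ) =
        V * (star (U : Matrix I I ℂ) * U) * D * (star (U : Matrix I I ℂ) * U) *
          star (V : Matrix I I ℂ) := by
        rw [hU, Matrix.mul_one, Matrix.mul_one]
    _ = _ := by simp only [Matrix.mul_assoc]

end Projections

/-! ### Row projections have full rank and transform by conjugation -/

section RowProjections

variable {I κ : Type*} [Fintype I] [Fintype κ] [DecidableEq κ] {A : Matrix κ I ℂ}

theorem isHermitian_rowProj : (rowProj A).IsHermitian := by
  have h := (Matrix.posSemidef_self_mul_conjTranspose A).inv.1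
  rw [Matrix.IsHermitian, rowProj, Matrix.conjTranspose_mul, Matrix.conjTranspose_mul, h,
    Matrix.conjTranspose_conjTranspose, Matrix.mul_assoc]

theorem rowProj_mul_rowProj (hK : (A * Aᴴ).det ≠ 0) : rowProj A * rowProj A = rowProj A := by
  rw [rowProj]
  calc _ = Aᴴ * (A * Aᴴ)⁻¹ * ((A * Aᴴ) * (A * Aᴴ)⁻¹) * A := by simp only [Matrix.mul_assoc]
    _ = _ := by rw [Matrix.mul_nonsing_inv _ (isUnit_iff_ne_zero.2 hK), Matrix.mul_one]

theorem rank_rowProj (hK : (A * Aᴴ).det ≠ 0) : (rowProj A).rank = Fintype.card κ := by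
  have hu : IsUnit (A * Aᴴ).det := isUnit_iff_ne_zero.2 hK
  refine le_antisymm ?_ ?_
  · rw [rowProj]
    exact (Matrix.rank_mul_le_right _ _).trans (Matrix.rank_le_card_height A)
  · have h1 : A * rowProj A * Aᴴ = A * Aᴴ := by
      rw [rowProj]
      calc _ = (A * Aᴴ) * ((A * Aᴴ)⁻¹ * (A * Aᴴ)) := by simp only [Matrix.mul_assoc]
        _ = _ := by rw [Matrix.nonsing_inv_mul _ hu, Matrix.mul_one]
    have h2 : (A * Aᴴ).rank = Fintype.card κ :=
      Matrix.rank_of_isUnit _ ((Matrix.isUnit_iff_isUnit_det _).2 hu)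
    rw [← h2, ← h1]
    exact (Matrix.rank_mul_le_left _ _).trans (Matrix.rank_mul_le_right _ _)

theorem rowProj_mul_unitary [DecidableEq I] {U : Matrix I I ℂ} (hU : Uᴴ * U = 1) :
    rowProj (A * Uᴴ) = U * rowProj A * Uᴴ := by
  have h : A * Uᴴ * (A * Uᴴ)ᴴ = A * Aᴴ := by
    rw [Matrix.conjTranspose_mul, Matrix.conjTranspose_conjTranspose]
    calc _ = A * (Uᴴ * U) * Aᴴ := by simp only [Matrix.mul_assoc]
      _ = _ := by rw [hU, Matrix.mul_one]
  rw [rowProj, rowProj, h, Matrix.conjTranspose_mul, Matrix.conjTranspose_conjTranspose]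
  simp only [Matrix.mul_assoc]

end RowProjections

/-! ### Haar-random projections as Gaussian row projections -/

section Haar

variable {I : Type} [Fintype I] [DecidableEq I]

theorem measurable_unitary_coe :
    Measurable fun U : Matrix.unitaryGroup I ℂ => (U : Matrix I I ℂ) :=
  continuous_subtype_val.measurable

theorem lintegral_haarUnitary_mul_left (W : Matrix.unitaryGroup I ℂ) (F : Matrix I I ℂ → ENNReal) :
    ∫⁻ U, F ((W : Matrix I I ℂ) * (U : Matrix I I ℂ)) ∂haarUnitary I =
      ∫⁻ U, F (U : Matrix I I ℂ) ∂haarUnitary I :=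
  lintegral_mul_left_eq_self (μ := haarUnitary I)
    (fun U : Matrix.unitaryGroup I ℂ => F (U : Matrix I I ℂ)) W

/-- Integrating F(V*U) over both variables and using left invariance in either one yields both
sides. Right invariance then follows from left invariance. -/
theorem lintegral_haarUnitary_conjTranspose (F : Matrix I I ℂ → ENNReal) (hF : Measurable F) :
    ∫⁻ U, F (U : Matrix I I ℂ)ᴴ ∂haarUnitary I = ∫⁻ U, F (U : Matrix I I ℂ) ∂haarUnitary I := by
  have h1 : ∫⁻ U, F (U : Matrix I I ℂ) ∂haarUnitary I =
      ∫⁻ V, ∫⁻ U, F ((V : Matrix I I ℂ)ᴴ * (U : Matrix I I ℂ)) ∂haarUnitary I ∂haarUnitary I := by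
    have : ∀ V : Matrix.unitaryGroup I ℂ,
        ∫⁻ U, F ((V : Matrix I I ℂ)ᴴ * (U : Matrix I I ℂ)) ∂haarUnitary I =
          ∫⁻ U, F (U : Matrix I I ℂ) ∂haarUnitary I :=
      fun V => lintegral_haarUnitary_mul_left (star V) F
    simp only [this, lintegral_const, measure_univ, mul_one]
  have hm : Measurable (Function.uncurry fun V U : Matrix.unitaryGroup I ℂ =>
      F ((V : Matrix I I ℂ)ᴴ * (U : Matrix I I ℂ))) :=
    hF.comp ((measurable_unitary_coe.comp measurable_fst).matrix_conjTranspose.matrix_mul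
      (measurable_unitary_coe.comp measurable_snd))
  rw [h1, lintegral_lintegral_swap hm.aemeasurable]
  have h2 : ∀ U : Matrix.unitaryGroup I ℂ,
      ∫⁻ V, F ((V : Matrix I I ℂ)ᴴ * (U : Matrix I I ℂ)) ∂haarUnitary I =
        ∫⁻ V, F (V : Matrix I I ℂ)ᴴ ∂haarUnitary I := by
    intro U
    have h3 := lintegral_haarUnitary_mul_left (star U) fun M => F Mᴴ
    rw [← h3]
    refine lintegral_congr fun V => ?_
    rw [Matrix.conjTranspose_mul]
    congr 2
    exact (star_star (U : Matrix I I ℂ)).symm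
  simp only [h2, lintegral_const, measure_univ, mul_one]

theorem lintegral_haarUnitary_mul_right (W : Matrix.unitaryGroup I ℂ) (F : Matrix I I ℂ → ENNReal)
    (hF : Measurable F) :
    ∫⁻ U, F ((U : Matrix I I ℂ) * (W : Matrix I I ℂ)) ∂haarUnitary I =
      ∫⁻ U, F (U : Matrix I I ℂ) ∂haarUnitary I := by
  rw [← lintegral_haarUnitary_conjTranspose (fun M => F (M * (W : Matrix I I ℂ)))
    (hF.comp (by fun_prop)), ← lintegral_haarUnitary_conjTranspose F hF,
    ← lintegral_haarUnitary_mul_left (star W) fun M => F Mᴴ]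
  refine lintegral_congr fun U => ?_
  rw [Matrix.conjTranspose_mul]
  congr 2
  exact (star_star (W : Matrix I I ℂ)).symm

/-- The Gaussian law is invariant under right multiplication by a unitary, so conjugating its row
projection by an independent Haar unitary changes nothing. For almost every fixed A that projection
is conjugate to Q, and right invariance of Haar measure absorbs the conjugating unitary. -/
theorem lintegral_haarUnitary_eq_gaussPi {κ : Type} [Fintype κ] [DecidableEq κ]
    (hκ : Fintype.card κ ≤ Fintype.card I) {Q : Matrix I I ℂ} (hQ : Q.IsHermitian)
    (hQ2 : Q * Q = Q) (hr : Q.rank = Fintype.card κ) (F : Matrix I I ℂ → ENNReal)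
    (hF : Measurable F) :
    ∫⁻ U, F ((U : Matrix I I ℂ) * Q * (U : Matrix I I ℂ)ᴴ) ∂haarUnitary I =
      ∫⁻ A, F (rowProj (toMat A)) ∂gaussPi (κ × I) := by
  have hrow : Measurable fun A : Matrix κ I ℂ => rowProj A := by
    unfold rowProj
    fun_prop
  have h1 : ∀ U : Matrix.unitaryGroup I ℂ,
      ∫⁻ A, F ((U : Matrix I I ℂ) * rowProj (toMat A) * (U : Matrix I I ℂ)ᴴ) ∂gaussPi (κ × I) =
        ∫⁻ A, F (rowProj (toMat A)) ∂gaussPi (κ × I) := by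
    intro U
    have hU : (U : Matrix I I ℂ)ᴴ * U = 1 := Unitary.coe_star_mul_self U
    have h2 := lintegral_gaussPi_unitary_mul_mul (κ := κ) (V := 1) (U := (U : Matrix I I ℂ)ᴴ)
      (by simp) (by rwa [Matrix.conjTranspose_conjTranspose]) (fun A => F (rowProj A))
      (hF.comp hrow)
    simpa only [Matrix.one_mul, rowProj_mul_unitary hU] using h2
  have h3 : ∫⁻ U : Matrix.unitaryGroup I ℂ, ∫⁻ A, F ((U : Matrix I I ℂ) * rowProj (toMat A) *
      (U : Matrix I I ℂ)ᴴ) ∂gaussPi (κ × I) ∂haarUnitary I =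
        ∫⁻ A, F (rowProj (toMat A)) ∂gaussPi (κ × I) := by
    simp only [h1, lintegral_const, measure_univ, mul_one]
  rw [← h3, lintegral_lintegral_swap]
  · have h4 : ∀ᵐ A ∂gaussPi (κ × I), ∫⁻ U : Matrix.unitaryGroup I ℂ,
        F ((U : Matrix I I ℂ) * rowProj (toMat A) * (U : Matrix I I ℂ)ᴴ) ∂haarUnitary I =
          ∫⁻ U, F ((U : Matrix I I ℂ) * Q * (U : Matrix I I ℂ)ᴴ) ∂haarUnitary I := by
      obtain ⟨f⟩ := Function.Embedding.nonempty_of_card_le hκ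
      filter_upwards [ae_det_submatrix_ne_zero f f.injective] with A hA
      have hDu : IsUnit (Matrix.of fun i j => A (i, f j)) :=
        (Matrix.isUnit_iff_isUnit_det _).2 (isUnit_iff_ne_zero.2 hA)
      have hK : (toMat A * (toMat A)ᴴ).det ≠ 0 := by
        refine (Matrix.PosDef.mul_conjTranspose_self _ fun v w hvw => ?_).det_pos.ne'
        refine Matrix.vecMul_injective_of_isUnit hDu ?_
        funext j
        exact congrFun hvw (f j)
      obtain ⟨W, hW⟩ := exists_unitary_conj_of_rank_eq hQ hQ2 isHermitian_rowProj
        (rowProj_mul_rowProj hK) (hr.trans (rank_rowProj hK).symm)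
      rw [hW, ← lintegral_haarUnitary_mul_right W (fun M => F (M * Q * Mᴴ)) (hF.comp (by fun_prop))]
      refine lintegral_congr fun U => ?_
      rw [Matrix.conjTranspose_mul]
      simp only [Matrix.mul_assoc]
    rw [lintegral_congr_ae h4, lintegral_const, measure_univ, mul_one]
  · have h5 : Measurable fun x : Matrix.unitaryGroup I ℂ × (κ × I → ℂ) =>
        (x.1 : Matrix I I ℂ) := measurable_unitary_coe.comp measurable_fst
    have h6 : Measurable fun x : Matrix.unitaryGroup I ℂ × (κ × I → ℂ) => rowProj (toMat x.2) :=
      hrow.comp (measurable_toMat.comp measurable_snd)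
    exact (hF.comp ((h5.matrix_mul h6).matrix_mul h5.matrix_conjTranspose)).aemeasurable

end Haar

theorem sqNorm_smul {J : Type*} [Fintype J] (c : ℂ) (x : J → ℂ) :
    sqNorm (c • x) = ‖c‖ ^ 2 * sqNorm x := by
  simp [sqNorm, Finset.mul_sum, mul_pow]

theorem sqNorm_pos {J : Type*} [Fintype J] {x : J → ℂ} (hx : x ≠ 0) : 0 < sqNorm x := by
  obtain ⟨i, hi⟩ := Function.ne_iff.1 hx
  exact Finset.sum_pos' (fun _ _ => by positivity)
    ⟨i, Finset.mem_univ i, by have := norm_pos_iff.2 hi; positivity⟩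

theorem exists_smul_sqNorm_eq_one {J : Type*} [Fintype J] {x : J → ℂ} (hx : x ≠ 0) :
    ∃ c : ℂ, c ≠ 0 ∧ sqNorm (c • x) = 1 := by
  have h0 := sqNorm_pos hx
  refine ⟨((Real.sqrt (sqNorm x))⁻¹ : ℝ), ?_, ?_⟩
  · exact_mod_cast (inv_pos.2 (Real.sqrt_pos.2 h0)).ne'
  · rw [sqNorm_smul, Complex.norm_real, Real.norm_eq_abs, sq_abs, inv_pow, Real.sq_sqrt h0.le,
      inv_mul_cancel₀ h0.ne']

/-! ### Moving product states to the base state -/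

section Invariance

variable {m : ℕ}

theorem exists_unitary_mulVec_single {φ : Fin (m + 1) → ℂ} (hφ : sqNorm φ = 1) :
    ∃ u : Matrix (Fin (m + 1)) (Fin (m + 1)) ℂ, uᴴ * u = 1 ∧ u *ᵥ Pi.single 0 1 = φ := by
  have h1 : Orthonormal ℂ (({0} : Set (Fin (m + 1))).domRestrict
      fun _ => (WithLp.toLp 2 φ : EuclideanSpace ℂ (Fin (m + 1)))) := by
    refine ⟨fun i => ?_, fun i j hij => absurd (Subsingleton.elim i j) hij⟩
    change ‖(WithLp.toLp 2 φ : EuclideanSpace ℂ (Fin (m + 1)))‖ = 1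
    rw [EuclideanSpace.norm_eq]
    exact Real.sqrt_eq_one.2 hφ
  obtain ⟨b, hb⟩ := h1.exists_orthonormalBasis_extension_of_card_eq (by simp)
  refine ⟨Matrix.of fun i j => b j i, ?_, ?_⟩
  · ext i j
    have h2 := orthonormal_iff_ite.1 b.orthonormal i j
    rw [EuclideanSpace.inner_eq_star_dotProduct] at h2
    rw [Matrix.one_apply, ← h2, Matrix.mul_apply, dotProduct]
    exact Finset.sum_congr rfl fun k _ => mul_comm _ _
  · funext i
    rw [Matrix.mulVec_single_one]
    exact congrArg (fun v : EuclideanSpace ℂ (Fin (m + 1)) => v i) (hb 0 rfl)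

theorem exists_unitary_stateProj {g : Fin (m + 1) → ℂ} (hg : g ≠ 0) :
    ∃ u : Matrix (Fin (m + 1)) (Fin (m + 1)) ℂ, uᴴ * u = 1 ∧
      stateProj g = u * stateProj (Pi.single 0 1) * uᴴ := by
  obtain ⟨c, hc, h1⟩ := exists_smul_sqNorm_eq_one hg
  obtain ⟨u, hu, hug⟩ := exists_unitary_mulVec_single h1
  refine ⟨u, hu, ?_⟩
  rw [← stateProj_mulVec hu, hug, stateProj_smul hc]

theorem kronecker_mulVec_prodVec {J : Type*} [Fintype J] (u₁ u₂ : Matrix J J ℂ) (x y : J → ℂ) :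
    (u₁ ⊗ₖ u₂) *ᵥ prodVec x y = prodVec (u₁ *ᵥ x) (u₂ *ᵥ y) := by
  funext p
  simp only [Matrix.mulVec, dotProduct, prodVec, Matrix.kroneckerMap_apply, Fintype.sum_prod_type,
    Finset.sum_mul_sum]
  exact Finset.sum_congr rfl fun i _ => Finset.sum_congr rfl fun j _ => by ring

theorem kronecker_conjTranspose_mul_self {J : Type*} [Fintype J] [DecidableEq J]
    {u₁ u₂ : Matrix J J ℂ} (h₁ : u₁ᴴ * u₁ = 1) (h₂ : u₂ᴴ * u₂ = 1) :
    (u₁ ⊗ₖ u₂)ᴴ * (u₁ ⊗ₖ u₂) = 1 := by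
  rw [Matrix.conjTranspose_kronecker, ← Matrix.mul_kronecker_mul, h₁, h₂,
    Matrix.one_kronecker_one]

theorem measurable_lintegral_productWeight (τ s e : ℝ) :
    Measurable fun p : Matrix (Fin (m + 1) × Fin (m + 1)) (Fin (m + 1) × Fin (m + 1)) ℂ ×
      Matrix (Fin (m + 1)) (Fin (m + 1)) ℂ =>
        ∫⁻ g, productWeight (m ^ 2 + 1) τ s e p.1 p.2 (stateProj g) ∂gaussPi (Fin (m + 1)) := by
  refine Measurable.lintegral_prod_right' (f := fun x : (Matrix (Fin (m + 1) × Fin (m + 1))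
    (Fin (m + 1) × Fin (m + 1)) ℂ × Matrix (Fin (m + 1)) (Fin (m + 1)) ℂ) × (Fin (m + 1) → ℂ) =>
      productWeight (m ^ 2 + 1) τ s e x.1.1 x.1.2 (stateProj x.2)) ?_
  exact (measurable_productWeight (m ^ 2 + 1) τ s e).comp
    ((measurable_fst.comp measurable_fst).prodMk
    ((measurable_snd.comp measurable_fst).prodMk (measurable_stateProj.comp measurable_snd)))

theorem measurable_averagedWeight (τ s e : ℝ) :
    Measurable (averagedWeight τ s e : Matrix (Fin (m + 1) × Fin (m + 1))
      (Fin (m + 1) × Fin (m + 1)) ℂ → ENNReal) := by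
  unfold averagedWeight
  refine Measurable.lintegral_prod_right' (f := fun x : Matrix (Fin (m + 1) × Fin (m + 1))
    (Fin (m + 1) × Fin (m + 1)) ℂ × (Fin (m + 1) → ℂ) =>
      ∫⁻ g, productWeight (m ^ 2 + 1) τ s e x.1 (stateProj x.2) (stateProj g)
        ∂gaussPi (Fin (m + 1))) ?_
  exact (measurable_lintegral_productWeight τ s e).comp
    (measurable_fst.prodMk (measurable_stateProj.comp measurable_snd))

theorem averagedWeight_conj {u₁ u₂ : Matrix (Fin (m + 1)) (Fin (m + 1)) ℂ} (h₁ : u₁ᴴ * u₁ = 1)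
    (h₂ : u₂ᴴ * u₂ = 1) (τ s e : ℝ)
    (Q : Matrix (Fin (m + 1) × Fin (m + 1)) (Fin (m + 1) × Fin (m + 1)) ℂ) :
    averagedWeight τ s e ((u₁ ⊗ₖ u₂) * Q * (u₁ ⊗ₖ u₂)ᴴ) = averagedWeight τ s e Q := by
  set Q' := (u₁ ⊗ₖ u₂) * Q * (u₁ ⊗ₖ u₂)ᴴ with hQ'
  have hm : Measurable fun g₁ : Fin (m + 1) → ℂ =>
      ∫⁻ g₂, productWeight (m ^ 2 + 1) τ s e Q' (stateProj g₁) (stateProj g₂)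
        ∂gaussPi (Fin (m + 1)) :=
    (measurable_lintegral_productWeight τ s e).comp (measurable_const.prodMk measurable_stateProj)
  have hm2 : ∀ P, Measurable fun g₂ : Fin (m + 1) → ℂ =>
      productWeight (m ^ 2 + 1) τ s e Q' P (stateProj g₂) := fun P =>
    (measurable_productWeight (m ^ 2 + 1) τ s e).comp
      (measurable_const.prodMk (measurable_const.prodMk measurable_stateProj))
  unfold averagedWeight
  rw [← lintegral_gaussPi_unitary h₁ _ hm]
  refine lintegral_congr fun g₁ => ?_
  rw [← lintegral_gaussPi_unitary h₂ _ (hm2 _)]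
  refine lintegral_congr fun g₂ => ?_
  rw [stateProj_mulVec h₁, stateProj_mulVec h₂, hQ', productWeight_conj h₁ h₂]

/-- A local unitary carries the minimiser to the base state. The averaged weight and the minimality
condition are invariant under it. -/
theorem le_liminf_averagedWeight
    {Q : Matrix (Fin (m + 1) × Fin (m + 1)) (Fin (m + 1) × Fin (m + 1)) ℂ} {l : ℝ}
    (hQp : Q.PosSemidef) {φ ψ : Fin (m + 1) → ℂ} (hφ : sqNorm φ = 1) (hψ : sqNorm ψ = 1)
    (hl : (star (prodVec φ ψ) ⬝ᵥ Q *ᵥ prodVec φ ψ).re = l)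
    (hmin : ∀ x y : Fin (m + 1) → ℂ,
      l * (sqNorm x * sqNorm y) ≤ (star (prodVec x y) ⬝ᵥ Q *ᵥ prodVec x y).re)
    {τ e : ℝ} (hτ : 0 < τ) (hle : l < e) {t : ℕ → ℝ} (ht : ∀ j, 0 < t j)
    (ht0 : Tendsto t atTop (𝓝 0)) :
    ENNReal.ofReal ((m.factorial : ℝ) ^ 2 / (2 * m).factorial) ≤
      liminf (fun j => (ENNReal.ofReal (t j ^ (4 * m)))⁻¹ *
        averagedWeight τ (t j ^ 2) e Q) atTop := by
  obtain ⟨u₁, h₁, hu₁⟩ := exists_unitary_mulVec_single hφ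
  obtain ⟨u₂, h₂, hu₂⟩ := exists_unitary_mulVec_single hψ
  set u := u₁ ⊗ₖ u₂ with hu
  have huu : u * uᴴ = 1 := mul_eq_one_comm.1 (kronecker_conjTranspose_mul_self h₁ h₂)
  set Q' := uᴴ * Q * u with hQ'
  have hQQ' : u * Q' * uᴴ = Q := by
    calc u * Q' * uᴴ = (u * uᴴ) * Q * (u * uᴴ) := by rw [hQ']; simp only [Matrix.mul_assoc]
      _ = Q := by rw [huu, Matrix.one_mul, Matrix.mul_one]
  have hq : ∀ x y, star (prodVec x y) ⬝ᵥ Q' *ᵥ prodVec x y =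
      star (prodVec (u₁ *ᵥ x) (u₂ *ᵥ y)) ⬝ᵥ Q *ᵥ prodVec (u₁ *ᵥ x) (u₂ *ᵥ y) := by
    intro x y
    rw [← kronecker_mulVec_prodVec, ← hu, hQ', Matrix.star_mulVec, ← Matrix.dotProduct_mulVec,
      Matrix.mulVec_mulVec, Matrix.mulVec_mulVec, Matrix.mul_assoc]
  have hQp' : Q'.PosSemidef := hQp.conjTranspose_mul_mul_same u
  have h00 : Q' (0, 0) (0, 0) =
      star (prodVec (Pi.single 0 1) (Pi.single 0 1)) ⬝ᵥ Q' *ᵥ prodVec (Pi.single 0 1)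
        (Pi.single (0 : Fin (m + 1)) (1 : ℂ)) := by
    have : prodVec (Pi.single 0 1) (Pi.single 0 1) =
        Pi.single ((0, 0) : Fin (m + 1) × Fin (m + 1)) (1 : ℂ) := by
      funext ⟨i, j⟩
      simp only [prodVec, Pi.single_apply, Prod.mk.injEq]
      by_cases hi : i = 0 <;> by_cases hj : j = 0 <;> simp [hi, hj]
    rw [this, Matrix.mulVec_single_one, ← Pi.single_star, star_one, single_one_dotProduct]
    rfl
  have hl' : Q' (0, 0) (0, 0) = l := by
    have h3 : (Q' (0, 0) (0, 0)).re = l := by rw [h00, hq, hu₁, hu₂, hl]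
    rw [← h3]
    exact (hQp'.1.coe_re_apply_self (0, 0)).symm
  have hl0 : 0 ≤ l := by
    rw [← hl]
    exact (Complex.le_def.1 (hQp.dotProduct_mulVec_nonneg (prodVec φ ψ))).1
  have := le_liminf_averagedWeight_of_base hQp'.1 hQp' hl' hl0 (fun x y => ?_) hτ hle ht ht0
  · simpa only [← averagedWeight_conj h₁ h₂ τ _ e Q', ← hu, hQQ'] using this
  · rw [hq, ← sqNorm_unitary_mulVec h₁ x, ← sqNorm_unitary_mulVec h₂ y]
    exact hmin _ _

/-- After exchanging the integrals, each pair of nonzero vectors is moved to the base state by a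
local unitary, which left invariance of Haar measure absorbs. The inner integral is therefore the
same for almost every pair. -/
theorem lintegral_haarUnitary_averagedWeight
    {Q : Matrix (Fin (m + 1) × Fin (m + 1)) (Fin (m + 1) × Fin (m + 1)) ℂ} (hQ : Qᴴ = Q)
    {τ : ℝ} (hτ : 0 < τ) (s e : ℝ) :
    ∫⁻ U, averagedWeight τ s e ((U : Matrix _ _ ℂ) * Q * (U : Matrix _ _ ℂ)ᴴ)
        ∂haarUnitary (Fin (m + 1) × Fin (m + 1)) =
      ∫⁻ U, criticalWeight (0, 0) (tangentIdx m) τ s e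
        ((U : Matrix _ _ ℂ) * Q * (U : Matrix _ _ ℂ)ᴴ)
        ∂haarUnitary (Fin (m + 1) × Fin (m + 1)) := by
  set C := ∫⁻ U, criticalWeight (0, 0) (tangentIdx m) τ s e
    ((U : Matrix _ _ ℂ) * Q * (U : Matrix _ _ ℂ)ᴴ) ∂haarUnitary (Fin (m + 1) × Fin (m + 1)) with hC
  have hcm : Measurable fun U : Matrix.unitaryGroup (Fin (m + 1) × Fin (m + 1)) ℂ =>
      (U : Matrix _ _ ℂ) * Q * (U : Matrix _ _ ℂ)ᴴ :=
    (measurable_unitary_coe.matrix_mul measurable_const).matrix_mul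
      measurable_unitary_coe.matrix_conjTranspose
  have key : ∀ g₁ g₂ : Fin (m + 1) → ℂ, g₁ ≠ 0 → g₂ ≠ 0 →
      ∫⁻ U, productWeight (m ^ 2 + 1) τ s e ((U : Matrix _ _ ℂ) * Q * (U : Matrix _ _ ℂ)ᴴ)
        (stateProj g₁) (stateProj g₂) ∂haarUnitary (Fin (m + 1) × Fin (m + 1)) = C := by
    intro g₁ g₂ hg₁ hg₂
    obtain ⟨u₁, h₁, hu₁⟩ := exists_unitary_stateProj hg₁
    obtain ⟨u₂, h₂, hu₂⟩ := exists_unitary_stateProj hg₂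
    have huu := kronecker_conjTranspose_mul_self h₁ h₂
    let W : Matrix.unitaryGroup (Fin (m + 1) × Fin (m + 1)) ℂ :=
      ⟨u₁ ⊗ₖ u₂, Matrix.mem_unitaryGroup_iff'.2 huu⟩
    rw [← lintegral_haarUnitary_mul_left W fun M =>
      productWeight (m ^ 2 + 1) τ s e (M * Q * Mᴴ) (stateProj g₁) (stateProj g₂)]
    refine lintegral_congr fun U => ?_
    have h3 : (W : Matrix _ _ ℂ) * (U : Matrix _ _ ℂ) * Q * ((W : Matrix _ _ ℂ) *
        (U : Matrix _ _ ℂ))ᴴ = (u₁ ⊗ₖ u₂) * ((U : Matrix _ _ ℂ) * Q * (U : Matrix _ _ ℂ)ᴴ) *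
          (u₁ ⊗ₖ u₂)ᴴ := by
      rw [Matrix.conjTranspose_mul]
      simp only [Matrix.mul_assoc, W]
    rw [h3, hu₁, hu₂, productWeight_conj h₁ h₂, productWeight_single _ hτ]
    rw [Matrix.conjTranspose_mul, Matrix.conjTranspose_mul, hQ, Matrix.conjTranspose_conjTranspose,
      Matrix.mul_assoc]
  have hne : ∀ᵐ g ∂gaussPi (Fin (m + 1)), g ≠ 0 := by
    refine (gaussPi_absolutelyContinuous _).ae_le ?_
    exact Measure.ae_ne volume 0
  have hmeas := measurable_productWeight (J := Fin (m + 1)) (m ^ 2 + 1) τ s e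
  unfold averagedWeight
  rw [lintegral_lintegral_swap]
  · have h5 : ∀ᵐ g₁ ∂gaussPi (Fin (m + 1)),
        ∫⁻ U, ∫⁻ g₂, productWeight (m ^ 2 + 1) τ s e ((U : Matrix _ _ ℂ) * Q * (U : Matrix _ _ ℂ)ᴴ)
          (stateProj g₁) (stateProj g₂) ∂gaussPi (Fin (m + 1))
            ∂haarUnitary (Fin (m + 1) × Fin (m + 1)) = C := by
      filter_upwards [hne] with g₁ hg₁
      rw [lintegral_lintegral_swap]
      · have h6 : ∀ᵐ g₂ ∂gaussPi (Fin (m + 1)), ∫⁻ U, productWeight (m ^ 2 + 1) τ s e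
            ((U : Matrix _ _ ℂ) * Q * (U : Matrix _ _ ℂ)ᴴ) (stateProj g₁) (stateProj g₂)
              ∂haarUnitary (Fin (m + 1) × Fin (m + 1)) = C := by
          filter_upwards [hne] with g₂ hg₂ using key g₁ g₂ hg₁ hg₂
        rw [lintegral_congr_ae h6, lintegral_const, measure_univ, mul_one]
      · exact (hmeas.comp ((hcm.comp measurable_fst).prodMk (measurable_const.prodMk
          (measurable_stateProj.comp measurable_snd)))).aemeasurable
    rw [lintegral_congr_ae h5, lintegral_const, measure_univ, mul_one]
  · exact ((measurable_lintegral_productWeight τ s e).comp ((hcm.comp measurable_fst).prodMk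
      (measurable_stateProj.comp measurable_snd))).aemeasurable

end Invariance

/-! ### Splitting the product basis -/

section Reindexing

/-- The splitting of the product basis into the base point, the tangent directions and the rest. -/
def basisSplit (m : ℕ) :
    Unit ⊕ ((Fin m ⊕ Fin m) ⊕ (Fin m × Fin m)) ≃ Fin (m + 1) × Fin (m + 1) :=
  Equiv.ofBijective (Sum.elim (fun _ => (0, 0)) (Sum.elim (tangentIdx m) fun p => (p.1.succ, p.2.succ)))
    (by
      rw [Fintype.bijective_iff_injective_and_card]
      refine ⟨?_, by simp; ring⟩
      rintro (⟨⟩ | (a | a) | ⟨a, b⟩) (⟨⟩ | (c | c) | ⟨c, d⟩) h <;>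
        simp_all [tangentIdx, Fin.ext_iff])

theorem rowProj_submatrix {κ I I' : Type*} [Fintype κ] [DecidableEq κ] [Fintype I] [Fintype I']
    (A : Matrix κ I ℂ) (e : I' ≃ I) :
    (rowProj A).submatrix e e = rowProj (A.submatrix id e) := by
  have h : A.submatrix id e * (A.submatrix id e)ᴴ = A * Aᴴ := by
    rw [Matrix.conjTranspose_submatrix, Matrix.submatrix_mul_equiv, Matrix.submatrix_id_id]
  rw [rowProj, rowProj, h, Matrix.conjTranspose_submatrix]
  ext i j
  simp [Matrix.mul_apply]

theorem lintegral_haarUnitary_criticalWeight_le {m x : ℕ} (hx : x ≤ m * m)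
    {Q : Matrix (Fin (m + 1) × Fin (m + 1)) (Fin (m + 1) × Fin (m + 1)) ℂ} (hQ : Q.IsHermitian)
    (hQ2 : Q * Q = Q) (hr : Q.rank = 2 * m + x) {τ s e : ℝ} (hτ : 0 < τ) (hs : 0 < s)
    (he : 0 < e) (he1 : e < 1) :
    ∫⁻ U, criticalWeight (0, 0) (tangentIdx m) τ s e ((U : Matrix _ _ ℂ) * Q * (U : Matrix _ _ ℂ)ᴴ)
        ∂haarUnitary (Fin (m + 1) × Fin (m + 1)) ≤
      ENNReal.ofReal ((s / (1 - e) ^ 2) ^ (2 * m) / (2 * m).factorial *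
        ((e / (1 - e)) ^ x / x.factorial)) *
      ∫⁻ B, ENNReal.ofReal (regularisedWeight τ B)
        ∂gaussPi (((Fin m ⊕ Fin m) ⊕ Fin x) × ((Fin m ⊕ Fin m) ⊕ (Fin m × Fin m))) := by
  have hT : Fintype.card (Fin m ⊕ Fin m) = 2 * m := by simp; ring
  have h1 := lintegral_criticalWeight_le (T := Fin m ⊕ Fin m) (X := Fin x) (R := Fin m × Fin m)
    (by simpa using hx) hτ hs he he1
  rw [hT, Fintype.card_fin] at h1
  refine le_trans (le_of_eq ?_) h1
  have hκ : Fintype.card ((Fin m ⊕ Fin m) ⊕ Fin x) = 2 * m + x := by simp; ring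
  have hcm := measurable_criticalWeight (0, 0) (tangentIdx m) τ s e
  rw [lintegral_haarUnitary_eq_gaussPi (κ := (Fin m ⊕ Fin m) ⊕ Fin x) (by rw [hκ]; simp; nlinarith)
    hQ hQ2 (hr.trans hκ.symm) _ hcm]
  have hmp := measurePreserving_gaussPi_congr
    ((Equiv.refl ((Fin m ⊕ Fin m) ⊕ Fin x)).prodCongr (basisSplit m))
  have hrow : Measurable fun A : (((Fin m ⊕ Fin m) ⊕ Fin x) × (Fin (m + 1) × Fin (m + 1))) → ℂ =>
      rowProj (toMat A) := by
    have : Measurable fun A : Matrix ((Fin m ⊕ Fin m) ⊕ Fin x) (Fin (m + 1) × Fin (m + 1)) ℂ =>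
        rowProj A := by
      unfold rowProj
      fun_prop
    exact this.comp measurable_toMat
  refine (hmp.lintegral_comp (hcm.comp hrow)).symm.trans (lintegral_congr fun A => ?_)
  set A' : Matrix ((Fin m ⊕ Fin m) ⊕ Fin x) (Fin (m + 1) × Fin (m + 1)) ℂ :=
    toMat fun i => A (((Equiv.refl _).prodCongr (basisSplit m)).symm i) with hA'
  have h2 : toMat A = A'.submatrix id (basisSplit m) := by
    ext i j
    simp [hA']
  rw [h2, ← rowProj_submatrix]
  rfl

end Reindexing

/-! ### Maximal overlap as a minimum for the complement -/

section Overlap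

variable {J : Type*} [Fintype J]

theorem sqNorm_prodVec (x y : J → ℂ) : sqNorm (prodVec x y) = sqNorm x * sqNorm y := by
  simp only [sqNorm, prodVec, norm_mul, mul_pow, Fintype.sum_prod_type, Finset.sum_mul_sum]

theorem le_quadratic_of_forall_unit {Q : Matrix (J × J) (J × J) ℂ} {l : ℝ}
    (h : ∀ x y : J → ℂ, sqNorm x = 1 → sqNorm y = 1 →
      l ≤ (star (prodVec x y) ⬝ᵥ Q *ᵥ prodVec x y).re) (x y : J → ℂ) :
    l * (sqNorm x * sqNorm y) ≤ (star (prodVec x y) ⬝ᵥ Q *ᵥ prodVec x y).re := by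
  by_cases hxy : x = 0 ∨ y = 0
  · have h0 : prodVec x y = 0 := by
      funext p
      rcases hxy with rfl | rfl <;> simp [prodVec]
    rw [← sqNorm_prodVec, h0]
    simp [sqNorm]
  · push Not at hxy
    obtain ⟨c, hc, hcx⟩ := exists_smul_sqNorm_eq_one hxy.1
    obtain ⟨d, hd, hdy⟩ := exists_smul_sqNorm_eq_one hxy.2
    have h1 := h _ _ hcx hdy
    have h2 := trace_stateProj_kronecker_mul x y Q
    rw [← stateProj_smul hc x, ← stateProj_smul hd y, trace_stateProj_kronecker_mul, hcx, hdy,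
      mul_one,
      Complex.ofReal_one, inv_one, one_mul] at h2
    rw [h2, ← Complex.ofReal_inv, Complex.re_ofReal_mul, inv_mul_eq_div,
      le_div_iff₀ (mul_pos (sqNorm_pos hxy.1) (sqNorm_pos hxy.2))] at h1
    exact h1

theorem productOverlap_eq {J : Type} [Fintype J] (P : Matrix (J × J) (J × J) ℂ)
    (φ ψ : EuclideanSpace ℂ J) :
    productOverlap P φ ψ = (star (prodVec φ.ofLp ψ.ofLp) ⬝ᵥ P *ᵥ prodVec φ.ofLp ψ.ofLp).re := by
  have h : pureState φ ⊗ₖ pureState ψ =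
      Matrix.vecMulVec (prodVec φ.ofLp ψ.ofLp) (star (prodVec φ.ofLp ψ.ofLp)) := by
    ext ⟨i, j⟩ ⟨k, l⟩
    simp only [pureState, prodVec, Matrix.kroneckerMap_apply, Matrix.vecMulVec_apply,
      Pi.star_apply, star_mul']
    ring
  rw [productOverlap, h, Matrix.vecMulVec_mul, Matrix.trace_vecMulVec, dotProduct_comm,
    Matrix.dotProduct_mulVec]

theorem norm_eq_one_iff_sqNorm {J : Type*} [Fintype J] (φ : EuclideanSpace ℂ J) :
    ‖φ‖ = 1 ↔ sqNorm φ.ofLp = 1 := by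
  rw [EuclideanSpace.norm_eq, Real.sqrt_eq_one]
  rfl

theorem quadratic_one_sub {ι : Type*} [Fintype ι] [DecidableEq ι] (P : Matrix ι ι ℂ) (v : ι → ℂ) :
    (star v ⬝ᵥ (1 - P) *ᵥ v).re = sqNorm v - (star v ⬝ᵥ P *ᵥ v).re := by
  rw [Matrix.sub_mulVec, Matrix.one_mulVec, dotProduct_sub, ← sqNorm_eq_dotProduct, Complex.sub_re,
    Complex.ofReal_re]

/-- The maximiser of the overlap with P minimises the overlap with 1 - P, at value 1 minus the
maximum. This is at most ε, hence strictly below e. -/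
theorem le_liminf_averagedWeight_of_le_maxProductOverlap {m : ℕ}
    {P : Matrix (Fin (m + 1) × Fin (m + 1)) (Fin (m + 1) × Fin (m + 1)) ℂ}
    (hP : (1 - P).PosSemidef) {ε : ℝ} (hε : 1 - ε ≤ maxProductOverlap P)
    {τ e : ℝ} (hτ : 0 < τ) (hle : ε < e) {t : ℕ → ℝ} (ht : ∀ j, 0 < t j)
    (ht0 : Tendsto t atTop (𝓝 0)) :
    ENNReal.ofReal ((m.factorial : ℝ) ^ 2 / (2 * m).factorial) ≤
      liminf (fun j => (ENNReal.ofReal (t j ^ (4 * m)))⁻¹ *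
        averagedWeight τ (t j ^ 2) e (1 - P)) atTop := by
  obtain ⟨⟨φ, ψ, hφ, hψ, hmax⟩, hub⟩ := isGreatest_maxProductOverlap P
  rw [norm_eq_one_iff_sqNorm] at hφ hψ
  refine le_liminf_averagedWeight (l := 1 - maxProductOverlap P) hP hφ hψ ?_ ?_ hτ
    (by linarith) ht ht0
  · rw [quadratic_one_sub, sqNorm_prodVec, hφ, hψ, mul_one, ← productOverlap_eq, hmax]
  · refine le_quadratic_of_forall_unit fun x y hx hy => ?_
    rw [quadratic_one_sub, sqNorm_prodVec, hx, hy, mul_one]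
    have := hub ⟨WithLp.toLp 2 x, WithLp.toLp 2 y, (norm_eq_one_iff_sqNorm _).2 hx,
      (norm_eq_one_iff_sqNorm _).2 hy, rfl⟩
    rw [productOverlap_eq] at this
    linarith

end Overlap

/-! ### The tail bound -/

section TailBound

variable {m x : ℕ} {P : Matrix (Fin (m + 1) × Fin (m + 1)) (Fin (m + 1) × Fin (m + 1)) ℂ}

/-- On the event the rescaled averages have liminf at least m!²/(2m)!, so Markov's inequality
followed by Fatou's lemma bounds its probability by the liminf of their means. These are bounded
uniformly in the scale t. -/
theorem mul_measure_le_regularised (hx : x ≤ m * m) (hP : P.IsHermitian) (hP2 : P * P = P)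
    (hr : (1 - P).rank = 2 * m + x) {ε e τ : ℝ} (hε : 0 < ε) (hεe : ε < e) (he1 : e < 1)
    (hτ : 0 < τ) :
    ENNReal.ofReal ((m.factorial : ℝ) ^ 2 / (2 * m).factorial) *
      haarUnitary (Fin (m + 1) × Fin (m + 1)) {U | 1 - ε ≤
        maxProductOverlap ((U : Matrix _ _ ℂ) * P * (U : Matrix _ _ ℂ)ᴴ)} ≤
      ENNReal.ofReal ((1 / (1 - e) ^ 2) ^ (2 * m) / (2 * m).factorial *
        ((e / (1 - e)) ^ x / x.factorial)) *
      ∫⁻ B, ENNReal.ofReal (regularisedWeight τ B)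
        ∂gaussPi (((Fin m ⊕ Fin m) ⊕ Fin x) × ((Fin m ⊕ Fin m) ⊕ (Fin m × Fin m))) := by
  have hQ : (1 - P).IsHermitian := Matrix.isHermitian_one.sub hP
  have hQ2 : (1 - P) * (1 - P) = 1 - P := by
    rw [Matrix.mul_sub, Matrix.sub_mul, Matrix.sub_mul, hP2]
    simp
  set K := ENNReal.ofReal ((1 / (1 - e) ^ 2) ^ (2 * m) / (2 * m).factorial *
        ((e / (1 - e)) ^ x / x.factorial)) *
      ∫⁻ B, ENNReal.ofReal (regularisedWeight τ B)
        ∂gaussPi (((Fin m ⊕ Fin m) ⊕ Fin x) × ((Fin m ⊕ Fin m) ⊕ (Fin m × Fin m))) with hK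
  set t : ℕ → ℝ := fun j => 1 / ((j : ℝ) + 1) with htdef
  have ht : ∀ j, 0 < t j := fun j => Nat.one_div_pos_of_nat
  have ht0 : Tendsto t atTop (𝓝 0) := tendsto_one_div_add_atTop_nhds_zero_nat
  set f : ℕ → Matrix.unitaryGroup (Fin (m + 1) × Fin (m + 1)) ℂ → ENNReal := fun j U =>
    (ENNReal.ofReal (t j ^ (4 * m)))⁻¹ *
      averagedWeight τ (t j ^ 2) e ((U : Matrix _ _ ℂ) * (1 - P) * (U : Matrix _ _ ℂ)ᴴ) with hf
  have hcm : Measurable fun U : Matrix.unitaryGroup (Fin (m + 1) × Fin (m + 1)) ℂ =>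
      (U : Matrix _ _ ℂ) * (1 - P) * (U : Matrix _ _ ℂ)ᴴ :=
    (measurable_unitary_coe.matrix_mul measurable_const).matrix_mul
      measurable_unitary_coe.matrix_conjTranspose
  have ham : ∀ j, Measurable fun U : Matrix.unitaryGroup (Fin (m + 1) × Fin (m + 1)) ℂ =>
      averagedWeight τ (t j ^ 2) e ((U : Matrix _ _ ℂ) * (1 - P) * (U : Matrix _ _ ℂ)ᴴ) := fun j =>
    (measurable_averagedWeight τ (t j ^ 2) e).comp hcm
  have hfm : ∀ j, Measurable (f j) := fun j => (ham j).const_mul _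
  have hfK : ∀ j, ∫⁻ U, f j U ∂haarUnitary (Fin (m + 1) × Fin (m + 1)) ≤ K := by
    intro j
    have hp : 0 < t j ^ (4 * m) := pow_pos (ht j) _
    have h1 : ENNReal.ofReal (t j ^ (4 * m)) ≠ 0 := by simpa using hp
    simp only [hf]
    rw [lintegral_const_mul _ (ham j), lintegral_haarUnitary_averagedWeight hQ hτ]
    refine (mul_le_mul_right (lintegral_haarUnitary_criticalWeight_le hx hQ hQ2 hr hτ
      (pow_pos (ht j) 2) (hε.trans hεe) he1) _).trans (le_of_eq ?_)
    -- At s = t² the ball in ℂ^(2m) supplies t^(4m), which cancels the normalisation and makes the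
    -- bound independent of t.
    have h2 : ∀ a b c d : ℝ, (a ^ 2 / b) ^ (2 * m) / c * d = a ^ (4 * m) *
        ((1 / b) ^ (2 * m) / c * d) := by
      intro a b c d
      rw [div_pow, div_pow, one_pow, ← pow_mul, show 2 * (2 * m) = 4 * m by ring]
      ring
    rw [h2, ENNReal.ofReal_mul hp.le, mul_assoc, ← mul_assoc,
      ENNReal.inv_mul_cancel h1 ENNReal.ofReal_ne_top, one_mul]
  have hsub : {U : Matrix.unitaryGroup (Fin (m + 1) × Fin (m + 1)) ℂ | 1 - ε ≤
        maxProductOverlap ((U : Matrix _ _ ℂ) * P * (U : Matrix _ _ ℂ)ᴴ)} ⊆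
      {U | ENNReal.ofReal ((m.factorial : ℝ) ^ 2 / (2 * m).factorial) ≤
        liminf (fun j => f j U) atTop} := by
    intro U hU
    have hUU : (U : Matrix (Fin (m + 1) × Fin (m + 1)) (Fin (m + 1) × Fin (m + 1)) ℂ) *
        (U : Matrix (Fin (m + 1) × Fin (m + 1)) (Fin (m + 1) × Fin (m + 1)) ℂ)ᴴ = 1 :=
      Unitary.coe_mul_star_self U
    have h1 : (U : Matrix _ _ ℂ) * (1 - P) * (U : Matrix _ _ ℂ)ᴴ =
        1 - (U : Matrix _ _ ℂ) * P * (U : Matrix _ _ ℂ)ᴴ := by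
      rw [Matrix.mul_sub, Matrix.sub_mul, Matrix.mul_one, hUU]
    have h2 : ((U : Matrix _ _ ℂ) * (1 - P) * (U : Matrix _ _ ℂ)ᴴ).PosSemidef := by
      have h3 := Matrix.posSemidef_self_mul_conjTranspose (1 - P)
      rw [hQ, hQ2] at h3
      exact h3.mul_mul_conjTranspose_same _
    have h4 := le_liminf_averagedWeight_of_le_maxProductOverlap (h1 ▸ h2) hU hτ hεe ht ht0
    simpa only [hf, h1, Set.mem_ofPred_eq] using h4
  calc _ ≤ ENNReal.ofReal ((m.factorial : ℝ) ^ 2 / (2 * m).factorial) *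
        haarUnitary (Fin (m + 1) × Fin (m + 1)) {U |
          ENNReal.ofReal ((m.factorial : ℝ) ^ 2 / (2 * m).factorial) ≤
            liminf (fun j => f j U) atTop} := by gcongr
    _ ≤ ∫⁻ U, liminf (fun j => f j U) atTop ∂haarUnitary (Fin (m + 1) × Fin (m + 1)) :=
        mul_meas_ge_le_lintegral (Measurable.liminf hfm) _
    _ ≤ liminf (fun j => ∫⁻ U, f j U ∂haarUnitary (Fin (m + 1) × Fin (m + 1))) atTop :=
        lintegral_liminf_le hfm
    _ ≤ K := by
        refine (liminf_le_liminf (v := fun _ => K) (Eventually.of_forall hfK)).trans ?_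
        rw [liminf_const]

theorem measureReal_maxProductOverlap_le (hx : x ≤ m * m) (hx0 : 0 < x) (hP : P.IsHermitian)
    (hP2 : P * P = P) (hr : (1 - P).rank = 2 * m + x) {ε : ℝ} (hε : 0 < ε) (hε1 : ε < 1) :
    (haarUnitary (Fin (m + 1) × Fin (m + 1))).real {U | 1 - ε ≤
        maxProductOverlap ((U : Matrix _ _ ℂ) * P * (U : Matrix _ _ ℂ)ᴴ)} ≤
      m.centralBinom * (2 * m + x).choose x * (m * m).choose x * (ε ^ x / (1 - ε) ^ (4 * m + x)) := by
  set S := {U : Matrix.unitaryGroup (Fin (m + 1) × Fin (m + 1)) ℂ | 1 - ε ≤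
        maxProductOverlap ((U : Matrix _ _ ℂ) * P * (U : Matrix _ _ ℂ)ᴴ)} with hS
  set D : ℕ := (2 * m + x).descFactorial (2 * m) * (m * m).descFactorial x with hD
  set g : ℝ → ℝ := fun e => (1 / (1 - e) ^ 2) ^ (2 * m) / (2 * m).factorial *
        ((e / (1 - e)) ^ x / x.factorial) with hg
  set c : ℝ := (m.factorial : ℝ) ^ 2 / (2 * m).factorial with hc
  have hc0 : 0 < c := by positivity
  have h1 : ∀ e, ε < e → e < 1 →
      c * (haarUnitary (Fin (m + 1) × Fin (m + 1))).real S ≤ g e * D := by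
    intro e he he1
    have hg0 : 0 ≤ g e := by
      have : 0 < 1 - e := by linarith
      have : 0 < e := by linarith
      positivity
    -- The limit τ → 0 is taken at fixed e; the probability does not involve τ.
    have hlim := tendsto_lintegral_regularisedWeight (T := Fin m ⊕ Fin m) (X := Fin x)
      (R := Fin m × Fin m) (by simpa using hx0) (by simpa using hx)
    have h2 := ge_of_tendsto' (ENNReal.Tendsto.const_mul (a := ENNReal.ofReal (g e)) hlim
      (Or.inr ENNReal.ofReal_ne_top)) fun j => mul_measure_le_regularised hx hP hP2 hr hε he he1
        (τ := 1 / ((j : ℝ) + 1)) Nat.one_div_pos_of_nat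
    have h3 := lintegral_regularisedWeight_zero_le (T := Fin m ⊕ Fin m) (X := Fin x)
      (R := Fin m × Fin m) (by simpa using hx)
    have h4 : ENNReal.ofReal c * haarUnitary (Fin (m + 1) × Fin (m + 1)) S ≤
        ENNReal.ofReal (g e) * (D : ENNReal) := by
      refine h2.trans (mul_le_mul_right (h3.trans (le_of_eq ?_)) _)
      simp only [Fintype.card_sum, Fintype.card_prod, Fintype.card_fin, ← two_mul, hD, Nat.cast_mul]
    have h5 := ENNReal.toReal_mono (ENNReal.mul_ne_top ENNReal.ofReal_ne_top
      (ENNReal.natCast_ne_top D)) h4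
    rwa [ENNReal.toReal_mul, ENNReal.toReal_mul, ENNReal.toReal_ofReal hc0.le,
      ENNReal.toReal_ofReal hg0, ENNReal.toReal_natCast] at h5
  have hgc : ContinuousAt (fun e => g e * D) ε := by
    have : 1 - ε ≠ 0 := by linarith
    simp only [hg]
    have hp : (1 - ε) ^ 2 ≠ 0 := pow_ne_zero 2 this
    fun_prop (disch := assumption)
  -- The cut-off in the weight is strict, so the bound is available only for e > ε; continuity in e
  -- gives it at ε.
  have h2 : c * (haarUnitary (Fin (m + 1) × Fin (m + 1))).real S ≤ g ε * D := by
    refine ge_of_tendsto (hgc.tendsto.mono_left (nhdsWithin_le_nhds (s := Set.Ioi ε))) ?_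
    filter_upwards [Ioo_mem_nhdsGT hε1] with e he using h1 e he.1 he.2
  have h3 : g ε * D = c * (m.centralBinom * (2 * m + x).choose x * (m * m).choose x *
      (ε ^ x / (1 - ε) ^ (4 * m + x))) := by
    have e1 : ((2 * m).factorial : ℝ) = m.centralBinom * (m.factorial : ℝ) ^ 2 := by
      have := Nat.choose_mul_factorial_mul_factorial (show m ≤ 2 * m by omega)
      rw [show 2 * m - m = m by omega] at this
      rw [Nat.centralBinom, ← this]
      push_cast
      ring
    have e2 : (D : ℝ) = (2 * m).factorial * (2 * m + x).choose x *
        (x.factorial * (m * m).choose x) := by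
      rw [hD, Nat.descFactorial_eq_factorial_mul_choose, Nat.descFactorial_eq_factorial_mul_choose,
        Nat.choose_symm_add]
      push_cast
      ring
    have e3 : 1 - ε ≠ 0 := by linarith
    have e4 : (m.factorial : ℝ) ≠ 0 := by positivity
    have e5 : (x.factorial : ℝ) ≠ 0 := by positivity
    have e6 : (m.centralBinom : ℝ) ≠ 0 := by exact_mod_cast (Nat.centralBinom_pos m).ne'
    simp only [hg, hc]
    rw [e2, e1, div_pow, div_pow, one_pow, ← pow_mul, show 2 * (2 * m) = 4 * m by ring, pow_add]
    field_simp
  rw [h3] at h2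
  exact le_of_mul_le_mul_left h2 hc0

end TailBound

/-! ### Numerical estimates -/

section Numerics

theorem choose_mul_choose_succ_le {m x M : ℕ}
    (h : (2 * m + x + 1) * (m * m - x) ≤ (x + 1) ^ 2 * M) :
    (2 * m + (x + 1)).choose (x + 1) * (m * m).choose (x + 1) ≤
      (2 * m + x).choose x * (m * m).choose x * M := by
  have h1 : (2 * m + (x + 1)).choose (x + 1) * (x + 1) = (2 * m + x + 1) * (2 * m + x).choose x :=
    (Nat.add_one_mul_choose_eq (2 * m + x) x).symm
  have h2 : (m * m).choose (x + 1) * (x + 1) = (m * m).choose x * (m * m - x) :=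
    Nat.choose_succ_right_eq _ _
  refine Nat.le_of_mul_le_mul_left (?_ : (x + 1) ^ 2 * _ ≤ (x + 1) ^ 2 * _) (by positivity)
  calc (x + 1) ^ 2 * ((2 * m + (x + 1)).choose (x + 1) * (m * m).choose (x + 1)) =
        ((2 * m + (x + 1)).choose (x + 1) * (x + 1)) * ((m * m).choose (x + 1) * (x + 1)) := by ring
    _ = ((2 * m + x).choose x * (m * m).choose x) * ((2 * m + x + 1) * (m * m - x)) := by
        rw [h1, h2]; ring
    _ ≤ ((2 * m + x).choose x * (m * m).choose x) * ((x + 1) ^ 2 * M) := by gcongr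
    _ = (x + 1) ^ 2 * ((2 * m + x).choose x * (m * m).choose x * M) := by ring

/-- The ratio of consecutive terms is at most m(m+2) once x ≥ 3. At x = 3 the inequality used for
this reads (2m+4)m ≤ 16(m+2), that is m ≤ 8, which fixes the range of m treated this way. -/
theorem choose_bound_of_three_le {m x c c' : ℕ} (hm : m ≤ 8) (hx : 3 ≤ x)
    (h : c * ((2 * m + 3).choose 3 * (m * m).choose 3) ≤ c' * (m * (m + 2)) ^ 3) :
    c * ((2 * m + x).choose x * (m * m).choose x) ≤ c' * (m * (m + 2)) ^ x := by
  induction x, hx using Nat.le_induction with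
  | base => exact h
  | succ x hx ih =>
    have h1 : (2 * m + x + 1) * (m * m - x) ≤ (x + 1) ^ 2 * (m * (m + 2)) := by
      have h2 : (2 * m + x + 1) * m ≤ (x + 1) ^ 2 * (m + 2) := by
        interval_cases m <;> nlinarith
      calc (2 * m + x + 1) * (m * m - x) ≤ (2 * m + x + 1) * (m * m) := by gcongr; omega
        _ = ((2 * m + x + 1) * m) * m := by ring
        _ ≤ ((x + 1) ^ 2 * (m + 2)) * m := by gcongr
        _ = _ := by ring
    calc _ ≤ c * ((2 * m + x).choose x * (m * m).choose x * (m * (m + 2))) := by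
          exact Nat.mul_le_mul_left c (choose_mul_choose_succ_le h1)
      _ = c * ((2 * m + x).choose x * (m * m).choose x) * (m * (m + 2)) := by ring
      _ ≤ c' * (m * (m + 2)) ^ x * (m * (m + 2)) := by gcongr
      _ = _ := by ring

theorem choose_bound_small {m x : ℕ} (hm : m ≤ 8) (hx : 1 ≤ x) (h : 3 ≤ m ∨ m = 2 ∧ 2 ≤ x) :
    m.centralBinom * ((m + 1) ^ 2) ^ (4 * m) * ((2 * m + x).choose x * (m * m).choose x) ≤
      (m + 1) ^ (m + 1) * (m * (m + 2)) ^ (4 * m) * (m * (m + 2)) ^ x := by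
  have hm2 : 2 ≤ m := by omega
  rcases lt_or_ge x 3 with hx3 | hx3
  · interval_cases m <;> interval_cases x <;> simp_all [Nat.centralBinom, Nat.choose]
  · refine choose_bound_of_three_le hm hx3 ?_
    interval_cases m <;> simp [Nat.centralBinom, Nat.choose]

/-- The binomial coefficient appears in one term of (1/4 + 3/4)^(2m+x) = 1. The weight 1/4 balances
the loss 4^x, later absorbed by x!, against the loss (16/9)^m. -/
theorem choose_le_four_pow (m x : ℕ) :
    ((2 * m + x).choose x : ℝ) ≤ 4 ^ x * (16 / 9) ^ m := by
  have h1 := add_pow (1 / 4 : ℝ) (3 / 4) (2 * m + x)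
  have h2 := Finset.single_le_sum (f := fun k => (1 / 4 : ℝ) ^ k * (3 / 4) ^ (2 * m + x - k) *
    (2 * m + x).choose k) (s := Finset.range (2 * m + x + 1)) (fun k _ => by positivity)
    (Finset.mem_range.2 (show x < 2 * m + x + 1 by omega))
  rw [← h1] at h2
  norm_num at h2
  have h3 : (4 : ℝ) ^ x * (16 / 9) ^ m * ((1 / 4) ^ x * (9 / 16) ^ m) = 1 := by
    rw [mul_mul_mul_comm, ← mul_pow, ← mul_pow]
    norm_num
  rw [pow_mul] at h2
  norm_num at h2
  calc ((2 * m + x).choose x : ℝ) = 4 ^ x * (16 / 9) ^ m *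
        ((1 / 4) ^ x * (9 / 16) ^ m * (2 * m + x).choose x) := by rw [← mul_assoc, h3, one_mul]
    _ ≤ 4 ^ x * (16 / 9) ^ m * 1 := by gcongr
    _ = _ := mul_one _

theorem pow_bound_large {m : ℕ} (hm : 9 ≤ m) :
    (82 : ℝ) * (64 / 9) ^ m ≤ (m + 1) ^ (m + 1) := by
  induction m, hm using Nat.le_induction with
  | base => norm_num
  | succ m hm ih =>
    have h1 : (9 : ℝ) ≤ m := by exact_mod_cast hm
    calc (82 : ℝ) * (64 / 9) ^ (m + 1) = 82 * (64 / 9) ^ m * (64 / 9) := by ring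
      _ ≤ (m + 1) ^ (m + 1) * (m + 1 + 1) := by gcongr; linarith
      _ ≤ (m + 1 + 1) ^ (m + 1) * (m + 1 + 1) := by gcongr; linarith
      _ = _ := by push_cast; ring

/-- The central binomial is at most 4^m, which with (16/9)^m gives (64/9)^m. The factor 4^x/x! is at
most e⁴, and replacing (m+1)² by m(m+2) in the power 4m costs at most e^(4/11). Since e^(4+4/11) ≤
82, it remains that 82(64/9)^m ≤ (m+1)^(m+1), which holds from m = 9 on. -/
theorem choose_bound_large {m x : ℕ} (hm : 9 ≤ m) :
    (m.centralBinom : ℝ) * ((m + 1) ^ 2) ^ (4 * m) * ((2 * m + x).choose x * (m * m).choose x) ≤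
      (m + 1) ^ (m + 1) * (m * (m + 2)) ^ (4 * m) * (m * (m + 2)) ^ x := by
  have hm' : (9 : ℝ) ≤ m := by exact_mod_cast hm
  have h1 : (m.centralBinom : ℝ) ≤ 4 ^ m := by
    have := Nat.choose_le_two_pow (2 * m) m
    rw [pow_mul] at this
    exact_mod_cast this
  have h2 := choose_le_four_pow m x
  have h3 : ((m * m).choose x : ℝ) ≤ (m * (m + 2)) ^ x / x.factorial := by
    refine (Nat.choose_le_pow_div (α := ℝ) x (m * m)).trans ?_
    push_cast
    gcongr
    linarith
  have h4 : ((m : ℝ) + 1) ^ 2 ≤ Real.exp (1 / (m * (m + 2))) * (m * (m + 2)) := by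
    have := Real.add_one_le_exp (1 / ((m : ℝ) * (m + 2)))
    calc ((m : ℝ) + 1) ^ 2 = (1 / (m * (m + 2)) + 1) * (m * (m + 2)) := by field_simp; ring
      _ ≤ _ := by gcongr
  -- The exponent is 4m/(m(m+2)) = 4/(m+2), at most 4/11 for m ≥ 9.
  have h5 : (((m : ℝ) + 1) ^ 2) ^ (4 * m) ≤ Real.exp (4 / 11) * (m * (m + 2)) ^ (4 * m) := by
    calc (((m : ℝ) + 1) ^ 2) ^ (4 * m) ≤
          (Real.exp (1 / (m * (m + 2))) * (m * (m + 2))) ^ (4 * m) := by gcongr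
      _ = Real.exp (4 / (m + 2)) * (m * (m + 2)) ^ (4 * m) := by
          rw [mul_pow, ← Real.exp_nat_mul]
          congr 2
          push_cast
          field_simp
      _ ≤ _ := by gcongr; linarith
  have h6 : (4 : ℝ) ^ x / x.factorial ≤ Real.exp 4 := Real.pow_div_factorial_le_exp 4
    (by norm_num) x
  have h7 : Real.exp (4 / 11) * Real.exp 4 ≤ 82 := by
    rw [← Real.exp_add]
    -- The exponent 4 + 4/11 equals 48/11; raising to the eleventh power reduces the claim to
    -- 2.72^48 ≤ 82^11.
    refine (pow_le_pow_iff_left₀ (Real.exp_pos _).le (by norm_num) (n := 11) (by norm_num)).1 ?_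
    rw [← Real.exp_nat_mul]
    have h8 : ((11 : ℕ) : ℝ) * (4 / 11 + 4) = ((48 : ℕ) : ℝ) * 1 := by norm_num
    rw [h8, Real.exp_nat_mul]
    calc Real.exp 1 ^ 48 ≤ 2.72 ^ 48 := by
          gcongr
          exact Real.exp_one_lt_d9.le.trans (by norm_num)
      _ ≤ 82 ^ 11 := by norm_num
  calc _ ≤ (4 : ℝ) ^ m * (Real.exp (4 / 11) * (m * (m + 2)) ^ (4 * m)) *
        (4 ^ x * (16 / 9) ^ m * ((m * (m + 2)) ^ x / x.factorial)) := by gcongr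
    _ = Real.exp (4 / 11) * (4 ^ x / x.factorial) * (4 ^ m * (16 / 9) ^ m) *
        ((m * (m + 2)) ^ (4 * m) * (m * (m + 2)) ^ x) := by ring
    _ ≤ 82 * (64 / 9) ^ m * ((m * (m + 2)) ^ (4 * m) * (m * (m + 2)) ^ x) := by
        rw [← mul_pow]
        norm_num only
        gcongr
        exact (mul_le_mul_of_nonneg_left h6 (Real.exp_pos _).le).trans h7
    _ ≤ (m + 1) ^ (m + 1) * ((m * (m + 2)) ^ (4 * m) * (m * (m + 2)) ^ x) := by
        gcongr
        exact pow_bound_large hm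
    _ = _ := by ring

theorem choose_bound {m x : ℕ} (hx : 1 ≤ x) (h : 3 ≤ m ∨ m = 2 ∧ 2 ≤ x) :
    (m.centralBinom : ℝ) * ((m + 1) ^ 2) ^ (4 * m) * ((2 * m + x).choose x * (m * m).choose x) ≤
      (m + 1) ^ (m + 1) * (m * (m + 2)) ^ (4 * m) * (m * (m + 2)) ^ x := by
  rcases le_or_gt m 8 with hm | hm
  · exact_mod_cast choose_bound_small hm hx h
  · exact choose_bound_large hm

/-- The choice of ε gives ε^x = d^(-2x) d^(-d) d^(-d), and ε ≤ d^(-2) gives 1 - ε ≥ m(m+2)/d². One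
factor d^(-d) is the claim and the other pays for the binomials through `choose_bound`. -/
theorem tail_bound_le {m x : ℕ} (hm : 1 ≤ m) (hx : 1 ≤ x) (hxm : x ≤ m * m) {ε : ℝ}
    (hε : ε = ((m : ℝ) + 1) ^ (-2 - 2 * ((m : ℝ) + 1) / x)) :
    (m.centralBinom : ℝ) * (2 * m + x).choose x * (m * m).choose x *
      (ε ^ x / (1 - ε) ^ (4 * m + x)) ≤ (((m : ℝ) + 1) ^ (m + 1))⁻¹ := by
  have hd : (0 : ℝ) < (m : ℝ) + 1 := by positivity
  have hd1 : (1 : ℝ) ≤ (m : ℝ) + 1 := by linarith [(Nat.cast_nonneg m : (0 : ℝ) ≤ m)]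
  have hm' : (1 : ℝ) ≤ m := by exact_mod_cast hm
  have hx' : (x : ℝ) ≠ 0 := by positivity
  have hεx : ε ^ x = ((((m : ℝ) + 1) ^ 2) ^ x)⁻¹ * (((m : ℝ) + 1) ^ (m + 1))⁻¹ *
      (((m : ℝ) + 1) ^ (m + 1))⁻¹ := by
    rw [hε, ← Real.rpow_natCast, ← Real.rpow_mul hd.le, ← mul_inv, ← mul_inv, ← pow_mul, ← pow_add,
      ← pow_add, ← Real.rpow_natCast, ← Real.rpow_neg hd.le]
    congr 1
    push_cast
    field_simp
    ring
  have hε0 : 0 < ε := hε ▸ Real.rpow_pos_of_pos hd _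
  have hε1 : ε ≤ (((m : ℝ) + 1) ^ 2)⁻¹ := by
    rw [hε, ← Real.rpow_natCast, ← Real.rpow_neg hd.le]
    refine Real.rpow_le_rpow_of_exponent_le hd1 ?_
    push_cast
    have : 0 ≤ 2 * ((m : ℝ) + 1) / x := by positivity
    linarith
  by_cases h : 3 ≤ m ∨ m = 2 ∧ 2 ≤ x
  · have h1 := choose_bound hx h
    have h2 : (m : ℝ) * (m + 2) / ((m : ℝ) + 1) ^ 2 ≤ 1 - ε := by
      have : (m : ℝ) * (m + 2) / ((m : ℝ) + 1) ^ 2 = 1 - (((m : ℝ) + 1) ^ 2)⁻¹ := by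
        field_simp
        ring
      linarith
    have h3 : 0 < (m : ℝ) * (m + 2) / ((m : ℝ) + 1) ^ 2 := by positivity
    calc _ ≤ (m.centralBinom : ℝ) * (2 * m + x).choose x * (m * m).choose x *
          (ε ^ x / ((m : ℝ) * (m + 2) / ((m : ℝ) + 1) ^ 2) ^ (4 * m + x)) := by gcongr
      _ = ((m.centralBinom : ℝ) * ((m + 1) ^ 2) ^ (4 * m) * ((2 * m + x).choose x *
            (m * m).choose x)) / ((m * (m + 2)) ^ (4 * m) * (m * (m + 2)) ^ x) *
              ((((m : ℝ) + 1) ^ (m + 1))⁻¹ * (((m : ℝ) + 1) ^ (m + 1))⁻¹) := by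
          rw [hεx, div_pow, pow_add, pow_add]
          field_simp
          ring
      _ ≤ ((m + 1) ^ (m + 1) * (m * (m + 2)) ^ (4 * m) * (m * (m + 2)) ^ x) /
            ((m * (m + 2)) ^ (4 * m) * (m * (m + 2)) ^ x) *
              ((((m : ℝ) + 1) ^ (m + 1))⁻¹ * (((m : ℝ) + 1) ^ (m + 1))⁻¹) := by gcongr
      _ = _ := by field_simp
  -- For (m, x) = (1, 1) and (2, 1) the estimate 1 - ε ≥ m(m+2)/d² is too weak, and the exact values
  -- ε = 1/64 and ε = 1/6561 are used.
  · have h1 : x = 1 ∧ (m = 1 ∨ m = 2) := by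
      have : m ≤ 2 := by omega
      interval_cases m <;> omega
    obtain ⟨rfl, rfl | rfl⟩ := h1
    · have h2 : ε = 1 / 64 := by
        rw [pow_one] at hεx
        rw [hεx]
        norm_num
      rw [h2]
      norm_num [Nat.centralBinom, Nat.choose]
    · have h2 : ε = 1 / 6561 := by
        rw [pow_one] at hεx
        rw [hεx]
        norm_num
      rw [h2]
      norm_num [Nat.centralBinom, Nat.choose]

end Numerics

end

theorem mainTheorem10 (d x r : ℕ) (hd : 1 ≤ d) (hx : 1 ≤ x)
    (hr : (r : ℤ) = (d : ℤ) ^ 2 - 2 * ((d : ℤ) - 1) - (x : ℤ))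
    (P₀ : Matrix (Fin d × Fin d) (Fin d × Fin d) ℂ)
    (hP₀ : IsStarProjection P₀) (hrank : P₀.rank = r) :
    (haarUnitary (Fin d × Fin d)).real
        {U | 1 - (d : ℝ) ^ (-2 - 2 * (d : ℝ) / (x : ℝ)) ≤
          maxProductOverlap
            ((U : Matrix (Fin d × Fin d) (Fin d × Fin d) ℂ) * P₀ *
              (U : Matrix (Fin d × Fin d) (Fin d × Fin d) ℂ)ᴴ)} ≤
      (d : ℝ) ^ (-(d : ℝ)) := by
  obtain ⟨m, rfl⟩ : ∃ m, d = m + 1 := ⟨d - 1, by omega⟩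
  -- For d = 1 the right side is 1 and any probability satisfies the bound.
  rcases Nat.eq_zero_or_pos m with rfl | hm
  · refine measureReal_le_one.trans ?_
    simp
  have hP : P₀.IsHermitian := hP₀.isSelfAdjoint
  have hP2 : P₀ * P₀ = P₀ := hP₀.isIdempotentElem
  have hsum : r + (2 * m + x) = (m + 1) * (m + 1) := by
    zify
    push_cast at hr
    linarith
  have hd1 : (1 : ℝ) < ((m + 1 : ℕ) : ℝ) := by exact_mod_cast Nat.lt_add_of_pos_left hm
  set ε : ℝ := ((m + 1 : ℕ) : ℝ) ^ (-2 - 2 * ((m + 1 : ℕ) : ℝ) / (x : ℝ)) with hε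
  have hε0 : 0 < ε := Real.rpow_pos_of_pos (by linarith) _
  have hε1 : ε < 1 := by
    refine Real.rpow_lt_one_of_one_lt_of_neg hd1 ?_
    have : 0 ≤ 2 * ((m + 1 : ℕ) : ℝ) / (x : ℝ) := by positivity
    linarith
  -- The tail bound needs x ≤ m², which is the same as r ≥ 1 because r = m² + 1 - x. For r = 0 the
  -- projector vanishes and all overlaps are 0 < 1 - ε, so the event is empty.
  rcases Nat.eq_zero_or_pos r with hr0 | hr0
  · have hP0 : P₀ = 0 := by
      have h1 : P₀.trace = 0 := by
        rw [trace_eq_rank_of_projection hP hP2, hrank, hr0, Nat.cast_zero]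
      have h2 : P₀ᴴ * P₀ = P₀ := by rw [hP.eq, hP2]
      exact Matrix.trace_conjTranspose_mul_self_eq_zero_iff.1 (by rw [h2, h1])
    have hempty : {U : Matrix.unitaryGroup (Fin (m + 1) × Fin (m + 1)) ℂ | 1 - ε ≤
        maxProductOverlap ((U : Matrix _ _ ℂ) * P₀ * (U : Matrix _ _ ℂ)ᴴ)} = ∅ := by
      refine Set.eq_empty_of_forall_notMem fun U hU => ?_
      obtain ⟨⟨φ, ψ, -, -, h⟩, -⟩ := isGreatest_maxProductOverlap
        ((U : Matrix (Fin (m + 1) × Fin (m + 1)) (Fin (m + 1) × Fin (m + 1)) ℂ) * P₀ *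
          (U : Matrix (Fin (m + 1) × Fin (m + 1)) (Fin (m + 1) × Fin (m + 1)) ℂ)ᴴ)
      rw [Set.mem_ofPred_eq, ← h, hP0] at hU
      simp only [productOverlap, Matrix.mul_zero, Matrix.zero_mul, Matrix.trace_zero,
        Complex.zero_re] at hU
      linarith
    rw [hempty, measureReal_empty]
    positivity
  · have hxm : x ≤ m * m := by nlinarith
    have hQr : (1 - P₀).rank = 2 * m + x := by
      have := rank_one_sub_of_projection hP hP2
      rw [hrank, Fintype.card_prod, Fintype.card_fin] at this
      omega
    refine (measureReal_maxProductOverlap_le hxm hx hP hP2 hQr hε0 hε1).trans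
      ((tail_bound_le hm hx hxm (by rw [hε]; push_cast; rfl)).trans (le_of_eq ?_))
    rw [Real.rpow_neg (by positivity), Real.rpow_natCast]
    push_cast
    rfl
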